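/- Conventions. Manifolds are smooth, finite-dimensional, Hausdorff and second countable. A Jacobi manifold $(P,L,\{\cdot,\cdot\})$ is a manifold $P$ with a real line bundle $L\to P$ and a Lie bracket on $\Gamma(L)$ which is local, i.e. $\mathrm{supp}\{u,v\}\subset\mathrm{supp}(u)\cap\mathrm{supp}(v)$. Its anchor $\rho_P:J^1L\to TP$ on the first jet bundle is the bundle map determined by $\{u,fv\}=f\{u,v\}+df(\rho_P(j^1u))\,v$ for $u,v\in\Gamma(L)$, $f\in C^\infty(P)$. A contact manifold $(M,H)$ is a manifold with a hyperplane distribution $H=\ker\theta$, where $\theta\in\Omega^1(M,L_M)$ is pointwise surjective, takes values in a line bundle $L_M\cong TM/H$, and $(X,Y)\mapsto\theta([X,Y])$ is fibrewise non-degenerate on $H$. The Reeb vector field $R_u$ of $u\in\Gamma(L_M)$ is the unique vector field with $\theta(R_u)=u$ and $[R_u,\Gamma(H)]\subset\Gamma(H)$, and $\{u,v\}_M=\theta([R_u,R_v])$ is the associated Jacobi structure, with anchor $\rho_M$. A contact isotropic realisation of $(P,L,\{\cdot,\cdot\})$ is a surjective submersion $\phi:M\to P$ with compact connected fibres from a contact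 manifold $(M,H)$, together with an isomorphism of line bundles $F:\phi^*L\to L_M$, such that - $\{F\circ\phi^*u,F\circ\phi^*v\}_M=F\circ\phi^*\{u,v\}$ for all $u,v\in\Gamma(L)$; - $H+\ker D\phi=TM$; - $\ker D\phi\subset\rho_M(\phi^*J^1L)$, where $\phi^*J^1L$ is embedded in $J^1L_M$ by $j^1u\mapsto j^1(F\circ\phi^*u)$. Let $k=\dim M-\dim P$. For $\alpha\in\ker\rho_P$ over $p\in P$, choose $u\in\Gamma(L)$ with $j^1_pu=\alpha$; the vector field $R_{F\circ\phi^*u}$ is tangent to $\phi^{-1}(p)$, its restriction to $\phi^{-1}(p)$ depends only on $\alpha$, and $\varphi^1_\alpha:\phi^{-1}(p)\to\phi^{-1}(p)$ denotes its time-one flow. The period lattice is $\Sigma=\{\alpha\in\ker\rho_P\mid\varphi^1_\alpha=\mathrm{id}\}$, and $\ker\rho_P/\Sigma$ is the fibrewise quotient, with projection $\pi$ to $P$. Theorem. Let $\phi:(M,H)\to(P,L,\{\cdot,\cdot\})$ be a contact isotropic realisation with period lattice $\Sigma$. Then $\ker\rho_P$ is an embedded submanifold of $J^1L$ of dimension $\dim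 P+k$, and: 1. $\Sigma$ is a closed embedded submanifold of $\ker\rho_P$ (of dimension $\dim P$). 2. The quotient space $\ker\rho_P/\Sigma$ is a smooth manifold, for a smooth structure for which the quotient map from $\ker\rho_P$ is a local diffeomorphism, and $\pi:\ker\rho_P/\Sigma\to P$ is a smooth fibre bundle with fibre the torus $\mathbb T^k$. 3. For every open $U\subset P$ and every smooth section $\sigma:U\to M$ of $\phi$ over $U$, the map $$\Psi_\sigma:(\ker\rho_P/\Sigma)|_U\to\phi^{-1}(U),\qquad[\alpha]\mapsto\varphi^1_\alpha(\sigma(\pi(\alpha)))$$ is well defined and is an isomorphism of fibre bundles over $U$, i.e. a diffeomorphism with $\phi\circ\Psi_\sigma=\pi$. -/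

import Mathlib

open Set Bundle Manifold Topology
open scoped Manifold Bundle ContDiff Topology

noncomputable section

namespace ContactRealisation

/-! ## The first jet bundle of a line bundle -/

section Jet

variable {E : Type*} [NormedAddCommGroup E] [NormedSpace ℝ E]
  {P : Type*} [TopologicalSpace P] [ChartedSpace E P]
  (L : P → Type*) [TopologicalSpace (TotalSpace ℝ L)] [∀ p, TopologicalSpace (L p)]
  [∀ p, AddCommGroup (L p)] [∀ p, Module ℝ (L p)] [FiberBundle ℝ L] [VectorBundle ℝ ℝ L]

/-- The transition function at `x` from the preferred trivialisation of `L` at `i` to the one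
at `j`: if a section reads `u` in the first one, it reads `transition i j * u` in the second. -/
def transition (i j x : P) : ℝ :=
  (trivializationAt ℝ L i).coordChangeL ℝ (trivializationAt ℝ L j) x 1

variable (E) in
/-- The differential at `x` of the transition function, in the preferred chart at `i`. -/
def dTransition (i j x : P) : E →L[ℝ] ℝ :=
  fderiv ℝ (fun y => transition L i j ((chartAt E i).symm y)) (chartAt E i x)

/-- The set over which both the preferred chart and trivialisation at `i` are defined. -/
def jetBaseSet (E : Type*) [NormedAddCommGroup E] [NormedSpace ℝ E]
    {P : Type*} [TopologicalSpace P] [ChartedSpace E P]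
    (L : P → Type*) [TopologicalSpace (TotalSpace ℝ L)] [∀ p, TopologicalSpace (L p)]
    [FiberBundle ℝ L] (i : P) : Set P :=
  (chartAt E i).source ∩ (trivializationAt ℝ L i).baseSet

theorem isOpen_jetBaseSet (E : Type*) [NormedAddCommGroup E] [NormedSpace ℝ E]
    {P : Type*} [TopologicalSpace P] [ChartedSpace E P]
    (L : P → Type*) [TopologicalSpace (TotalSpace ℝ L)] [∀ p, TopologicalSpace (L p)]
    [FiberBundle ℝ L] (i : P) : IsOpen (jetBaseSet E L i) :=
  (chartAt E i).open_source.inter (trivializationAt ℝ L i).open_baseSet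

theorem transition_mul {i j x : P} (hi : x ∈ (trivializationAt ℝ L i).baseSet)
    (hj : x ∈ (trivializationAt ℝ L j).baseSet) (l : L x) :
    transition L i j x * (trivializationAt ℝ L i ⟨x, l⟩).2 = (trivializationAt ℝ L j ⟨x, l⟩).2 := by
  have h := (trivializationAt ℝ L i).coordChangeL_apply (R := ℝ) (trivializationAt ℝ L j) ⟨hi, hj⟩
    (trivializationAt ℝ L i ⟨x, l⟩).2
  rw [(trivializationAt ℝ L i).symm_apply_apply_mk hi] at h
  rw [← h, transition, mul_comm, ← smul_eq_mul, ← map_smul, smul_eq_mul, mul_one]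

theorem transition_comp {i j k x : P} (hi : x ∈ (trivializationAt ℝ L i).baseSet)
    (hj : x ∈ (trivializationAt ℝ L j).baseSet) (hk : x ∈ (trivializationAt ℝ L k).baseSet) :
    transition L j k x * transition L i j x = transition L i k x := by
  have e : (trivializationAt ℝ L i ⟨x, (trivializationAt ℝ L i).symm x 1⟩).2 = 1 := by
    rw [(trivializationAt ℝ L i).apply_mk_symm hi]
  have h1 := transition_mul L hi hj ((trivializationAt ℝ L i).symm x 1)
  have h2 := transition_mul L hj hk ((trivializationAt ℝ L i).symm x 1)
  have h3 := transition_mul L hi hk ((trivializationAt ℝ L i).symm x 1)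
  rw [e, mul_one] at h1 h3
  rw [h1, h2, h3]

theorem transition_self {i x : P} (hi : x ∈ (trivializationAt ℝ L i).baseSet) :
    transition L i i x = 1 := by
  have e : (trivializationAt ℝ L i ⟨x, (trivializationAt ℝ L i).symm x 1⟩).2 = 1 := by
    rw [(trivializationAt ℝ L i).apply_mk_symm hi]
  have h1 := transition_mul L hi hi ((trivializationAt ℝ L i).symm x 1)
  rwa [e, mul_one] at h1

variable (E)

theorem contMDiffOn_transition [ContMDiffVectorBundle ∞ ℝ L 𝓘(ℝ, E)] (i j : P) :
    ContMDiffOn 𝓘(ℝ, E) 𝓘(ℝ, ℝ) ∞ (transition L i j)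
      ((trivializationAt ℝ L i).baseSet ∩ (trivializationAt ℝ L j).baseSet) :=
  (contMDiffOn_coordChangeL (IB := 𝓘(ℝ, E)) (n := ∞) (trivializationAt ℝ L i)
    (trivializationAt ℝ L j)).clm_apply contMDiffOn_const


variable [IsManifold 𝓘(ℝ, E) ∞ P]

/-- The change of coordinates of 1-jets at `x`. In the preferred chart and trivialisation at `i`
the 1-jet of a section is the pair (value, derivative); by the product and the chain rule it is
transformed to the ones at `j` by `(a, A) ↦ (g a, (g A + a dg) ∘ D(κᵢ κⱼ⁻¹))`. -/
def jetCoordChange (i j x : P) : (ℝ × (E →L[ℝ] ℝ)) →L[ℝ] (ℝ × (E →L[ℝ] ℝ)) :=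
  (transition L i j x • ContinuousLinearMap.fst ℝ ℝ (E →L[ℝ] ℝ)).prod
    (((ContinuousLinearMap.compL ℝ E E ℝ).flip (tangentCoordChange 𝓘(ℝ, E) j i x)).comp
      (transition L i j x • ContinuousLinearMap.snd ℝ ℝ (E →L[ℝ] ℝ) +
        (ContinuousLinearMap.fst ℝ ℝ (E →L[ℝ] ℝ)).smulRight (dTransition E L i j x)))

theorem jetCoordChange_apply (i j x : P) (v : ℝ × (E →L[ℝ] ℝ)) :
    jetCoordChange E L i j x v = (transition L i j x * v.1,
      (transition L i j x • v.2 + v.1 • dTransition E L i j x).comp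
        (tangentCoordChange 𝓘(ℝ, E) j i x)) := by
  simp [jetCoordChange]

theorem contDiffAt_transition [ContMDiffVectorBundle ∞ ℝ L 𝓘(ℝ, E)] {i j k x : P}
    (hi : x ∈ (chartAt E i).source)
    (hj : x ∈ (trivializationAt ℝ L j).baseSet) (hk : x ∈ (trivializationAt ℝ L k).baseSet) :
    ContDiffAt ℝ ∞ (fun y => transition L j k ((chartAt E i).symm y)) (chartAt E i x) := by
  rw [← contMDiffAt_iff_contDiffAt]
  have h1 : ContMDiffAt 𝓘(ℝ, E) 𝓘(ℝ, E) ∞ (chartAt E i).symm (chartAt E i x) :=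
    (contMDiffOn_chart_symm (I := 𝓘(ℝ, E)) (n := ∞)).contMDiffAt
      ((chartAt E i).open_target.mem_nhds ((chartAt E i).map_source hi))
  have h2 : ContMDiffAt 𝓘(ℝ, E) 𝓘(ℝ, ℝ) ∞ (transition L j k)
      ((chartAt E i).symm (chartAt E i x)) := by
    rw [(chartAt E i).left_inv hi]
    exact (contMDiffOn_transition E L j k).contMDiffAt
      (((trivializationAt ℝ L j).open_baseSet.inter
        (trivializationAt ℝ L k).open_baseSet).mem_nhds ⟨hj, hk⟩)
  exact h2.comp (chartAt E i x) h1

theorem contMDiffOn_dTransition [ContMDiffVectorBundle ∞ ℝ L 𝓘(ℝ, E)] (i j : P) :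
    ContMDiffOn 𝓘(ℝ, E) 𝓘(ℝ, E →L[ℝ] ℝ) ∞ (dTransition E L i j)
      (jetBaseSet E L i ∩ jetBaseSet E L j) := by
  intro x hx
  have h := (contDiffAt_transition E L hx.1.1 hx.1.2 hx.2.2).fderiv_right (m := ∞) le_rfl
  have h1 : ContMDiffAt 𝓘(ℝ, E) 𝓘(ℝ, E) ∞ (chartAt E i) x :=
    (contMDiffOn_chart (I := 𝓘(ℝ, E)) (n := ∞)).contMDiffAt
      ((chartAt E i).open_source.mem_nhds hx.1.1)
  exact ((contMDiffAt_iff_contDiffAt.2 h).comp x h1).contMDiffWithinAt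

theorem hasFDerivAt_coordChange {i j x : P} (hi : x ∈ (chartAt E i).source)
    (hj : x ∈ (chartAt E j).source) :
    HasFDerivAt (fun y => chartAt E j ((chartAt E i).symm y)) (tangentCoordChange 𝓘(ℝ, E) i j x)
      (chartAt E i x) := by
  have := hasFDerivWithinAt_tangentCoordChange (I := 𝓘(ℝ, E)) (x := i) (y := j) (z := x)
    (by simpa using ⟨hi, hj⟩)
  simpa [Function.comp_def, hasFDerivWithinAt_univ] using! this

/-- The chain rule for the differential of a function read in two charts. -/
theorem fderiv_comp_tangentCoordChange {i j x : P} (hi : x ∈ (chartAt E i).source)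
    (hj : x ∈ (chartAt E j).source) {f : P → ℝ}
    (hf : DifferentiableAt ℝ (fun y => f ((chartAt E i).symm y)) (chartAt E i x)) :
    HasFDerivAt (fun y => f ((chartAt E j).symm y))
      ((fderiv ℝ (fun y => f ((chartAt E i).symm y)) (chartAt E i x)).comp
        (tangentCoordChange 𝓘(ℝ, E) j i x)) (chartAt E j x) := by
  have h := hasFDerivAt_coordChange E hj hi
  have hf' := hf.hasFDerivAt
  have e : chartAt E i ((chartAt E j).symm (chartAt E j x)) = chartAt E i x := by
    rw [(chartAt E j).left_inv hj]
  rw [← e] at hf'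
  have h2 := hf'.comp (chartAt E j x) h
  rw [e] at h2
  refine h2.congr_of_eventuallyEq ?_
  have h3 : ∀ᶠ y in 𝓝 (chartAt E j x), (chartAt E j).symm y ∈ (chartAt E i).source :=
    ((chartAt E j).continuousAt_symm ((chartAt E j).map_source hj)).preimage_mem_nhds
      ((chartAt E i).open_source.mem_nhds (by rwa [(chartAt E j).left_inv hj]))
  filter_upwards [h3] with y hy
  simp [(chartAt E i).left_inv hy]

theorem contMDiffOn_jetCoordChange [ContMDiffVectorBundle ∞ ℝ L 𝓘(ℝ, E)] (i j : P) :
    ContMDiffOn 𝓘(ℝ, E) 𝓘(ℝ, (ℝ × (E →L[ℝ] ℝ)) →L[ℝ] (ℝ × (E →L[ℝ] ℝ))) ∞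
      (jetCoordChange E L i j) (jetBaseSet E L i ∩ jetBaseSet E L j) := by
  have hg : ContMDiffOn 𝓘(ℝ, E) 𝓘(ℝ, ℝ) ∞ (transition L i j)
      (jetBaseSet E L i ∩ jetBaseSet E L j) :=
    (contMDiffOn_transition E L i j).mono fun x hx => ⟨hx.1.2, hx.2.2⟩
  have hD := contMDiffOn_dTransition E L i j
  have hT : ContMDiffOn 𝓘(ℝ, E) 𝓘(ℝ, E →L[ℝ] E) ∞ (tangentCoordChange 𝓘(ℝ, E) j i)
      (jetBaseSet E L i ∩ jetBaseSet E L j) := by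
    have : IsManifold 𝓘(ℝ, E) (∞ + 1) P := inferInstanceAs (IsManifold 𝓘(ℝ, E) ∞ P)
    have := tangentBundleCore.isContMDiff (I := 𝓘(ℝ, E)) (M := P) (n := ∞)
    exact (this.contMDiffOn_coordChange (achart E j) (achart E i)).mono
      fun x hx => ⟨hx.2.1, hx.1.1⟩
  have h1 : ContMDiffOn 𝓘(ℝ, E) 𝓘(ℝ, (ℝ × (E →L[ℝ] ℝ)) →L[ℝ] ℝ) ∞
      (fun x => transition L i j x • ContinuousLinearMap.fst ℝ ℝ (E →L[ℝ] ℝ))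
      (jetBaseSet E L i ∩ jetBaseSet E L j) := hg.smul contMDiffOn_const
  have h2 : ContMDiffOn 𝓘(ℝ, E) 𝓘(ℝ, (ℝ × (E →L[ℝ] ℝ)) →L[ℝ] (E →L[ℝ] ℝ)) ∞
      (fun x => transition L i j x • ContinuousLinearMap.snd ℝ ℝ (E →L[ℝ] ℝ))
      (jetBaseSet E L i ∩ jetBaseSet E L j) := hg.smul contMDiffOn_const
  have h3' : ContDiff ℝ ∞ (fun D : E →L[ℝ] ℝ =>
      (ContinuousLinearMap.fst ℝ ℝ (E →L[ℝ] ℝ)).smulRight D) :=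
    contDiff_const.smulRight contDiff_id
  have h3 := h3'.contMDiff.comp_contMDiffOn hD
  have h4' : ContDiff ℝ ∞ (fun T : E →L[ℝ] E => (ContinuousLinearMap.compL ℝ E E ℝ).flip T) :=
    ContinuousLinearMap.contDiff _
  have h4 := h4'.contMDiff.comp_contMDiffOn hT
  have h5 := h4.clm_comp (h2.add h3)
  have h6 : ContDiff ℝ ∞ (fun A : ((ℝ × (E →L[ℝ] ℝ)) →L[ℝ] ℝ) ×
      ((ℝ × (E →L[ℝ] ℝ)) →L[ℝ] (E →L[ℝ] ℝ)) =>
        (ContinuousLinearMap.inl ℝ ℝ (E →L[ℝ] ℝ)).comp A.1 +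
          (ContinuousLinearMap.inr ℝ ℝ (E →L[ℝ] ℝ)).comp A.2) :=
    (contDiff_const.clm_comp contDiff_fst).add (contDiff_const.clm_comp contDiff_snd)
  have h7 := h6.contMDiff.comp_contMDiffOn (h1.prodMk_space h5)
  refine h7.congr fun x hx => ?_
  refine ContinuousLinearMap.ext fun v => Prod.ext ?_ ?_
  · exact (add_zero (transition L i j x * v.1)).symm
  · exact (zero_add ((transition L i j x • v.2 + v.1 • dTransition E L i j x).comp
      (tangentCoordChange 𝓘(ℝ, E) j i x))).symm

/-- The 1-jet bundle of `L` as a smooth vector bundle, given by its transition functions. -/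
def jetCore [ContMDiffVectorBundle ∞ ℝ L 𝓘(ℝ, E)] :
    VectorBundleCore ℝ P (ℝ × (E →L[ℝ] ℝ)) P where
  baseSet := jetBaseSet E L
  isOpen_baseSet := isOpen_jetBaseSet E L
  indexAt := id
  mem_baseSet_at p := ⟨mem_chart_source E p, FiberBundle.mem_baseSet_trivializationAt' p⟩
  coordChange := jetCoordChange E L
  coordChange_self i x hx v := by
    have hT : tangentCoordChange 𝓘(ℝ, E) i i x = ContinuousLinearMap.id ℝ E := by
      ext w
      exact tangentCoordChange_self (by simpa using hx.1)
    have hD : dTransition E L i i x = 0 := by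
      have : (fun y => transition L i i ((chartAt E i).symm y)) =ᶠ[𝓝 (chartAt E i x)]
          fun _ => (1 : ℝ) := by
        have h3 : ∀ᶠ y in 𝓝 (chartAt E i x),
            (chartAt E i).symm y ∈ (trivializationAt ℝ L i).baseSet :=
          ((chartAt E i).continuousAt_symm ((chartAt E i).map_source hx.1)).preimage_mem_nhds
            ((trivializationAt ℝ L i).open_baseSet.mem_nhds
              (by rw [(chartAt E i).left_inv hx.1]; exact hx.2))
        filter_upwards [h3] with y hy using transition_self L hy
      rw [dTransition, this.fderiv_eq]
      simp
    rw [jetCoordChange_apply, hT, hD, transition_self L hx.2]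
    simp
  continuousOn_coordChange i j := (contMDiffOn_jetCoordChange E L i j).continuousOn
  coordChange_comp i j k x hx v := by
    obtain ⟨⟨hi, hj⟩, hk⟩ := hx
    have hT : (tangentCoordChange 𝓘(ℝ, E) j i x).comp (tangentCoordChange 𝓘(ℝ, E) k j x) =
        tangentCoordChange 𝓘(ℝ, E) k i x := by
      ext w
      exact tangentCoordChange_comp (by simpa using ⟨⟨hk.1, hj.1⟩, hi.1⟩)
    have hd1 := (contDiffAt_transition E L hi.1 hi.2 hj.2).differentiableAt (by simp)
    have hd2 := (contDiffAt_transition E L hi.1 hj.2 hk.2).differentiableAt (by simp)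
    have hD2 : dTransition E L j k x =
        (fderiv ℝ (fun y => transition L j k ((chartAt E i).symm y)) (chartAt E i x)).comp
          (tangentCoordChange 𝓘(ℝ, E) j i x) :=
      (fderiv_comp_tangentCoordChange E hi.1 hj.1 hd2).fderiv
    have hTT : (tangentCoordChange 𝓘(ℝ, E) j i x).comp (tangentCoordChange 𝓘(ℝ, E) i j x) =
        ContinuousLinearMap.id ℝ E := by
      ext w
      exact (tangentCoordChange_comp (by simpa using ⟨⟨hi.1, hj.1⟩, hi.1⟩)).trans
        (tangentCoordChange_self (by simpa using hi.1))
    have hD3 : dTransition E L i k x = transition L j k x • dTransition E L i j x +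
        transition L i j x •
          fderiv ℝ (fun y => transition L j k ((chartAt E i).symm y)) (chartAt E i x) := by
      have : (fun y => transition L i k ((chartAt E i).symm y)) =ᶠ[𝓝 (chartAt E i x)]
          fun y => transition L j k ((chartAt E i).symm y) *
            transition L i j ((chartAt E i).symm y) := by
        have h3 : ∀ᶠ y in 𝓝 (chartAt E i x), (chartAt E i).symm y ∈
            jetBaseSet E L i ∩ jetBaseSet E L j ∩ jetBaseSet E L k :=
          ((chartAt E i).continuousAt_symm ((chartAt E i).map_source hi.1)).preimage_mem_nhds
            ((((isOpen_jetBaseSet E L i).inter (isOpen_jetBaseSet E L j)).inter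
              (isOpen_jetBaseSet E L k)).mem_nhds
              (by rw [(chartAt E i).left_inv hi.1]; exact ⟨⟨hi, hj⟩, hk⟩))
        filter_upwards [h3] with y hy using (transition_comp L hy.1.1.2 hy.1.2.2 hy.2.2).symm
      rw [dTransition, this.fderiv_eq, fderiv_fun_mul hd2 hd1, (chartAt E i).left_inv hi.1]
      rfl
    simp only [jetCoordChange_apply]
    refine Prod.ext ?_ ?_
    · simp only [← transition_comp L hi.2 hj.2 hk.2]
      ring
    · simp only [hD3, ← transition_comp L hi.2 hj.2 hk.2, ← hT, hD2]
      ext w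
      simp
      ring

instance jetCore_isContMDiff [ContMDiffVectorBundle ∞ ℝ L 𝓘(ℝ, E)] :
    (jetCore E L).IsContMDiff 𝓘(ℝ, E) ∞ :=
  ⟨contMDiffOn_jetCoordChange E L⟩

/-- The total space of the first jet bundle `J¹L`, a smooth vector bundle over `P` (hence a smooth
manifold) through the instances for `VectorBundleCore`. -/
abbrev J1 [ContMDiffVectorBundle ∞ ℝ L 𝓘(ℝ, E)] : Type _ :=
  TotalSpace (ℝ × (E →L[ℝ] ℝ)) (jetCore E L).Fiber

/-- The 1-jet at `p` of a section `u`: the value and the derivative of `u` at `p`, read in the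
preferred chart and trivialisation at `p`. -/
def jet [ContMDiffVectorBundle ∞ ℝ L 𝓘(ℝ, E)] (p : P) (u : ∀ x, L x) : (jetCore E L).Fiber p :=
  ((trivializationAt ℝ L p ⟨p, u p⟩).2,
    fderiv ℝ (fun y => (trivializationAt ℝ L p
      ⟨(chartAt E p).symm y, u ((chartAt E p).symm y)⟩).2) (chartAt E p p))

/-- In the trivialisation at `i` the 1-jet of a section `u` is the pair (value, derivative) of `u`
read in the preferred chart and trivialisation at `i`. -/
theorem localTriv_jet [ContMDiffVectorBundle ∞ ℝ L 𝓘(ℝ, E)] (i p : P)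
    (hp : p ∈ jetBaseSet E L i) (u : Cₛ^∞⟮𝓘(ℝ, E); ℝ, L⟯) :
    ((jetCore E L).localTriv i ⟨p, jet E L p u⟩).2 = ((trivializationAt ℝ L i ⟨p, u p⟩).2,
    fderiv ℝ (fun y => (trivializationAt ℝ L i
      ⟨(chartAt E i).symm y, u ((chartAt E i).symm y)⟩).2) (chartAt E i p)) := by
  have hpp : p ∈ jetBaseSet E L p := (jetCore E L).mem_baseSet_at p
  have hd : DifferentiableAt ℝ (fun y => (trivializationAt ℝ L p
      ⟨(chartAt E p).symm y, u ((chartAt E p).symm y)⟩).2) (chartAt E p p) := by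
    have h1 : ContMDiffAt 𝓘(ℝ, E) 𝓘(ℝ, ℝ) ∞ (fun x => (trivializationAt ℝ L p ⟨x, u x⟩).2) p :=
      (contMDiffAt_section p).1 (u.contMDiff p)
    have h2 : ContMDiffAt 𝓘(ℝ, E) 𝓘(ℝ, E) ∞ (chartAt E p).symm (chartAt E p p) :=
      (contMDiffOn_chart_symm (I := 𝓘(ℝ, E)) (n := ∞)).contMDiffAt
      ((chartAt E p).open_target.mem_nhds ((chartAt E p).map_source hpp.1))
    have h1' : ContMDiffAt 𝓘(ℝ, E) 𝓘(ℝ, ℝ) ∞ (fun x => (trivializationAt ℝ L p ⟨x, u x⟩).2) ((chartAt E p).symm (chartAt E p p)) := by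
      rw [(chartAt E p).left_inv hpp.1]; exact h1
    exact (contMDiffAt_iff_contDiffAt.1 (h1'.comp _ h2)).differentiableAt (by simp)
  have hg := (contDiffAt_transition E L hpp.1 hpp.2 hp.2).differentiableAt (by simp)
  have hm := hg.fun_mul hd
  have h := fderiv_comp_tangentCoordChange E hpp.1 hp.1 (f := fun x => transition L p i x * (trivializationAt ℝ L p ⟨x, u x⟩).2) hm
  have e : (fun y => (trivializationAt ℝ L i
      ⟨(chartAt E i).symm y, u ((chartAt E i).symm y)⟩).2) =ᶠ[𝓝 (chartAt E i p)] fun y => transition L p i ((chartAt E i).symm y) * (trivializationAt ℝ L p ⟨((chartAt E i).symm y), u ((chartAt E i).symm y)⟩).2 := by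
    have h3 : ∀ᶠ y in 𝓝 (chartAt E i p), (chartAt E i).symm y ∈
            jetBaseSet E L p ∩ jetBaseSet E L i :=
          ((chartAt E i).continuousAt_symm ((chartAt E i).map_source hp.1)).preimage_mem_nhds
            (((isOpen_jetBaseSet E L p).inter (isOpen_jetBaseSet E L i)).mem_nhds
              (by rw [(chartAt E i).left_inv hp.1]; exact ⟨hpp, hp⟩))
    filter_upwards [h3] with y hy using (transition_mul L hy.1.2 hy.2.2 _).symm
  rw [e.fderiv_eq, h.fderiv, fderiv_fun_mul hg hd, ← transition_mul L hpp.2 hp.2]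
  refine (jetCoordChange_apply E L p i p _).trans ?_
  rw [(chartAt E p).left_inv hpp.1]
  rfl

end Jet

/-! ## Jacobi structures -/

section Jacobi

variable {E : Type*} [NormedAddCommGroup E] [NormedSpace ℝ E]
  {P : Type*} [TopologicalSpace P] [ChartedSpace E P]
  {L : P → Type*} [TopologicalSpace (TotalSpace ℝ L)] [∀ p, TopologicalSpace (L p)]
  [∀ p, AddCommGroup (L p)] [∀ p, Module ℝ (L p)] [FiberBundle ℝ L] [VectorBundle ℝ ℝ L]

variable (E L) in
/-- The space `Γ(L)` of smooth sections of a line bundle `L → P`. -/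
abbrev Sections : Type _ := Cₛ^∞⟮𝓘(ℝ, E); ℝ, L⟯

/-- The product of a smooth function and a smooth section. -/
def fsmul (f : C^∞⟮𝓘(ℝ, E), P; 𝓘(ℝ, ℝ), ℝ⟯) (u : Sections E L) : Sections E L where
  toFun p := f p • u p
  contMDiff_toFun := f.contMDiff.smul_section u.contMDiff

/-- The (closed) support of a section. -/
def sectionSupport (u : Sections E L) : Set P := closure {p | u p ≠ 0}

variable (E L) in
/-- A Jacobi structure: a local Lie bracket on the sections of the line bundle `L`. -/
structure JacobiStructure where
  bracket : Sections E L →ₗ[ℝ] Sections E L →ₗ[ℝ] Sections E L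
  bracket_self : ∀ u, bracket u u = 0
  jacobi : ∀ u v w, bracket u (bracket v w) + bracket v (bracket w u) +
    bracket w (bracket u v) = 0
  local_bracket : ∀ u v,
    sectionSupport (bracket u v) ⊆ sectionSupport u ∩ sectionSupport v

/-- For a bracket `b` on `Γ(L)`: the anchor `ρ` of its Lie algebroid `J¹L` takes the value `X` on
`j¹ₚu`. The anchor is characterised by `b(u, f v) = f b(u, v) + df(ρ(j¹u)) v` for all smooth
functions `f` and all sections `v`; this is that identity at `p`. -/
def HasAnchor (b : Sections E L → Sections E L → Sections E L) (u : Sections E L) (p : P)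
    (X : TangentSpace 𝓘(ℝ, E) p) : Prop :=
  ∀ (f : C^∞⟮𝓘(ℝ, E), P; 𝓘(ℝ, ℝ), ℝ⟯) (v : Sections E L),
    b u (fsmul f v) p = f p • b u v p + (mvfderiv 𝓘(ℝ, E) f p X) • v p

variable [IsManifold 𝓘(ℝ, E) ∞ P] [ContMDiffVectorBundle ∞ ℝ L 𝓘(ℝ, E)]

/-- The kernel `ker ρ ⊆ J¹L` of the anchor of a Jacobi structure. -/
def kerAnchor (J : JacobiStructure E L) : Set (J1 E L) :=
  {α | ∃ u : Sections E L, jet E L α.proj u = α.2 ∧ HasAnchor (J.bracket · ·) u α.proj 0}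

end Jacobi

/-! ## Contact manifolds -/

section Contact

variable {E : Type*} [NormedAddCommGroup E] [NormedSpace ℝ E] [FiniteDimensional ℝ E]
  {M : Type*} [TopologicalSpace M] [ChartedSpace E M] [IsManifold 𝓘(ℝ, E) ∞ M]
  {L : M → Type*} [TopologicalSpace (TotalSpace ℝ L)] [∀ p, TopologicalSpace (L p)]
  [∀ p, AddCommGroup (L p)] [∀ p, Module ℝ (L p)] [FiberBundle ℝ L] [VectorBundle ℝ ℝ L]
  [∀ p, IsTopologicalAddGroup (L p)] [∀ p, ContinuousSMul ℝ (L p)]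
  [ContMDiffVectorBundle ∞ ℝ L 𝓘(ℝ, E)]

variable (E M) in
/-- The space of smooth vector fields on `M`. -/
abbrev VectorFields : Type _ := Cₛ^∞⟮𝓘(ℝ, E); E, (TangentSpace 𝓘(ℝ, E) : M → Type _)⟯

variable (E L) in
/-- The space `Ω¹(M, L)` of smooth 1-forms on `M` with values in the line bundle `L`. -/
abbrev OneForms : Type _ :=
  Cₛ^∞⟮𝓘(ℝ, E); E →L[ℝ] ℝ, (fun m : M => TangentSpace 𝓘(ℝ, E) m →L[ℝ] L m)⟯

/-- `X ∈ Γ(H)`, where `H = ker θ`. -/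
def IsHorizontal (θ : OneForms E L) (X : VectorFields E M) : Prop := ∀ m, θ m (X m) = 0

variable (E L) in
/-- A contact structure on `M`, given by a generalised contact form: a pointwise surjective 1-form
`θ ∈ Ω¹(M, L)` such that the curvature `(X, Y) ↦ θ([X, Y])` is fibrewise non-degenerate on the
hyperplane distribution `H = ker θ`. (Thus `L ≅ TM/H`.) -/
structure ContactForm where
  form : OneForms E L
  surjective : ∀ m, Function.Surjective (form m)
  nondegenerate : ∀ (m : M) (X : VectorFields E M), IsHorizontal form X →
    (∀ Y : VectorFields E M, IsHorizontal form Y →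
      form m (VectorField.mlieBracket 𝓘(ℝ, E) X Y m) = 0) → X m = 0

/-- `R` is a Reeb vector field: `[R, Γ(H)] ⊆ Γ(H)`. -/
def IsReeb (C : ContactForm E L) (R : VectorFields E M) : Prop :=
  ∀ X : VectorFields E M, IsHorizontal C.form X →
    ∀ m, C.form m (VectorField.mlieBracket 𝓘(ℝ, E) R X m) = 0

/-- The section `θ(X)` of `L`. -/
def evalForm (θ : OneForms E L) (X : VectorFields E M) : Sections E L where
  toFun m := θ m (X m)
  contMDiff_toFun := θ.contMDiff.clm_bundle_apply X.contMDiff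

/-- The Lie bracket of smooth vector fields. -/
def lie (X Y : VectorFields E M) : VectorFields E M where
  toFun := VectorField.mlieBracket 𝓘(ℝ, E) X Y
  contMDiff_toFun := fun m => by
    have : CompleteSpace E := FiniteDimensional.complete ℝ E
    have : IsManifold 𝓘(ℝ, E) (minSmoothness ℝ 2) M := by
      rw [minSmoothness_of_isRCLikeNormedField]; infer_instance
    have : IsManifold 𝓘(ℝ, E) (((⊤ : ℕ∞) : ℕ∞ω) + 1) M :=
      inferInstanceAs (IsManifold 𝓘(ℝ, E) ∞ M)
    exact ContMDiffAt.mlieBracket_vectorField (n := ⊤) (m := ⊤) (X.contMDiff m) (Y.contMDiff m) (by simp)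

open Classical in
/-- The Reeb vector field `R_u` of a section `u`: the unique Reeb vector field with `θ(R_u) = u`. -/
def reeb (C : ContactForm E L) (u : Sections E L) : VectorFields E M :=
  if h : ∃ R : VectorFields E M, IsReeb C R ∧ evalForm C.form R = u then h.choose else 0

/-- The Reeb bracket `{u, v} = θ([R_u, R_v])` on the sections of `L`. -/
def reebBracket (C : ContactForm E L) (u v : Sections E L) : Sections E L :=
  evalForm C.form (lie (reeb C u) (reeb C v))

end Contact


/-! ## Contact isotropic realisations -/

section Realisation

variable {E : Type*} [NormedAddCommGroup E] [NormedSpace ℝ E]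
  {P : Type*} [TopologicalSpace P] [ChartedSpace E P] [IsManifold 𝓘(ℝ, E) ∞ P]
  {L : P → Type*} [TopologicalSpace (TotalSpace ℝ L)] [∀ p, TopologicalSpace (L p)]
  [∀ p, AddCommGroup (L p)] [∀ p, Module ℝ (L p)] [FiberBundle ℝ L] [VectorBundle ℝ ℝ L]
  [ContMDiffVectorBundle ∞ ℝ L 𝓘(ℝ, E)]
  {E' : Type*} [NormedAddCommGroup E'] [NormedSpace ℝ E'] [FiniteDimensional ℝ E']
  {M : Type*} [TopologicalSpace M] [ChartedSpace E' M] [IsManifold 𝓘(ℝ, E') ∞ M]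
  {L' : M → Type*} [TopologicalSpace (TotalSpace ℝ L')] [∀ m, TopologicalSpace (L' m)]
  [∀ m, AddCommGroup (L' m)] [∀ m, Module ℝ (L' m)] [FiberBundle ℝ L'] [VectorBundle ℝ ℝ L']
  [∀ m, IsTopologicalAddGroup (L' m)] [∀ m, ContinuousSMul ℝ (L' m)]
  [ContMDiffVectorBundle ∞ ℝ L' 𝓘(ℝ, E')]

variable (E L E' L') in
/-- An isomorphism `F : φ^*L → L'` of smooth line bundles: fibrewise linear isomorphisms
`L_{φ(m)} ≅ L'_m` such that the pull-back `F ∘ φ^*u` of every smooth section `u` is smooth. (As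
`L` has smooth local frames which extend to global sections, this is smoothness of `F`.) -/
structure BundleComponent (φ : M → P) where
  equiv : ∀ m, L (φ m) ≃ₗ[ℝ] L' m
  contMDiff_pullback : ∀ u : Sections E L,
    ContMDiff 𝓘(ℝ, E') (𝓘(ℝ, E').prod 𝓘(ℝ, ℝ)) ∞
      (fun m => TotalSpace.mk' ℝ m (equiv m (u (φ m))))

/-- The section `F ∘ φ^*u` of `L'`. -/
def BundleComponent.pullback {φ : M → P} (F : BundleComponent E L E' L' φ) (u : Sections E L) :
    Sections E' L' :=
  ⟨fun m => F.equiv m (u (φ m)), F.contMDiff_pullback u⟩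

/-- `φ : (M, H) → (P, L, {·,·})`, with bundle component `F : φ^*L → L'`, is a contact isotropic
realisation: a surjective submersion with compact connected fibres such that
* `φ` is a Jacobi map with bundle component `F`;
* `H + ker Dφ = TM`;
* `ker Dφ ⊆ (ker Dφ)^⊥ := ρ_M(φ^*J¹L)`, where `φ^* : φ^*J¹L → J¹L'` is
  `j¹u ↦ j¹(F ∘ φ^*u)` and `ρ_M` is the anchor of the Jacobi structure of `M`. -/
structure IsContactIsotropicRealisation (J : JacobiStructure E L) (C : ContactForm E' L')
    (φ : M → P) (F : BundleComponent E L E' L' φ) : Prop where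
  contMDiff : ContMDiff 𝓘(ℝ, E') 𝓘(ℝ, E) ∞ φ
  surjective : Function.Surjective φ
  submersion : ∀ m, Function.Surjective (mfderiv 𝓘(ℝ, E') 𝓘(ℝ, E) φ m)
  isCompact_fibre : ∀ p, IsCompact (φ ⁻¹' {p})
  isConnected_fibre : ∀ p, IsConnected (φ ⁻¹' {p})
  jacobi_map : ∀ u v : Sections E L,
    reebBracket C (F.pullback u) (F.pullback v) = F.pullback (J.bracket u v)
  transversal : ∀ (m : M) (X : TangentSpace 𝓘(ℝ, E') m), ∃ Y Z : TangentSpace 𝓘(ℝ, E') m,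
    C.form m Y = 0 ∧ mfderiv 𝓘(ℝ, E') 𝓘(ℝ, E) φ m Z = 0 ∧ X = Y + Z
  isotropic : ∀ (m : M) (X : TangentSpace 𝓘(ℝ, E') m), mfderiv 𝓘(ℝ, E') 𝓘(ℝ, E) φ m X = 0 →
    ∃ u : Sections E L, HasAnchor (reebBracket C) (F.pullback u) m X

/-- `m' = φ¹_α(m)`: the time-one flow of `ψ(φ^*α)` takes `m` to `m'`, where `ψ` is the
infinitesimal action `φ^*j¹u ↦ R_{F ∘ φ^*u}`. Here `m` lies in the fibre over the base point of
`α`; for `α ∈ ker ρ` the vector field `R_{F ∘ φ^*u}`, for any `u` with 1-jet `α`, is tangent to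
that fibre and restricts to `ψ(φ^*α)` on it. -/
def FlowsTo (C : ContactForm E' L') {φ : M → P} (F : BundleComponent E L E' L' φ)
    (α : J1 E L) (m m' : M) : Prop :=
  φ m = α.proj ∧ ∃ (u : Sections E L) (γ : ℝ → M), jet E L α.proj u = α.2 ∧
    IsMIntegralCurve (I := 𝓘(ℝ, E')) γ (reeb C (F.pullback u)) ∧ γ 0 = m ∧ γ 1 = m'

/-- The period lattice `Σ ⊆ ker ρ`: the elements whose time-one flow is the identity of the fibre
over their base point. -/
def periodLattice (J : JacobiStructure E L) (C : ContactForm E' L') {φ : M → P}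
    (F : BundleComponent E L E' L' φ) : Set (kerAnchor J) :=
  {α | ∀ m, φ m = α.1.proj → FlowsTo C F α.1 m m}

/-- `α ∼ β` when they lie over the same point and `α - β ∈ Σ`. -/
def PeriodRel (J : JacobiStructure E L) (C : ContactForm E' L') {φ : M → P}
    (F : BundleComponent E L E' L' φ) (α β : kerAnchor J) : Prop :=
  ∃ (p : P) (a b : (jetCore E L).Fiber p), α.1 = ⟨p, a⟩ ∧ β.1 = ⟨p, b⟩ ∧
    ∃ σ ∈ periodLattice J C F, σ.1 = ⟨p, a - b⟩

/-- The quotient `ker ρ / Σ`, with the quotient topology. -/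
abbrev PeriodQuotient (J : JacobiStructure E L) (C : ContactForm E' L') {φ : M → P}
    (F : BundleComponent E L E' L' φ) : Type _ :=
  Quot (PeriodRel J C F)

/-- The projection `π : ker ρ / Σ → P`. -/
def PeriodQuotient.proj {J : JacobiStructure E L} {C : ContactForm E' L'} {φ : M → P}
    {F : BundleComponent E L E' L' φ} : PeriodQuotient J C F → P :=
  Quot.lift (fun α => α.1.proj) (by
    rintro α β ⟨p, a, b, hα, hβ, -⟩
    rw [hα, hβ])

end Realisation

end ContactRealisation

end

open ContactRealisation

noncomputable section

set_option linter.unusedSectionVars false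

/-! The theorem is a contact version of the Liouville–Arnold theorem. An element α of ker ρ over p
acts on the fibre over p through the vector field R_{F∘φ^*u}, where u has 1-jet α. This is an
abelian action of the vector bundle ker ρ, locally free and transitive on fibres; compact fibres are
then quotients of ker ρ by lattices, that is, tori.

Normal form. In a chart E × ℝᵏ of M over a chart of P, and in a frame pulled back from L, the
contact structure is a scalar 1-form θ, and the Reeb vector R of a function f is given by θ(R) = f
and dθ(R, ·) = -df modulo θ. Isotropy makes every vertical vector (0, κ) the Reeb vector of a jet
pulled back from the base. Transversality kills the multiple of θ, so dθ vanishes on pairs of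
vertical vectors (`IsotropicOn.extD_vert`) and the jet is forced to be `vertJet θ x κ`, with value
θ(0, κ) and differential -dθ((0, κ), ·). Hence ker ρ is the image of the injective map `vertJet θ
x`, for any x over the given base point. As ddθ = 0, `vertJet` is a closed 1-form along the fibres
(`IsotropicOn.fderiv_vertJet_symm`). A fibrewise primitive, read through a linear map Q that gives
coordinates on ker ρ, supplies new fibre coordinates in which α acts by the constant vector Q(α)
(`IsotropicOn.exists_chart`). A `FlowModel` uses one Q for all points of M over an open subset of P.

The action. A compact fibre is covered by such charts of a uniform size. Therefore the flows are
complete (`FlowModel.exists_flowLine`), short flows are translations, and cutting a long flow into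
short ones gives additivity (`FlowModel.flow_add`) and joint smoothness
(`FlowModel.contMDiffAt_flow`). Connectedness of the fibre gives transitivity
(`FlowModel.exists_flow_eq`).

Consequences. For a local section σ, the map sending α to the time-one flow of σ(π(α)) is a local
diffeomorphism (`FlowModel.exists_flowFrom_localInverse`), onto by transitivity, and its level sets
are the classes modulo Σ, because in a transitive abelian action all points of a fibre have the same
stabiliser. So Σ is locally the preimage of the image of σ, a union of graphs over P
(`FlowModel.exists_period_function`), and the manifold structure of the quotient and the
diffeomorphism Ψ_σ both come from this map. By compactness a bounded set of elements already reaches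
the whole fibre, so the periods over a point form a full lattice. A basis at one point extends along
the graphs, and a compactness argument on the unit cube shows that it generates all nearby periods
(`FlowModel.exists_smooth_periods_basis`); this trivialises the quotient with fibre the torus. -/

namespace ContactRealisation

/-! ## Calculus in normed spaces -/

section Calculus

open MeasureTheory in
/-- An integral over `[0, 1]` of a smooth function of the parameters is smooth. -/
theorem contDiff_intervalIntegral {X V : Type*} [NormedAddCommGroup X] [NormedSpace ℝ X]
    [NormedAddCommGroup V] [NormedSpace ℝ V] {g : ℝ × X → V} (hg : ContDiff ℝ ∞ g) :
    ContDiff ℝ ∞ fun x => ∫ t in (0 : ℝ)..1, g (t, x) := by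
  -- The integral is the value at 0 of the convolution of the indicator of [0, 1] with t ↦ χ(t)
  -- g(-t, x). The bump makes the second factor compactly supported and equals 1 on [-1, 0], the
  -- only values of the argument that matter.
  let χ : ContDiffBump (0 : ℝ) := ⟨1, 2, one_pos, by norm_num⟩
  have h := contDiffOn_convolution_right_with_param_comp (μ := volume) (n := (⊤ : ℕ∞))
    (ContinuousLinearMap.lsmul ℝ ℝ : ℝ →L[ℝ] V →L[ℝ] V) (s := (univ : Set X)) (v := fun _ => (0 : ℝ))
    (f := (Icc (0 : ℝ) 1).indicator fun _ => (1 : ℝ)) (g := fun x t => χ t • g (-t, x))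
    (k := Metric.closedBall 0 2) contDiffOn_const isOpen_univ (isCompact_closedBall _ _)
    (fun x t _ ht => by
      have h0 : χ t = 0 := χ.zero_of_le_dist (by
        have : 2 < dist t 0 := by simpa using ht
        exact this.le)
      simp [h0])
    ((integrable_indicator_iff measurableSet_Icc).2
      (integrableOn_const (by simp))).locallyIntegrable
    (by
      have : ContDiff ℝ ∞ fun q : X × ℝ => χ q.2 • g (-q.2, q.1) :=
        (χ.contDiff.comp contDiff_snd).smul (hg.comp (contDiff_snd.neg.prodMk contDiff_fst))
      exact this.contDiffOn)
  rw [contDiffOn_univ] at h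
  convert h using 1
  funext x
  rw [convolution_def, intervalIntegral.integral_of_le zero_le_one, ← integral_Icc_eq_integral_Ioc,
    ← integral_indicator measurableSet_Icc]
  refine integral_congr_ae (Filter.Eventually.of_forall fun t => ?_)
  by_cases ht : t ∈ Icc (0 : ℝ) 1
  · have h1 : χ (0 - t) = 1 := χ.one_of_mem_closedBall (by
      simpa [χ, Real.norm_eq_abs, abs_of_nonneg ht.1] using ht.2)
    have h2 : -(0 - t) = t := by ring
    simp only [indicator_of_mem ht, h1, h2, one_smul, ContinuousLinearMap.lsmul_apply]
  · simp [ht]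

/-- The Poincaré lemma with parameters: a smooth fibrewise closed 1-form along the factor `K` of
`E × K` has, near every point, a smooth fibrewise primitive. -/
theorem exists_fibrewise_primitive {E K V : Type*} [NormedAddCommGroup E] [NormedSpace ℝ E]
    [FiniteDimensional ℝ E] [NormedAddCommGroup K] [NormedSpace ℝ K] [FiniteDimensional ℝ K]
    [NormedAddCommGroup V] [NormedSpace ℝ V] [CompleteSpace V]
    {O : Set (E × K)} (hO : IsOpen O) {T : E × K → K →L[ℝ] V} (hT : ContDiffOn ℝ ∞ T O)
    (hsymm : ∀ x ∈ O, ∀ κ κ' : K, fderiv ℝ T x (0, κ) κ' = fderiv ℝ T x (0, κ') κ)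
    {x₀ : E × K} (hx₀ : x₀ ∈ O) :
    ∃ (U : Set (E × K)) (h : E × K → V), IsOpen U ∧ x₀ ∈ U ∧ U ⊆ O ∧ ContDiff ℝ ∞ h ∧
      ∀ x ∈ U, ∀ κ : K, fderiv ℝ h x (0, κ) = T x κ := by
  obtain ⟨r, hr, hrO⟩ := Metric.isOpen_iff.1 hO x₀ hx₀
  -- The cut-off makes the integrand below smooth on the whole space without changing T near x₀.
  let χ : ContDiffBump x₀ := ⟨r / 4, r / 2, by positivity, by linarith⟩
  let S : E × K → K →L[ℝ] V := fun x => χ x • T x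
  have hS : ContDiff ℝ ∞ S := by
    rw [contDiff_iff_contDiffAt]
    intro x
    by_cases hx : x ∈ Metric.ball x₀ r
    · exact χ.contDiff.contDiffAt.smul (hT.contDiffAt (hO.mem_nhds (hrO hx)))
    · have : S =ᶠ[𝓝 x] fun _ => 0 := by
        have hc : (Metric.closedBall x₀ (r / 2))ᶜ ∈ 𝓝 x :=
          Metric.isClosed_closedBall.isOpen_compl.mem_nhds fun h =>
            hx (Metric.closedBall_subset_ball (by linarith) h)
        filter_upwards [hc] with y hy
        have h0 : χ y = 0 := χ.zero_of_le_dist (by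
          have : r / 2 < dist y x₀ := by simpa using hy
          exact this.le)
        simp [S, h0]
      exact contDiffAt_const.congr_of_eventuallyEq this
  let U := Metric.ball x₀ (r / 4)
  have hUO : U ⊆ O := (Metric.ball_subset_ball (by linarith)).trans hrO
  have hST : ∀ x ∈ U, S x = T x := fun x hx => by
    have h1 : χ x = 1 := χ.one_of_mem_closedBall (Metric.ball_subset_closedBall hx)
    simp [S, h1]
  -- The radial primitive along the fibre, based at the fibre coordinate of x₀: it is smooth in the
  -- base variable too, since it is a parameter integral.
  let h : E × K → V := fun x => ∫ t in (0 : ℝ)..1, S (x.1, x₀.2 + t • (x.2 - x₀.2)) (x.2 - x₀.2)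
  have hh : ContDiff ℝ ∞ h := by
    have : ContDiff ℝ ∞ fun q : ℝ × (E × K) =>
        S (q.2.1, x₀.2 + q.1 • (q.2.2 - x₀.2)) (q.2.2 - x₀.2) := by
      refine (hS.comp ?_).clm_apply (by fun_prop)
      fun_prop
    exact contDiff_intervalIntegral this
  refine ⟨U, h, Metric.isOpen_ball, Metric.mem_ball_self (by positivity), hUO, hh, ?_⟩
  rintro ⟨e, v⟩ hev κ
  -- the slice of `U` over `e`
  let s : Set K := {v | (e, v) ∈ U}
  have hsb : s = Metric.ball x₀.2 (r / 4) := by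
    ext w
    have he : dist e x₀.1 < r / 4 := by
      have := Metric.mem_ball.1 hev
      rw [Prod.dist_eq] at this
      exact (max_lt_iff.1 this).1
    simp [s, U, Metric.mem_ball, Prod.dist_eq, he]
  have hs : Convex ℝ s := hsb ▸ convex_ball _ _
  have hso : IsOpen s := hsb ▸ Metric.isOpen_ball
  have h0 : x₀.2 ∈ s := hsb ▸ Metric.mem_ball_self (by positivity)
  have hder : ∀ w ∈ s, HasFDerivAt (fun v => T (e, v))
      ((fderiv ℝ T (e, w)).comp (ContinuousLinearMap.inr ℝ E K)) w := fun w hw =>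
    ((hT.contDiffAt (hO.mem_nhds (hUO hw))).differentiableAt (by simp)).hasFDerivAt.comp w
      (hasFDerivAt_prodMk_right e w)
  obtain ⟨f, hf⟩ := hs.exists_forall_hasFDerivAt_of_fderiv_symmetric hso
    (show DifferentiableOn ℝ (fun v => T (e, v)) s from
      fun w hw => (hder w hw).differentiableAt.differentiableWithinAt)
    (fun w hw a b => by
      rw [(hder w hw).fderiv]
      exact hsymm _ (hUO hw) a b)
  have hhf : ∀ w ∈ s, h (e, w) = f w - f x₀.2 := by
    intro w hw
    have hline : ∀ t ∈ uIcc (0 : ℝ) 1, x₀.2 + t • (w - x₀.2) ∈ s := fun t ht => by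
      rw [uIcc_of_le zero_le_one] at ht
      exact hs.add_smul_sub_mem h0 hw ht
    have hd : ∀ t ∈ uIcc (0 : ℝ) 1, HasDerivAt (fun t : ℝ => f (x₀.2 + t • (w - x₀.2)))
        (S (e, x₀.2 + t • (w - x₀.2)) (w - x₀.2)) t := by
      intro t ht
      have h1 : HasDerivAt (fun t : ℝ => x₀.2 + t • (w - x₀.2)) (w - x₀.2) t := by
        simpa using ((hasDerivAt_id t).smul_const (w - x₀.2)).const_add x₀.2
      rw [hST _ (hline t ht)]
      exact (hf _ (hline t ht)).comp_hasDerivAt t h1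
    have hc : Continuous fun t : ℝ => S (e, x₀.2 + t • (w - x₀.2)) (w - x₀.2) := by
      have := hS.continuous
      fun_prop
    have := intervalIntegral.integral_eq_sub_of_hasDerivAt hd (hc.intervalIntegrable 0 1)
    simpa [h] using this
  have h2 : HasFDerivAt (fun v => h (e, v)) (T (e, v)) v :=
    ((hf v hev).sub_const (f x₀.2)).congr_of_eventuallyEq
      (Filter.eventually_of_mem (hso.mem_nhds hev) hhf)
  have h3 : HasFDerivAt (fun v => h (e, v))
      ((fderiv ℝ h (e, v)).comp (ContinuousLinearMap.inr ℝ E K)) v :=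
    ((hh.differentiable (by simp)).differentiableAt (x := (e, v))).hasFDerivAt.comp v
      (hasFDerivAt_prodMk_right e v)
  rw [h2.unique h3]
  simp

/-- The inverse function theorem for smooth functions. -/
theorem exists_openPartialHomeomorph_of_hasFDerivAt {X Y : Type*} [NormedAddCommGroup X]
    [NormedSpace ℝ X] [CompleteSpace X] [NormedAddCommGroup Y] [NormedSpace ℝ Y]
    {f : X → Y} {s : Set X} (hs : IsOpen s) (hf : ContDiffOn ℝ ∞ f s) {x₀ : X} (hx₀ : x₀ ∈ s)
    {f' : X ≃L[ℝ] Y} (hf' : HasFDerivAt f (f' : X →L[ℝ] Y) x₀) :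
    ∃ e : OpenPartialHomeomorph X Y, x₀ ∈ e.source ∧ e.source ⊆ s ∧ ⇑e = f ∧
      ContDiffOn ℝ ∞ e.symm e.target := by
  have hfa := hf.contDiffAt (hs.mem_nhds hx₀)
  let e := hfa.toOpenPartialHomeomorph f hf' (by simp)
  have he : x₀ ∈ e.source := hfa.mem_toOpenPartialHomeomorph_source hf' (by simp)
  have hcont : ContinuousOn (fderiv ℝ f) s :=
    hf.continuousOn_fderiv_of_isOpen hs (by simp)
  -- Restricting to the points with invertible derivative makes the inverse smooth on its whole
  -- target, and not only at the image of x₀.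
  let U : Set X := s ∩ (fderiv ℝ f) ⁻¹' range ((↑) : (X ≃L[ℝ] Y) → (X →L[ℝ] Y))
  have hU : IsOpen U := hcont.isOpen_inter_preimage hs (ContinuousLinearEquiv.isOpen)
  refine ⟨e.restrOpen U hU, ⟨he, hx₀, ⟨f', hf'.fderiv.symm⟩⟩, fun x hx => hx.2.1, rfl, ?_⟩
  intro y hy
  have hy' : y ∈ e.target ∧ e.symm y ∈ U := by
    simpa [OpenPartialHomeomorph.restrOpen] using hy
  obtain ⟨g, hg⟩ := hy'.2.2
  have hd : HasFDerivAt f (g : X →L[ℝ] Y) (e.symm y) := by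
    rw [hg]
    exact ((hf.contDiffAt (hs.mem_nhds hy'.2.1)).differentiableAt (by simp)).hasFDerivAt
  exact (e.contDiffAt_symm hy'.1 hd (hf.contDiffAt (hs.mem_nhds hy'.2.1))).contDiffWithinAt

end Calculus

/-! ## Contact forms in coordinates -/

section ContactCoordinates

variable {X : Type*} [NormedAddCommGroup X] [NormedSpace ℝ X]

/-- The exterior derivative of a 1-form on a normed space. -/
def extD (θ : X → X →L[ℝ] ℝ) (x : X) : X →L[ℝ] X →L[ℝ] ℝ :=
  fderiv ℝ θ x - (fderiv ℝ θ x).flip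

theorem extD_apply (θ : X → X →L[ℝ] ℝ) (x v w : X) :
    extD θ x v w = fderiv ℝ θ x v w - fderiv ℝ θ x w v := rfl

theorem extD_skew (θ : X → X →L[ℝ] ℝ) (x v w : X) : extD θ x v w = -extD θ x w v := by
  simp [extD_apply]

theorem contDiffOn_extD_apply {θ : X → X →L[ℝ] ℝ} {O : Set X} (hO : IsOpen O)
    (hθ : ContDiffOn ℝ ∞ θ O) (v w : X) : ContDiffOn ℝ ∞ (fun x => extD θ x v w) O := by
  have h := hθ.fderiv_of_isOpen hO (m := ∞) le_rfl
  exact ((h.clm_apply contDiffOn_const).clm_apply contDiffOn_const).sub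
    ((h.clm_apply contDiffOn_const).clm_apply contDiffOn_const)

theorem contDiffOn_extD [FiniteDimensional ℝ X] {θ : X → X →L[ℝ] ℝ} {O : Set X} (hO : IsOpen O)
    (hθ : ContDiffOn ℝ ∞ θ O) : ContDiffOn ℝ ∞ (extD θ) O := by
  refine contDiffOn_clm_apply.2 fun v => contDiffOn_clm_apply.2 fun w => ?_
  exact contDiffOn_extD_apply hO hθ v w

/-- The exterior derivative of a 1-form is closed. -/
theorem fderiv_extD_cyclic {θ : X → X →L[ℝ] ℝ} {O : Set X} (hO : IsOpen O)
    (hθ : ContDiffOn ℝ ∞ θ O) {x : X} (hx : x ∈ O) (u v w : X) :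
    fderiv ℝ (fun y => extD θ y v w) x u + fderiv ℝ (fun y => extD θ y w u) x v +
      fderiv ℝ (fun y => extD θ y u v) x w = 0 := by
  have h := hθ.fderiv_of_isOpen hO (m := ∞) le_rfl
  have hd : DifferentiableAt ℝ (fderiv ℝ θ) x :=
    (h.contDiffAt (hO.mem_nhds hx)).differentiableAt (by simp)
  have key : ∀ a b c : X, fderiv ℝ (fun y => extD θ y b c) x a =
      fderiv ℝ (fderiv ℝ θ) x a b c - fderiv ℝ (fderiv ℝ θ) x a c b := fun a b c => by
    have h1 : ∀ b c : X, HasFDerivAt (fun y => fderiv ℝ θ y b c) _ x := fun b c =>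
      (hd.hasFDerivAt.clm_apply (hasFDerivAt_const b x)).clm_apply (hasFDerivAt_const c x)
    have h2 : HasFDerivAt (fun y => extD θ y b c) _ x := (h1 b c).sub (h1 c b)
    rw [h2.fderiv]
    simp
  -- Symmetry of the second derivative of θ cancels the six terms of the cyclic sum in pairs.
  have hs : IsSymmSndFDerivAt ℝ θ x :=
    (hθ.contDiffAt (hO.mem_nhds hx)).isSymmSndFDerivAt (by
      rw [minSmoothness_of_isRCLikeNormedField]; exact ENat.LEInfty.out)
  rw [key, key, key]
  have h1 := congrArg (fun A => A w) (hs u v)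
  have h2 := congrArg (fun A => A u) (hs v w)
  have h3 := congrArg (fun A => A v) (hs w u)
  linarith

/-- `r` satisfies at `x` the equations `θ(r) = a`, `i_r dθ = -A` modulo `θ` characterising the Reeb
vector of a function with value `a` and differential `A` at `x`. -/
def IsReebVector (θ : X → X →L[ℝ] ℝ) (x : X) (a : ℝ × (X →L[ℝ] ℝ)) (r : X) : Prop :=
  θ x r = a.1 ∧ ∃ l : ℝ, ∀ w, extD θ x r w = -a.2 w + l * θ x w

/-- `dθ` is non-degenerate on the kernel of `θ` at `x`. -/
def ContactAt (θ : X → X →L[ℝ] ℝ) (x : X) : Prop :=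
  θ x ≠ 0 ∧ ∀ r, θ x r = 0 → (∀ w, θ x w = 0 → extD θ x r w = 0) → r = 0

/-- The difference of two solutions lies in the kernel of θ and is dθ-orthogonal to it, as the
multiples of θ vanish there. -/
theorem IsReebVector.unique {θ : X → X →L[ℝ] ℝ} {x : X} (hc : ContactAt θ x)
    {a : ℝ × (X →L[ℝ] ℝ)} {r r' : X} (h : IsReebVector θ x a r) (h' : IsReebVector θ x a r') :
    r = r' := by
  obtain ⟨h1, l, hl⟩ := h
  obtain ⟨h1', l', hl'⟩ := h'
  refine sub_eq_zero.1 (hc.2 _ (by rw [map_sub, h1, h1', sub_self]) fun w hw => ?_)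
  rw [map_sub, sub_apply, hl, hl', hw]
  ring

/-- The Reeb equations can be checked on the kernel of `θ`. -/
theorem isReebVector_iff {θ : X → X →L[ℝ] ℝ} {x : X} (hx : θ x ≠ 0) {a : ℝ × (X →L[ℝ] ℝ)}
    {r : X} : IsReebVector θ x a r ↔
      θ x r = a.1 ∧ ∀ w, θ x w = 0 → extD θ x r w = -a.2 w := by
  constructor
  · rintro ⟨h1, l, hl⟩
    exact ⟨h1, fun w hw => by rw [hl, hw, mul_zero, add_zero]⟩
  · rintro ⟨h1, h2⟩
    obtain ⟨n, hn⟩ : ∃ n, θ x n ≠ 0 := by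
      by_contra! h
      exact hx (ContinuousLinearMap.ext h)
    -- The multiplier is dictated by evaluation at n. Every w differs from an element of the kernel
    -- by a multiple of n.
    refine ⟨h1, (extD θ x r n + a.2 n) / θ x n, fun w => ?_⟩
    have := h2 (w - (θ x w / θ x n) • n) (by
      rw [map_sub, map_smul, smul_eq_mul, div_mul_cancel₀ _ hn, sub_self])
    simp only [map_sub, map_smul, smul_eq_mul] at this
    have e : extD θ x r w = -a.2 w + θ x w / θ x n * (extD θ x r n + a.2 n) := by linarith
    rw [e]
    ring

/-- The Lie bracket of a field with a horizontal one, evaluated by the form. -/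
theorem apply_lieBracket {θ : X → X →L[ℝ] ℝ} {x : X} (hθ : DifferentiableAt ℝ θ x) {f : X → ℝ}
    {R Y : X → X} (hR : DifferentiableAt ℝ R x) (hY : DifferentiableAt ℝ Y x)
    (hRf : ∀ᶠ y in 𝓝 x, θ y (R y) = f y) (hY0 : ∀ᶠ y in 𝓝 x, θ y (Y y) = 0) :
    θ x (VectorField.lieBracket ℝ R Y x) = -extD θ x (R x) (Y x) - fderiv ℝ f x (Y x) := by
  have h1 : HasFDerivAt f _ x :=
    (hθ.hasFDerivAt.clm_apply hR.hasFDerivAt).congr_of_eventuallyEq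
      (hRf.mono fun _ h => h.symm)
  have h2 : HasFDerivAt (fun _ : X => (0 : ℝ)) _ x :=
    (hθ.hasFDerivAt.clm_apply hY.hasFDerivAt).congr_of_eventuallyEq
      (hY0.mono fun _ h => h.symm)
  -- Differentiating θ(Y) = 0 along R replaces θ(DY · R) by a derivative of θ.
  have h3 := congrArg (fun A => A (R x)) (h2.unique (hasFDerivAt_const (0 : ℝ) x))
  rw [h1.fderiv, extD_apply, VectorField.lieBracket]
  simp at h3 ⊢
  linarith

variable [FiniteDimensional ℝ X]

/-- Smooth solutions of the Reeb equations exist locally. -/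
theorem exists_contDiffOn_isReebVector {θ : X → X →L[ℝ] ℝ} {O : Set X} (hO : IsOpen O)
    (hθ : ContDiffOn ℝ ∞ θ O) (hc : ∀ x ∈ O, ContactAt θ x) {f : X → ℝ}
    (hf : ContDiffOn ℝ ∞ f O) :
    ∃ R : X → X, ContDiffOn ℝ ∞ R O ∧ ∀ x ∈ O, IsReebVector θ x (f x, fderiv ℝ f x) (R x) := by
  -- The Reeb equations form a linear system in the pair (r, l) of the vector and its multiplier.
  -- The contact condition makes it injective and the dimensions agree, so smoothness of inversion
  -- gives a smooth solution.
  let B : X → (X × ℝ) →L[ℝ] ((X →L[ℝ] ℝ) × ℝ) := fun x =>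
    ((extD θ x).comp (ContinuousLinearMap.fst ℝ X ℝ) -
      (ContinuousLinearMap.snd ℝ X ℝ).smulRight (θ x)).prod
        ((θ x).comp (ContinuousLinearMap.fst ℝ X ℝ))
  have hB : ContDiffOn ℝ ∞ B O := by
    rw [contDiffOn_clm_apply]
    rintro ⟨r, l⟩
    exact (((contDiffOn_extD hO hθ).clm_apply contDiffOn_const).sub
      (contDiffOn_const.smul hθ)).prodMk (hθ.clm_apply contDiffOn_const)
  have hinj : ∀ x ∈ O, Function.Injective (B x) := fun x hx => by
    rw [injective_iff_map_eq_zero]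
    rintro ⟨r, l⟩ h
    have h1 : ∀ w, extD θ x r w = l * θ x w := fun w => by
      have := congrArg (fun q => q.1 w) h
      simpa [B, sub_eq_zero] using this
    have h2 : θ x r = 0 := by simpa [B] using congrArg Prod.snd h
    have hr : r = 0 := (hc x hx).2 r h2 fun w hw => by rw [h1, hw, mul_zero]
    obtain ⟨n, hn⟩ : ∃ n, θ x n ≠ 0 := by
      by_contra! h
      exact (hc x hx).1 (ContinuousLinearMap.ext h)
    have := h1 n
    rw [hr] at this
    simp [hn] at this
    simp [hr, this]
  have hfin : Module.finrank ℝ (X × ℝ) = Module.finrank ℝ ((X →L[ℝ] ℝ) × ℝ) := by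
    have : Module.finrank ℝ (X →L[ℝ] ℝ) = Module.finrank ℝ X := by
      rw [← (LinearMap.toContinuousLinearMap (𝕜 := ℝ) (E := X) (F' := ℝ)).finrank_eq]
      exact Subspace.dual_finrank_eq
    simp [this]
  have hequiv : ∀ x ∈ O, ∃ e : (X × ℝ) ≃L[ℝ] ((X →L[ℝ] ℝ) × ℝ), (e : _ →L[ℝ] _) = B x :=
    fun x hx => ⟨(LinearEquiv.ofInjectiveOfFinrankEq (B x : _ →ₗ[ℝ] _) (hinj x hx)
      hfin).toContinuousLinearEquiv, by ext <;> rfl⟩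
  refine ⟨fun x => ((B x).inverse (-fderiv ℝ f x, f x)).1, ?_, fun x hx => ?_⟩
  · have h1 : ContDiffOn ℝ ∞ (fun x => (B x).inverse) O := fun x hx => by
      obtain ⟨e, he⟩ := hequiv x hx
      have := contDiffAt_map_inverse (𝕜 := ℝ) (n := ∞) e
      rw [he] at this
      exact this.comp_contDiffWithinAt x (hB x hx)
    have h2 := hf.fderiv_of_isOpen hO (m := ∞) le_rfl
    exact (h1.clm_apply (h2.neg.prodMk hf)).fst
  · obtain ⟨e, he⟩ := hequiv x hx
    have hs : B x ((B x).inverse (-fderiv ℝ f x, f x)) = (-fderiv ℝ f x, f x) := by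
      rw [← he, ContinuousLinearMap.inverse_equiv]
      simp
    refine ⟨congrArg Prod.snd hs, ((B x).inverse (-fderiv ℝ f x, f x)).2, fun w => ?_⟩
    have := congrArg (fun q => q.1 w) hs
    simp only [B, ContinuousLinearMap.prod_apply, sub_apply,
      ContinuousLinearMap.comp_apply, ContinuousLinearMap.smulRight_apply,
      ContinuousLinearMap.coe_fst', ContinuousLinearMap.coe_snd', smul_apply,
      neg_apply, smul_eq_mul] at this
    linarith

end ContactCoordinates

/-! ### Contact forms with isotropic vertical fibres -/

section FibredContact

variable {E K : Type*} [NormedAddCommGroup E] [NormedSpace ℝ E]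
  [NormedAddCommGroup K] [NormedSpace ℝ K]

/-- The pull-back along `E × K → E` of a 1-jet of functions. -/
def pullJet (a : ℝ × (E →L[ℝ] ℝ)) : ℝ × (E × K →L[ℝ] ℝ) :=
  (a.1, a.2.comp (ContinuousLinearMap.fst ℝ E K))

/-- The 1-jet on the base whose Reeb vector is the given vertical vector. -/
def vertJet (θ : E × K → E × K →L[ℝ] ℝ) (x : E × K) : K →L[ℝ] ℝ × (E →L[ℝ] ℝ) :=
  ((θ x).comp (ContinuousLinearMap.inr ℝ E K)).prod
    (-(((ContinuousLinearMap.compL ℝ E (E × K) ℝ).flip (ContinuousLinearMap.inl ℝ E K)).comp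
      ((extD θ x).comp (ContinuousLinearMap.inr ℝ E K))))

theorem vertJet_apply (θ : E × K → E × K →L[ℝ] ℝ) (x : E × K) (κ : K) :
    vertJet θ x κ =
      (θ x (0, κ), -(extD θ x (0, κ)).comp (ContinuousLinearMap.inl ℝ E K)) := by
  simp [vertJet]

/-- A contact form in coordinates for which the fibres of `E × K → E` are transversal to the
contact distribution and consist of Reeb vectors of functions on the base. -/
structure IsotropicOn (θ : E × K → E × K →L[ℝ] ℝ) (O : Set (E × K)) : Prop where
  isOpen : IsOpen O
  contDiffOn : ContDiffOn ℝ ∞ θ O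
  contactAt : ∀ x ∈ O, ContactAt θ x
  transversal : ∀ x ∈ O, ∃ κ : K, θ x (0, κ) ≠ 0
  isotropic : ∀ x ∈ O, ∀ κ : K, ∃ a, IsReebVector θ x (pullJet a) (0, κ)

namespace IsotropicOn

variable {θ : E × K → E × K →L[ℝ] ℝ} {O : Set (E × K)} (h : IsotropicOn θ O)

include h

/-- On vertical vectors the pulled back differential vanishes, so dθ((0, κ), ·) = l θ there. For a
vector κ₀ with θ(0, κ₀) ≠ 0, which transversality supplies, skew-symmetry applied to (κ₀, κ₀) gives
multiplier 0; skew-symmetry applied to (κ, κ₀) then gives l = 0 for every κ. -/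
theorem extD_vert {x : E × K} (hx : x ∈ O) (κ κ' : K) : extD θ x (0, κ) (0, κ') = 0 ∧
    ∀ a, IsReebVector θ x (pullJet a) (0, κ) → ∀ w, extD θ x (0, κ) w = -a.2 w.1 := by
  have key : ∀ κ a, IsReebVector θ x (pullJet a) (0, κ) →
      ∃ l : ℝ, ∀ w, extD θ x (0, κ) w = -a.2 w.1 + l * θ x w := fun κ a ha => ha.2
  have hl : ∀ (κ : K) (l : ℝ), (∀ κ', extD θ x (0, κ) (0, κ') = l * θ x (0, κ')) → l = 0 := by
    intro κ l hl
    obtain ⟨κ₀, h0⟩ := h.transversal x hx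
    obtain ⟨a₀, ha₀⟩ := h.isotropic x hx κ₀
    obtain ⟨l₀, hl₀⟩ := key _ _ ha₀
    have e1 := hl₀ (0, κ₀)
    have e2 := hl₀ (0, κ)
    have e3 := hl κ₀
    have e4 := extD_skew θ x (0, κ₀) (0, κ₀)
    have e5 := extD_skew θ x (0, κ) (0, κ₀)
    simp only [map_zero, neg_zero, zero_add] at e1 e2
    have h1 : l₀ = 0 := by
      have : l₀ * θ x (0, κ₀) = 0 := by linarith
      exact (mul_eq_zero.1 this).resolve_right h0
    have h2 : l * θ x (0, κ₀) = 0 := by rw [← e3, e5, e2, h1]; simp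
    exact (mul_eq_zero.1 h2).resolve_right h0
  have hr : ∀ a, IsReebVector θ x (pullJet a) (0, κ) →
      ∀ w, extD θ x (0, κ) w = -a.2 w.1 := fun a ha w => by
    obtain ⟨l, hl'⟩ := key _ _ ha
    have : l = 0 := hl κ l fun κ' => by simpa using hl' (0, κ')
    rw [hl', this, zero_mul, add_zero]
  obtain ⟨a, ha⟩ := h.isotropic x hx κ
  exact ⟨by simpa using hr a ha (0, κ'), hr⟩

/-- Once the multiplier is known to vanish, the equations determine the jet: its value is θ(0, κ)
and its differential is read off by evaluating dθ on vectors (e, 0). -/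
theorem isReebVector_iff {x : E × K} (hx : x ∈ O) {a : ℝ × (E →L[ℝ] ℝ)} {κ : K} :
    IsReebVector θ x (pullJet a) (0, κ) ↔ a = vertJet θ x κ := by
  rw [vertJet_apply]
  constructor
  · intro ha
    refine Prod.ext ha.1.symm (ContinuousLinearMap.ext fun e => ?_)
    have := (h.extD_vert hx κ 0).2 a ha (e, 0)
    simp [this]
  · rintro rfl
    refine ⟨rfl, 0, fun w => ?_⟩
    have e : extD θ x (0, κ) w = extD θ x (0, κ) (w.1, 0) + extD θ x (0, κ) (0, w.2) := by
      rw [← map_add]; simp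
    rw [e, (h.extD_vert hx κ w.2).1]
    simp [pullJet]

theorem vertJet_injective {x : E × K} (hx : x ∈ O) : Function.Injective (vertJet θ x) := by
  intro κ κ' hκ
  have h1 := (h.isReebVector_iff hx).2 (rfl : vertJet θ x κ = vertJet θ x κ)
  have h2 := (h.isReebVector_iff hx).2 hκ
  exact congrArg Prod.snd (h1.unique (h.contactAt x hx) h2)

variable [FiniteDimensional ℝ E] [FiniteDimensional ℝ K]

theorem contDiffOn_vertJet : ContDiffOn ℝ ∞ (vertJet θ) O := by
  refine contDiffOn_clm_apply.2 fun κ => ?_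
  simp only [vertJet_apply]
  exact (h.contDiffOn.clm_apply contDiffOn_const).prodMk
    (((contDiffOn_extD h.isOpen h.contDiffOn).clm_apply contDiffOn_const).clm_comp
      contDiffOn_const).neg

/-- This is closedness along the fibres. For the value component, the antisymmetrised derivative is
dθ on two vertical vectors, which is zero. For the differential component it is ddθ = 0 on (κ, κ',
e), in which the term differentiating the identically vanishing dθ(κ, κ') drops out. -/
theorem fderiv_vertJet_symm {x : E × K} (hx : x ∈ O) (κ κ' : K) :
    fderiv ℝ (vertJet θ) x (0, κ) κ' = fderiv ℝ (vertJet θ) x (0, κ') κ := by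
  have hd : ∀ κ, HasFDerivAt (fun y => vertJet θ y κ) ((fderiv ℝ (vertJet θ) x).flip κ) x :=
    fun κ => by
      have := ((h.contDiffOn_vertJet.contDiffAt (h.isOpen.mem_nhds hx)).differentiableAt
        (by simp)).hasFDerivAt.clm_apply (hasFDerivAt_const κ x)
      rwa [ContinuousLinearMap.comp_zero, zero_add] at this
  have h1 : ∀ κ w, (fderiv ℝ (vertJet θ) x w κ).1 = fderiv ℝ θ x w (0, κ) := fun κ w => by
    have e1 : HasFDerivAt (fun y => θ y (0, κ)) _ x := (hd κ).fst.congr_of_eventuallyEq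
      (Filter.Eventually.of_forall fun y => by simp [vertJet_apply])
    have e2 := ((h.contDiffOn.contDiffAt (h.isOpen.mem_nhds hx)).differentiableAt
      (by simp)).hasFDerivAt.clm_apply (hasFDerivAt_const ((0 : E), κ) x)
    simpa using congrArg (fun A => A w) (e1.unique e2)
  have h2 : ∀ κ w e, (fderiv ℝ (vertJet θ) x w κ).2 e =
      -fderiv ℝ (fun y => extD θ y (0, κ) (e, 0)) x w := fun κ w e => by
    have e1 : HasFDerivAt (fun y => -extD θ y (0, κ) (e, 0)) _ x :=
      (((hd κ).snd.clm_apply (hasFDerivAt_const e x))).congr_of_eventuallyEq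
        (Filter.Eventually.of_forall fun y => by simp [vertJet_apply])
    have e2 := (((contDiffOn_extD_apply h.isOpen h.contDiffOn (0, κ) (e, 0)).contDiffAt
      (h.isOpen.mem_nhds hx)).differentiableAt (by simp)).hasFDerivAt.neg
    simpa using congrArg (fun A => A w) (e1.unique e2)
  refine Prod.ext ?_ (ContinuousLinearMap.ext fun e => ?_)
  · rw [h1, h1, ← sub_eq_zero, ← extD_apply]
    exact (h.extD_vert hx κ κ').1
  · rw [h2, h2, neg_inj]
    have hc := fderiv_extD_cyclic h.isOpen h.contDiffOn hx (0, κ) (0, κ') (e, 0)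
    have z : fderiv ℝ (fun y => extD θ y (0, κ) (0, κ')) x = 0 := by
      have : (fun y => extD θ y (0, κ) (0, κ')) =ᶠ[𝓝 x] fun _ => (0 : ℝ) :=
        Filter.eventually_of_mem (h.isOpen.mem_nhds hx) fun y hy => (h.extD_vert hy κ κ').1
      rw [this.fderiv_eq]
      simp
    have s : (fun y => extD θ y (0, κ) (e, 0)) = -fun y => extD θ y (e, 0) (0, κ) := by
      funext y
      exact extD_skew θ y _ _
    rw [z] at hc
    rw [s, fderiv_neg]
    simp at hc ⊢
    linarith

/-- Coordinates in which the Reeb vectors tangent to the fibres are constant. -/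
theorem exists_chart {x₀ : E × K} (hx₀ : x₀ ∈ O) {Q : ℝ × (E →L[ℝ] ℝ) →L[ℝ] K}
    (hQ : Function.Injective (Q.comp (vertJet θ x₀))) :
    ∃ e : OpenPartialHomeomorph (E × K) (E × K), x₀ ∈ e.source ∧ e.source ⊆ O ∧
      ContDiffOn ℝ ∞ e e.source ∧ ContDiffOn ℝ ∞ e.symm e.target ∧
      (∀ x ∈ e.source, (e x).1 = x.1) ∧
      ∀ x ∈ e.source, ∀ κ, fderiv ℝ e x (0, κ) = (0, Q (vertJet θ x κ)) := by
  obtain ⟨U, f, hU, hxU, hUO, hf, hfT⟩ := exists_fibrewise_primitive h.isOpen h.contDiffOn_vertJet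
    (fun x hx κ κ' => h.fderiv_vertJet_symm hx κ κ') hx₀
  -- Only the fibre coordinates change: they become Q of a fibrewise primitive of `vertJet`. The
  -- fibre derivative is then Q ∘ `vertJet`, so the Reeb vector of a jet is mapped to Q of that jet.
  let Θ : E × K → E × K := fun x => (x.1, Q (f x))
  have hΘ : ContDiff ℝ ∞ Θ := contDiff_fst.prodMk (Q.contDiff.comp hf)
  have hd : ∀ x, HasFDerivAt Θ ((ContinuousLinearMap.fst ℝ E K).prod (Q.comp (fderiv ℝ f x))) x :=
    fun x => hasFDerivAt_fst.prodMk
      (Q.hasFDerivAt.comp x (hf.differentiable (by simp)).differentiableAt.hasFDerivAt)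
  have hinj : Function.Injective ((ContinuousLinearMap.fst ℝ E K).prod (Q.comp (fderiv ℝ f x₀))) := by
    rw [injective_iff_map_eq_zero]
    rintro ⟨e, κ⟩ hw
    obtain ⟨rfl, h2⟩ : e = 0 ∧ Q (fderiv ℝ f x₀ (e, κ)) = 0 := by simpa using hw
    rw [hfT _ hxU] at h2
    rw [hQ (a₁ := κ) (a₂ := 0) (by simpa using h2)]
    rfl
  let f' : (E × K) ≃L[ℝ] (E × K) := (LinearEquiv.ofInjectiveEndo
    ((ContinuousLinearMap.fst ℝ E K).prod (Q.comp (fderiv ℝ f x₀)) : (E × K) →ₗ[ℝ] (E × K))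
      hinj).toContinuousLinearEquiv
  obtain ⟨e, he0, heU, he, hes⟩ := exists_openPartialHomeomorph_of_hasFDerivAt hU hΘ.contDiffOn hxU
    (f' := f') (hd x₀)
  rw [← he] at hd hΘ
  refine ⟨e, he0, heU.trans hUO, hΘ.contDiffOn, hes, fun x _ => by rw [he], fun x hx κ => ?_⟩
  rw [(hd x).fderiv]
  simp [hfT x (heU hx)]

end IsotropicOn

end FibredContact

/-! ### Cut-off functions and global sections with prescribed germs -/

section Sections

variable {E : Type*} [NormedAddCommGroup E] [NormedSpace ℝ E] [FiniteDimensional ℝ E]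
  {M : Type*} [TopologicalSpace M] [ChartedSpace E M] [IsManifold 𝓘(ℝ, E) ∞ M] [T2Space M]

theorem exists_cutoff {m₀ : M} {O : Set M} (hO : O ∈ 𝓝 m₀) :
    ∃ χ : C^∞⟮𝓘(ℝ, E), M; 𝓘(ℝ, ℝ), ℝ⟯, tsupport χ ⊆ O ∧ ∀ᶠ m in 𝓝 m₀, χ m = 1 := by
  obtain ⟨f, -, hf⟩ := (SmoothBumpFunction.nhds_basis_tsupport (I := 𝓘(ℝ, E)) m₀).mem_iff.1 hO
  exact ⟨⟨f, f.contMDiff⟩, hf, f.eventuallyEq_one⟩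

variable {L : M → Type*} [TopologicalSpace (TotalSpace ℝ L)] [∀ p, TopologicalSpace (L p)]
  [∀ p, AddCommGroup (L p)] [∀ p, Module ℝ (L p)] [FiberBundle ℝ L] [VectorBundle ℝ ℝ L]

/-- A section of a smooth vector bundle that is smooth near a point agrees near that point with a
global smooth section, supported where the given one is smooth. -/
theorem exists_section_eventuallyEq {F : Type*} [NormedAddCommGroup F] [NormedSpace ℝ F]
    {W : M → Type*} [TopologicalSpace (TotalSpace F W)] [∀ p, TopologicalSpace (W p)]
    [∀ p, AddCommGroup (W p)] [∀ p, Module ℝ (W p)] [FiberBundle F W] [VectorBundle ℝ F W]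
    [ContMDiffVectorBundle ∞ F W 𝓘(ℝ, E)]
    {m₀ : M} {O : Set M} (hO : IsOpen O) (hm : m₀ ∈ O) {v : ∀ m, W m}
    (hv : ContMDiffOn 𝓘(ℝ, E) (𝓘(ℝ, E).prod 𝓘(ℝ, F)) ∞ (fun m => TotalSpace.mk' F m (v m)) O) :
    ∃ (χ : C^∞⟮𝓘(ℝ, E), M; 𝓘(ℝ, ℝ), ℝ⟯) (u : Cₛ^∞⟮𝓘(ℝ, E); F, W⟯),
      (∀ m, u m = χ m • v m) ∧ (∀ m, m ∉ O → χ m = 0) ∧ ∀ᶠ m in 𝓝 m₀, χ m = 1 := by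
  obtain ⟨χ, h1, h2⟩ := exists_cutoff (E := E) (hO.mem_nhds hm)
  refine ⟨χ, ⟨fun m => χ m • v m, ?_⟩, fun m => rfl, fun m h => ?_, h2⟩
  · exact ContMDiffOn.smul_section_of_tsupport χ.contMDiff.contMDiffOn hO h1 hv
  · exact image_eq_zero_of_notMem_tsupport fun h' => h (h1 h')

variable [ContMDiffVectorBundle ∞ ℝ L 𝓘(ℝ, E)]

/-- A smooth function near a point is, near that point, the coordinate of a global section in the
preferred trivialisation. -/
theorem exists_section_coord {m₀ : M} {g : M → ℝ} {O : Set M} (hO1 : O ∈ 𝓝 m₀)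
    (hO2 : ContMDiffOn 𝓘(ℝ, E) 𝓘(ℝ, ℝ) ∞ g O) :
    ∃ u : Sections E L, ∀ᶠ m in 𝓝 m₀, (trivializationAt ℝ L m₀ ⟨m, u m⟩).2 = g m := by
  set t := trivializationAt ℝ L m₀
  have hb := t.open_baseSet.mem_nhds (FiberBundle.mem_baseSet_trivializationAt' m₀)
  have hmem := Filter.inter_mem hO1 hb
  obtain ⟨O', hO'1, hO'2, hO'3⟩ := mem_nhds_iff.1 hmem
  have hv : ContMDiffOn 𝓘(ℝ, E) (𝓘(ℝ, E).prod 𝓘(ℝ, ℝ)) ∞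
      (fun m => TotalSpace.mk' ℝ m (t.symm m (g m))) O' := by
    rw [t.contMDiffOn_section_iff hO'2 fun m hm => (hO'1 hm).2]
    exact (hO2.mono fun m hm => (hO'1 hm).1).congr fun m hm => by
      rw [t.apply_mk_symm (hO'1 hm).2]
  obtain ⟨χ, u, h1, -, h3⟩ := exists_section_eventuallyEq hO'2 hO'3 hv
  refine ⟨u, ?_⟩
  filter_upwards [h3, hO'2.mem_nhds hO'3] with m hm hm'
  rw [h1, hm, one_smul, t.apply_mk_symm (hO'1 hm').2]

theorem exists_section_ne_zero (m₀ : M) : ∃ u : Sections E L, u m₀ ≠ 0 := by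
  obtain ⟨u, hu⟩ := exists_section_coord (E := E) (L := L) (m₀ := m₀) (g := fun _ => 1)
    Filter.univ_mem contMDiffOn_const
  refine ⟨u, fun h => ?_⟩
  have h1 := hu.self_of_nhds
  have h2 := congrArg Prod.snd ((trivializationAt ℝ L m₀).zeroSection ℝ
    (FiberBundle.mem_baseSet_trivializationAt' m₀))
  rw [h] at h1
  exact zero_ne_one (h2.symm.trans h1)

end Sections

/-! ### Coefficients with respect to a frame of a line bundle -/

section Coef

variable {E : Type*} [NormedAddCommGroup E] [NormedSpace ℝ E]
  {M : Type*} [TopologicalSpace M] [ChartedSpace E M]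
  {L : M → Type*} [TopologicalSpace (TotalSpace ℝ L)] [∀ p, TopologicalSpace (L p)]
  [∀ p, AddCommGroup (L p)] [∀ p, Module ℝ (L p)] [FiberBundle ℝ L] [VectorBundle ℝ ℝ L]

/-- The coefficient of an element of the line `L m` with respect to `s m`. -/
def coef (s : Sections E L) (m : M) : L m →L[ℝ] ℝ :=
  ((trivializationAt ℝ L m ⟨m, s m⟩).2)⁻¹ • (trivializationAt ℝ L m).continuousLinearMapAt ℝ m

theorem snd_trivialization_smul (t : Trivialization ℝ (TotalSpace.proj : TotalSpace ℝ L → M))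
    [t.IsLinear ℝ] {m : M} (hm : m ∈ t.baseSet) (c : ℝ) (l : L m) :
    (t ⟨m, c • l⟩).2 = c * (t ⟨m, l⟩).2 :=
  (t.linear ℝ hm).map_smul c l

theorem snd_trivialization_injective
    (t : Trivialization ℝ (TotalSpace.proj : TotalSpace ℝ L → M)) [t.IsLinear ℝ]
    {m : M} (hm : m ∈ t.baseSet) : Function.Injective fun l : L m => (t ⟨m, l⟩).2 := by
  intro l l' h
  have h1 := t.symm_apply_apply_mk hm l
  have h2 := t.symm_apply_apply_mk hm l'
  rw [← h1, ← h2]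
  exact congrArg (t.symm m) h

theorem snd_trivialization_ne_zero
    (t : Trivialization ℝ (TotalSpace.proj : TotalSpace ℝ L → M)) [t.IsLinear ℝ]
    {m : M} (hm : m ∈ t.baseSet) {l : L m} : (t ⟨m, l⟩).2 ≠ 0 ↔ l ≠ 0 := by
  have h0 : (t ⟨m, 0⟩).2 = 0 := (t.linear ℝ hm).map_zero
  rw [not_iff_not]
  exact ⟨fun h => snd_trivialization_injective t hm (h.trans h0.symm), fun h => by rw [h, h0]⟩

theorem coef_apply (s : Sections E L) (m : M) (l : L m) :
    coef s m l = (trivializationAt ℝ L m ⟨m, l⟩).2 / (trivializationAt ℝ L m ⟨m, s m⟩).2 := by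
  have h := (trivializationAt ℝ L m).continuousLinearMapAt_apply_of_mem (R := ℝ)
    (FiberBundle.mem_baseSet_trivializationAt' m) l
  rw [coef, smul_apply, h, smul_eq_mul, div_eq_inv_mul]

theorem coef_smul {s : Sections E L} {m : M} (hs : s m ≠ 0) (l : L m) : coef s m l • s m = l := by
  have hb := FiberBundle.mem_baseSet_trivializationAt' (F := ℝ) (E := L) m
  refine snd_trivialization_injective (trivializationAt ℝ L m) hb ?_
  simp only [snd_trivialization_smul _ hb, coef_apply]
  exact div_mul_cancel₀ _ ((snd_trivialization_ne_zero _ hb).2 hs)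

theorem coef_eq_of_smul {s : Sections E L} {m : M} (hs : s m ≠ 0) {c : ℝ} {l : L m}
    (h : c • s m = l) : coef s m l = c := by
  have := coef_smul hs l
  rw [← h] at this ⊢
  exact smul_left_injective ℝ hs this

theorem coef_eq_div {s : Sections E L} {m : M} (hs : s m ≠ 0)
    (t : Trivialization ℝ (TotalSpace.proj : TotalSpace ℝ L → M)) [t.IsLinear ℝ]
    (hm : m ∈ t.baseSet) (l : L m) : coef s m l = (t ⟨m, l⟩).2 / (t ⟨m, s m⟩).2 := by
  rw [eq_div_iff ((snd_trivialization_ne_zero t hm).2 hs), ← snd_trivialization_smul t hm,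
    coef_smul hs]

theorem eventually_section_ne_zero {s : Sections E L} {m : M} (hs : s m ≠ 0) :
    ∀ᶠ m' in 𝓝 m, s m' ≠ 0 := by
  set t := trivializationAt ℝ L m
  have hb := FiberBundle.mem_baseSet_trivializationAt' (F := ℝ) (E := L) m
  have h1 := ((contMDiffAt_section m).1 (s.contMDiff m)).continuousAt
  filter_upwards [h1.eventually_ne ((snd_trivialization_ne_zero t hb).2 hs),
    t.open_baseSet.mem_nhds hb] with m' h h'
  exact (snd_trivialization_ne_zero t h').1 h

/-- The definition of `coef` uses a trivialisation depending on the point, but a quotient of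
coordinates is independent of it. Near m everything can be computed in the one at m. -/
theorem contMDiffAt_coef [IsManifold 𝓘(ℝ, E) ∞ M] [ContMDiffVectorBundle ∞ ℝ L 𝓘(ℝ, E)]
    {s : Sections E L} {m : M} (hs : s m ≠ 0)
    {v : ∀ m, L m} (hv : ContMDiffAt 𝓘(ℝ, E) (𝓘(ℝ, E).prod 𝓘(ℝ, ℝ)) ∞
      (fun m => TotalSpace.mk' ℝ m (v m)) m) :
    ContMDiffAt 𝓘(ℝ, E) 𝓘(ℝ, ℝ) ∞ (fun m => coef s m (v m)) m := by
  set t := trivializationAt ℝ L m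
  have hb := FiberBundle.mem_baseSet_trivializationAt' (F := ℝ) (E := L) m
  have h1 := (contMDiffAt_section m).1 (s.contMDiff m)
  have h2 := (contMDiffAt_section m).1 hv
  refine (h2.div₀ h1 ((snd_trivialization_ne_zero t hb).2 hs)).congr_of_eventuallyEq ?_
  filter_upwards [t.open_baseSet.mem_nhds hb, eventually_section_ne_zero hs] with m' h h'
  exact coef_eq_div h' t h _

end Coef

theorem mlieBracket_eq_lieBracket {X : Type*} [NormedAddCommGroup X] [NormedSpace ℝ X]
    {V W : ∀ x : X, TangentSpace 𝓘(ℝ, X) x} :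
    VectorField.mlieBracket 𝓘(ℝ, X) V W = VectorField.lieBracket ℝ V W := by
  rw [← VectorField.mlieBracketWithin_univ, VectorField.mlieBracketWithin_eq_lieBracketWithin]
  exact VectorField.lieBracketWithin_univ

/-! ### Vector fields and their brackets in charts -/

section SmoothChart

variable {E : Type*} [NormedAddCommGroup E] [NormedSpace ℝ E]
  {M : Type*} [TopologicalSpace M] [ChartedSpace E M]
  {X : Type*} [NormedAddCommGroup X] [NormedSpace ℝ X]

/-- A diffeomorphism from an open subset of `M` to an open subset of the vector space `X`. -/
structure IsSmoothChart (D : OpenPartialHomeomorph M X) : Prop where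
  contMDiffOn : ContMDiffOn 𝓘(ℝ, E) 𝓘(ℝ, X) ∞ D D.source
  contMDiffOn_symm : ContMDiffOn 𝓘(ℝ, X) 𝓘(ℝ, E) ∞ D.symm D.target

variable {D : OpenPartialHomeomorph M X}

theorem IsSmoothChart.contMDiffAt (hD : IsSmoothChart (E := E) D) {m : M}
    (hm : m ∈ D.source) : ContMDiffAt 𝓘(ℝ, E) 𝓘(ℝ, X) ∞ D m :=
  hD.contMDiffOn.contMDiffAt (D.open_source.mem_nhds hm)

theorem IsSmoothChart.contMDiffAt_symm (hD : IsSmoothChart (E := E) D) {x : X} (hx : x ∈ D.target) :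
    ContMDiffAt 𝓘(ℝ, X) 𝓘(ℝ, E) ∞ D.symm x :=
  hD.contMDiffOn_symm.contMDiffAt (D.open_target.mem_nhds hx)

variable [FiniteDimensional ℝ E] [IsManifold 𝓘(ℝ, E) ∞ M] [T2Space M] [FiniteDimensional ℝ X]

/-- The differential of a chart. -/
def chartDeriv (E : Type*) [NormedAddCommGroup E] [NormedSpace ℝ E]
    {M : Type*} [TopologicalSpace M] [ChartedSpace E M]
    {X : Type*} [NormedAddCommGroup X] [NormedSpace ℝ X] (D : OpenPartialHomeomorph M X) (m : M) :
    TangentSpace 𝓘(ℝ, E) m →L[ℝ] X := mfderiv 𝓘(ℝ, E) 𝓘(ℝ, X) D m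

/-- The vector field on `M` that reads `V` in a chart. -/
def liftField (E : Type*) [NormedAddCommGroup E] [NormedSpace ℝ E]
    {M : Type*} [TopologicalSpace M] [ChartedSpace E M]
    {X : Type*} [NormedAddCommGroup X] [NormedSpace ℝ X]
    (D : OpenPartialHomeomorph M X) (V : X → X) (m : M) : TangentSpace 𝓘(ℝ, E) m :=
  (chartDeriv E D m).inverse (V (D m))

/-- The coordinate expression of a vector field. -/
def chartField (D : OpenPartialHomeomorph M X) (R : VectorFields E M) (x : X) : X :=
  chartDeriv E D (D.symm x) (R (D.symm x))

namespace IsSmoothChart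

variable (hD : IsSmoothChart (E := E) D)
include hD

theorem mdifferentiable : D.MDifferentiable 𝓘(ℝ, E) 𝓘(ℝ, X) :=
  ⟨hD.contMDiffOn.mdifferentiableOn (by simp), hD.contMDiffOn_symm.mdifferentiableOn (by simp)⟩

theorem isInvertible {m : M} (hm : m ∈ D.source) : (chartDeriv E D m).IsInvertible :=
  ⟨hD.mdifferentiable.mfderiv hm, rfl⟩

theorem chartDeriv_inverse {m : M} (hm : m ∈ D.source) (x : X) :
    chartDeriv E D m ((chartDeriv E D m).inverse x) = x :=
  (hD.isInvertible hm).self_apply_inverse x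

theorem inverse_chartDeriv {m : M} (hm : m ∈ D.source) (r : TangentSpace 𝓘(ℝ, E) m) :
    (chartDeriv E D m).inverse (chartDeriv E D m r) = r :=
  (hD.isInvertible hm).inverse_apply_self r

theorem contMDiffAt_liftField {m : M} (hm : m ∈ D.source) {V : X → X}
    (hV : ContDiffAt ℝ ∞ V (D m)) : ContMDiffAt 𝓘(ℝ, E) 𝓘(ℝ, E).tangent ∞
      (fun m => (⟨m, liftField E D V m⟩ : TangentBundle 𝓘(ℝ, E) M)) m := by
  have := FiniteDimensional.complete ℝ E
  have h : ContMDiffAt 𝓘(ℝ, X) 𝓘(ℝ, X).tangent ∞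
      (fun x => (⟨x, V x⟩ : TangentBundle 𝓘(ℝ, X) X)) (D m) :=
    contMDiffAt_vectorSpace_iff_contDiffAt.2 hV
  exact h.mpullback_vectorField_preimage (hD.contMDiffAt hm) (hD.isInvertible hm) (by simp)

theorem contDiffOn_chartField (R : VectorFields E M) :
    ContDiffOn ℝ ∞ (chartField D R) D.target := by
  have := FiniteDimensional.complete ℝ E
  have := FiniteDimensional.complete ℝ X
  intro x hx
  have h1 : ContMDiffAt 𝓘(ℝ, E) 𝓘(ℝ, E).tangent ∞
      (fun m => (⟨m, R m⟩ : TangentBundle 𝓘(ℝ, E) M)) (D.symm x) := R.contMDiff _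
  have hi := hD.mdifferentiable.symm
  have h := h1.mpullback_vectorField_preimage (hD.contMDiffAt_symm hx)
    ⟨hi.mfderiv hx, rfl⟩ (by simp)
  rw [contMDiffAt_vectorSpace_iff_contDiffAt] at h
  refine (h.congr_of_eventuallyEq ?_).contDiffWithinAt
  filter_upwards [D.open_target.mem_nhds hx] with y hy
  have h1 := hD.mdifferentiable.symm_comp_deriv (D.map_target hy)
  have h2 := hD.mdifferentiable.comp_symm_deriv hy
  rw [D.right_inv hy] at h1
  rw [VectorField.mpullback_apply]
  exact (congrFun (congrArg DFunLike.coe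
    (ContinuousLinearMap.inverse_eq (f := mfderiv 𝓘(ℝ, X) 𝓘(ℝ, E) D.symm y) h1 h2)) _).symm

theorem liftField_chartField (R : VectorFields E M) {m : M} (hm : m ∈ D.source) :
    liftField E D (chartField D R) m = R m := by
  rw [liftField, chartField, D.left_inv hm, hD.inverse_chartDeriv hm]

theorem chartField_eq {R : VectorFields E M} {V : X → X} {m : M} (hm : m ∈ D.source)
    (h : R m = liftField E D V m) : chartField D R (D m) = V (D m) := by
  rw [chartField, D.left_inv hm, h, liftField, hD.chartDeriv_inverse hm]

/-- Near m both fields are the pull-backs of their coordinate expressions, and the Lie bracket is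
natural under pull-back. -/
theorem mlieBracket_eq (R Y : VectorFields E M) {m : M} (hm : m ∈ D.source) :
    VectorField.mlieBracket 𝓘(ℝ, E) R Y m = liftField E D
      (VectorField.lieBracket ℝ (chartField D R) (chartField D Y)) m := by
  have := FiniteDimensional.complete ℝ E
  have := FiniteDimensional.complete ℝ X
  have : IsManifold 𝓘(ℝ, E) (minSmoothness ℝ 2) M := by
    rw [minSmoothness_of_isRCLikeNormedField]; infer_instance
  have hd (Z : VectorFields E M) : MDifferentiableAt 𝓘(ℝ, X) 𝓘(ℝ, X).tangent
      (fun x => (⟨x, (chartField D Z : X → X) x⟩ : TangentBundle 𝓘(ℝ, X) X)) (D m) :=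
    (contMDiffAt_vectorSpace_iff_contDiffAt.2 ((hD.contDiffOn_chartField Z).contDiffAt
      (D.open_target.mem_nhds (D.map_source hm)))).mdifferentiableAt (by simp)
  have he (Z : VectorFields E M) : (Z : ∀ m, TangentSpace 𝓘(ℝ, E) m) =ᶠ[𝓝 m]
      VectorField.mpullback 𝓘(ℝ, E) 𝓘(ℝ, X) D (chartField D Z) := by
    filter_upwards [D.open_source.mem_nhds hm] with y hy
    exact (hD.liftField_chartField Z hy).symm
  have h2 : minSmoothness ℝ 2 ≤ ∞ := by
    rw [minSmoothness_of_isRCLikeNormedField]; exact ENat.LEInfty.out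
  have hb := mlieBracket_eq_lieBracket (V := (chartField D R : X → X))
    (W := (chartField D Y : X → X))
  rw [(he R).mlieBracket_vectorField_eq (he Y),
    ← VectorField.mpullback_mlieBracket (V := (chartField D R : X → X))
      (W := (chartField D Y : X → X)) (hd R) (hd Y) (hD.contMDiffAt hm) h2, hb]
  rfl

theorem exists_vectorField_eventuallyEq {m : M} (hm : m ∈ D.source) {V : X → X} {O : Set X}
    (hO : IsOpen O) (hmO : D m ∈ O) (hV : ContDiffOn ℝ ∞ V O) :
    ∃ (χ : C^∞⟮𝓘(ℝ, E), M; 𝓘(ℝ, ℝ), ℝ⟯) (Y : VectorFields E M),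
      (∀ m, Y m = χ m • liftField E D V m) ∧ (∀ m, m ∉ D.source ∩ D ⁻¹' O → χ m = 0) ∧
      ∀ᶠ m in 𝓝 m, χ m = 1 :=
  exists_section_eventuallyEq (D.isOpen_inter_preimage hO) ⟨hm, hmO⟩ fun _ h =>
    (hD.contMDiffAt_liftField h.1 (hV.contDiffAt (hO.mem_nhds h.2))).contMDiffWithinAt

end IsSmoothChart
end SmoothChart

/-! ### Contact structures in coordinates; existence and uniqueness of Reeb vector fields -/

section CoordForm

variable {E : Type*} [NormedAddCommGroup E] [NormedSpace ℝ E] [FiniteDimensional ℝ E]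
  {M : Type*} [TopologicalSpace M] [ChartedSpace E M] [IsManifold 𝓘(ℝ, E) ∞ M] [T2Space M]
  {L : M → Type*} [TopologicalSpace (TotalSpace ℝ L)] [∀ p, TopologicalSpace (L p)]
  [∀ p, AddCommGroup (L p)] [∀ p, Module ℝ (L p)] [FiberBundle ℝ L] [VectorBundle ℝ ℝ L]
  [∀ p, IsTopologicalAddGroup (L p)] [∀ p, ContinuousSMul ℝ (L p)]
  [ContMDiffVectorBundle ∞ ℝ L 𝓘(ℝ, E)]
  {X : Type*} [NormedAddCommGroup X] [NormedSpace ℝ X] [FiniteDimensional ℝ X]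

/-- The coordinate expression of a contact form in a chart and a frame. -/
def coordForm (C : ContactForm E L) (s : Sections E L) (D : OpenPartialHomeomorph M X) (x : X) :
    X →L[ℝ] ℝ :=
  (coef s (D.symm x)).comp ((C.form (D.symm x)).comp (chartDeriv E D (D.symm x)).inverse)

/-- The coordinate expression of a section. -/
def coordSection (s v : Sections E L) (D : OpenPartialHomeomorph M X) (x : X) : ℝ :=
  coef s (D.symm x) (v (D.symm x))

/-- A chart of `M` together with a frame of `L` over its source. -/
structure IsFramedChart (D : OpenPartialHomeomorph M X) (s : Sections E L) : Prop extends
    IsSmoothChart (E := E) D where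
  ne_zero : ∀ m ∈ D.source, s m ≠ 0

theorem exists_isFramedChart (m : M) : ∃ (D : OpenPartialHomeomorph M E) (s : Sections E L),
    m ∈ D.source ∧ IsFramedChart D s := by
  obtain ⟨s, hs⟩ := exists_section_ne_zero (E := E) (L := L) m
  obtain ⟨O, hO1, hO2, hO3⟩ := eventually_nhds_iff.1 (eventually_section_ne_zero hs)
  refine ⟨(chartAt E m).restr O, s, ?_, ⟨?_, ?_⟩, ?_⟩
  · rw [OpenPartialHomeomorph.restr_source' _ _ hO2]
    exact ⟨mem_chart_source E m, hO3⟩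
  · exact (contMDiffOn_chart (I := 𝓘(ℝ, E))).mono fun x hx => hx.1
  · exact (contMDiffOn_chart_symm (I := 𝓘(ℝ, E))).mono fun x hx => hx.1
  · intro m' hm'
    rw [OpenPartialHomeomorph.restr_source' _ _ hO2] at hm'
    exact hO1 _ hm'.2

namespace IsFramedChart

variable {D : OpenPartialHomeomorph M X} {s : Sections E L} (hD : IsFramedChart D s)
  (C : ContactForm E L)
include hD

theorem coordForm_chartDeriv {m : M} (hm : m ∈ D.source) (r : TangentSpace 𝓘(ℝ, E) m) :
    coordForm C s D (D m) (chartDeriv E D m r) = coef s m (C.form m r) := by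
  rw [coordForm, D.left_inv hm]
  exact congrArg (fun r => coef s m (C.form m r)) (hD.inverse_chartDeriv hm r)

theorem coordForm_eq {m : M} (hm : m ∈ D.source) (x : X) : coordForm C s D (D m) x =
    coef s m (C.form m ((chartDeriv E D m).inverse x)) := by
  rw [← hD.coordForm_chartDeriv C hm, hD.chartDeriv_inverse hm]

theorem coordForm_chartField {m : M} (hm : m ∈ D.source) (R : VectorFields E M) :
    coordForm C s D (D m) (chartField D R (D m)) = coef s m (C.form m (R m)) := by
  rw [chartField, D.left_inv hm, hD.coordForm_chartDeriv C hm]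

theorem coef_eq_zero_iff {m : M} (hm : m ∈ D.source) {l : L m} : coef s m l = 0 ↔ l = 0 := by
  refine ⟨fun h => ?_, fun h => by rw [h, map_zero]⟩
  rw [← coef_smul (hD.ne_zero m hm) l, h, zero_smul]

theorem coef_injective {m : M} (hm : m ∈ D.source) : Function.Injective (coef s m) :=
  (injective_iff_map_eq_zero _).2 fun _ h => (hD.coef_eq_zero_iff hm).1 h

theorem contDiffOn_coordForm : ContDiffOn ℝ ∞ (coordForm C s D) D.target := by
  rw [contDiffOn_clm_apply]
  intro w x hx
  have hm := D.map_target hx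
  have h1 := hD.contMDiffAt_liftField (V := fun _ => w) hm contDiffAt_const
  have h2 : ContMDiffAt 𝓘(ℝ, E) (𝓘(ℝ, E).prod 𝓘(ℝ, ℝ)) ∞
      (fun m => TotalSpace.mk' ℝ m (C.form m (liftField E D (fun _ => w) m))) (D.symm x) :=
    (C.form.contMDiff _).clm_bundle_apply h1
  have h3 := (contMDiffAt_coef (hD.ne_zero _ hm) h2).comp x (hD.contMDiffAt_symm hx)
  exact (contMDiffAt_iff_contDiffAt.1 h3).contDiffWithinAt

theorem contDiffOn_coordSection (v : Sections E L) :
    ContDiffOn ℝ ∞ (coordSection s v D) D.target := by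
  intro x hx
  have h3 := (contMDiffAt_coef (hD.ne_zero _ (D.map_target hx)) (v.contMDiff _)).comp x
    (hD.contMDiffAt_symm hx)
  exact (contMDiffAt_iff_contDiffAt.1 h3).contDiffWithinAt

theorem coordForm_ne_zero {x : X} (hx : x ∈ D.target) : coordForm C s D x ≠ 0 := by
  intro h
  have hm := D.map_target hx
  obtain ⟨r, hr⟩ := C.surjective (D.symm x) (s (D.symm x))
  have := hD.coordForm_chartDeriv C hm r
  rw [D.right_inv hx, h, hr] at this
  exact hD.ne_zero _ hm ((hD.coef_eq_zero_iff hm).1 this.symm)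

/-- Conditions on a contact form are stated through global horizontal fields; this turns them into
conditions on vectors. The constant field w is corrected by a multiple of a vector n transversal to
the kernel, and a cut-off keeps it horizontal. -/
theorem exists_isHorizontal {m : M} (hm : m ∈ D.source) {w : X}
    (hw : coordForm C s D (D m) w = 0) :
    ∃ Y : VectorFields E M, IsHorizontal C.form Y ∧ chartField D Y (D m) = w := by
  have hx := D.map_source hm
  obtain ⟨n, hn⟩ : ∃ n, coordForm C s D (D m) n ≠ 0 := by
    by_contra! h
    exact hD.coordForm_ne_zero C hx (ContinuousLinearMap.ext h)
  have hθ := hD.contDiffOn_coordForm C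
  set O := D.target ∩ {x | coordForm C s D x n ≠ 0} with hO
  have hOo : IsOpen O :=
    (hθ.clm_apply contDiffOn_const).continuousOn.isOpen_inter_preimage D.open_target
      isOpen_compl_singleton
  set V : X → X := fun x => w - (coordForm C s D x w / coordForm C s D x n) • n
  have hV : ContDiffOn ℝ ∞ V O := by
    have hθ' := hθ.mono (inter_subset_left : O ⊆ _)
    exact contDiffOn_const.sub (((hθ'.clm_apply contDiffOn_const).div
      (hθ'.clm_apply contDiffOn_const) fun x hx => hx.2).smul contDiffOn_const)
  have hmO : D m ∈ O := ⟨hx, hn⟩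
  obtain ⟨χ, Y, h1, h2, h3⟩ := hD.exists_vectorField_eventuallyEq hm hOo hmO hV
  refine ⟨Y, fun m' => ?_, ?_⟩
  · rw [h1]
    by_cases h : m' ∈ D.source ∩ D ⁻¹' O
    · rw [map_smul]
      have : coef s m' (C.form m' (liftField E D V m')) = 0 := by
        rw [liftField, ← hD.coordForm_eq C h.1]
        have h0 : coordForm C s D (D m') n ≠ 0 := h.2.2
        simp [V, div_mul_cancel₀ _ h0]
      rw [(hD.coef_eq_zero_iff h.1).1 this, smul_zero]
    · rw [h2 _ h, zero_smul, map_zero]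
  · have : Y m = liftField E D V m := by rw [h1, h3.self_of_nhds, one_smul]
    rw [hD.chartField_eq hm this]
    simp [V, hw]

/-- Cartan's formula for dθ(R, Y), in which the term containing θ(Y) vanishes. -/
theorem coef_mlieBracket {m : M} (hm : m ∈ D.source) {R Y : VectorFields E M} {v : Sections E L}
    (hR : ∀ᶠ m' in 𝓝 m, C.form m' (R m') = v m') (hY : IsHorizontal C.form Y) :
    coef s m (C.form m (VectorField.mlieBracket 𝓘(ℝ, E) R Y m)) =
      -extD (coordForm C s D) (D m) (chartField D R (D m)) (chartField D Y (D m)) -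
        fderiv ℝ (coordSection s v D) (D m) (chartField D Y (D m)) := by
  have hx := D.open_target.mem_nhds (D.map_source hm)
  have hd {V : Type _} [NormedAddCommGroup V] [NormedSpace ℝ V] {g : X → V}
      (hg : ContDiffOn ℝ ∞ g D.target) : DifferentiableAt ℝ g (D m) :=
    (hg.contDiffAt hx).differentiableAt (by simp)
  have hs : ∀ᶠ x in 𝓝 (D m), D.symm x ∈ D.source ∧ D (D.symm x) = x := by
    filter_upwards [hx] with x hx using ⟨D.map_target hx, D.right_inv hx⟩
  rw [hD.mlieBracket_eq R Y hm, liftField, ← hD.coordForm_eq C hm]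
  refine apply_lieBracket (hd (hD.contDiffOn_coordForm C)) (hd (hD.contDiffOn_chartField R))
    (hd (hD.contDiffOn_chartField Y)) ?_ ?_
  · have hc : ContinuousAt D.symm (D m) := D.continuousAt_symm (D.map_source hm)
    have hR2 : ∀ᶠ m' in 𝓝 (D.symm (D m)), C.form m' (R m') = v m' := by rwa [D.left_inv hm]
    have : ∀ᶠ x in 𝓝 (D m), C.form (D.symm x) (R (D.symm x)) = v (D.symm x) :=
      hc.eventually hR2
    filter_upwards [this, hs] with x h1 h2
    have := hD.coordForm_chartField C h2.1 R
    rwa [h2.2, h1] at this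
  · filter_upwards [hs] with x h2
    have := hD.coordForm_chartField C h2.1 Y
    rwa [h2.2, hY, map_zero] at this

/-- By `coef_mlieBracket` with v = 0, the curvature of horizontal fields is -dθ. Every vector of the
kernel extends to a horizontal field, so the non-degeneracy assumed for fields is pointwise. -/
theorem contactAt {x : X} (hx : x ∈ D.target) : ContactAt (coordForm C s D) x := by
  refine ⟨hD.coordForm_ne_zero C hx, fun r hr h => ?_⟩
  have hm := D.map_target hx
  rw [← D.right_inv hx] at hr h
  obtain ⟨R, hR, hRr⟩ := hD.exists_isHorizontal C hm hr
  have h0 : R (D.symm x) = 0 := by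
    refine C.nondegenerate _ R hR fun Y hY => ?_
    rw [← hD.coef_eq_zero_iff hm, hD.coef_mlieBracket C hm (v := 0) (.of_forall hR) hY]
    have hf : coordSection s (0 : Sections E L) D = fun _ => 0 := by
      funext x; exact map_zero _
    rw [hRr, h, hf]
    · simp
    · rw [hD.coordForm_chartField C hm, hY, map_zero]
  rw [← hRr, chartField, D.left_inv hm, h0, map_zero]

/-- This and the next lemma translate the condition that brackets with horizontal fields stay
horizontal into the linear Reeb equations at one point. Horizontal fields attain every vector of the
kernel, so nothing is lost. -/
theorem isReebVector {m : M} (hm : m ∈ D.source) {R : VectorFields E M} {v : Sections E L}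
    (hR : ∀ᶠ m' in 𝓝 m, C.form m' (R m') = v m')
    (hR' : ∀ Y : VectorFields E M, IsHorizontal C.form Y →
      C.form m (VectorField.mlieBracket 𝓘(ℝ, E) R Y m) = 0) :
    IsReebVector (coordForm C s D) (D m)
      (coordSection s v D (D m), fderiv ℝ (coordSection s v D) (D m)) (chartField D R (D m)) := by
  refine (isReebVector_iff (hD.coordForm_ne_zero C (D.map_source hm))).2 ⟨?_, fun w hw => ?_⟩
  · rw [hD.coordForm_chartField C hm, hR.self_of_nhds, coordSection, D.left_inv hm]
  · obtain ⟨Y, hY, rfl⟩ := hD.exists_isHorizontal C hm hw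
    have := hD.coef_mlieBracket C hm hR hY
    rw [hR' Y hY, map_zero] at this
    linarith

theorem mlieBracket_horizontal {m : M} (hm : m ∈ D.source) {R : VectorFields E M}
    {v : Sections E L} (hR : ∀ᶠ m' in 𝓝 m, C.form m' (R m') = v m')
    (h : IsReebVector (coordForm C s D) (D m)
      (coordSection s v D (D m), fderiv ℝ (coordSection s v D) (D m)) (chartField D R (D m)))
    {Y : VectorFields E M} (hY : IsHorizontal C.form Y) :
    C.form m (VectorField.mlieBracket 𝓘(ℝ, E) R Y m) = 0 := by
  rw [← hD.coef_eq_zero_iff hm, hD.coef_mlieBracket C hm hR hY]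
  have := ((isReebVector_iff (hD.coordForm_ne_zero C (D.map_source hm))).1 h).2
    (chartField D Y (D m)) (by rw [hD.coordForm_chartField C hm, hY, map_zero])
  rw [this]
  simp

end IsFramedChart

/-- `R` is near `m` a Reeb vector field of `v`. -/
def IsReebNear (C : ContactForm E L) (v : Sections E L) (R : VectorFields E M) (m : M) : Prop :=
  ∀ᶠ m' in 𝓝 m, C.form m' (R m') = v m' ∧ ∀ Y : VectorFields E M, IsHorizontal C.form Y →
    C.form m' (VectorField.mlieBracket 𝓘(ℝ, E) R Y m') = 0

theorem IsReebNear.unique {C : ContactForm E L} {v : Sections E L} {R R' : VectorFields E M}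
    {m : M} (h : IsReebNear C v R m) (h' : IsReebNear C v R' m) : R m = R' m := by
  obtain ⟨D, s, hm, hD⟩ := exists_isFramedChart (E := E) (L := L) m
  have h1 := hD.isReebVector C hm (h.mono fun _ h => h.1) h.self_of_nhds.2
  have h2 := hD.isReebVector C hm (h'.mono fun _ h => h.1) h'.self_of_nhds.2
  have h3 := h1.unique (hD.contactAt C (D.map_source hm)) h2
  rw [← hD.liftField_chartField R hm, ← hD.liftField_chartField R' hm, liftField, liftField, h3]

theorem exists_isReebNear (C : ContactForm E L) (v : Sections E L) (m : M) :
    ∃ R : VectorFields E M, IsReebNear C v R m := by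
  obtain ⟨D, s, hm, hD⟩ := exists_isFramedChart (E := E) (L := L) m
  obtain ⟨V, hV, hV'⟩ := exists_contDiffOn_isReebVector D.open_target (hD.contDiffOn_coordForm C)
    (fun x hx => hD.contactAt C hx) (hD.contDiffOn_coordSection v)
  obtain ⟨χ, R, h1, -, h3⟩ := hD.exists_vectorField_eventuallyEq hm D.open_target
    (D.map_source hm) hV
  have h4 : ∀ᶠ m' in 𝓝 m, m' ∈ D.source ∧ R m' = liftField E D V m' := by
    filter_upwards [D.open_source.mem_nhds hm, h3] with m' h h'
    exact ⟨h, by rw [h1, h', one_smul]⟩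
  have h5 : ∀ m' ∈ D.source, R m' = liftField E D V m' → C.form m' (R m') = v m' := by
    intro m' h h'
    apply hD.coef_injective h
    rw [← hD.coordForm_chartField C h, hD.chartField_eq h h', (hV' _ (D.map_source h)).1,
      coordSection, D.left_inv h]
  refine ⟨R, ?_⟩
  -- The bracket at m' depends on the germ of the field there, so the field must agree with the
  -- lifted solution on a neighbourhood of m'.
  filter_upwards [h4.eventually_nhds] with m' hm'
  have h6 : ∀ᶠ m'' in 𝓝 m', C.form m'' (R m'') = v m'' := hm'.mono fun m'' h => h5 m'' h.1 h.2
  refine ⟨h6.self_of_nhds, fun Y hY => hD.mlieBracket_horizontal C hm'.self_of_nhds.1 h6 ?_ hY⟩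
  rw [hD.chartField_eq hm'.self_of_nhds.1 hm'.self_of_nhds.2]
  exact hV' _ (D.map_source hm'.self_of_nhds.1)

/-- Local solutions glue because they are unique: the field whose value at m is that of the solution
around m agrees near m with this one solution. -/
theorem exists_isReeb (C : ContactForm E L) (v : Sections E L) :
    ∃ R : VectorFields E M, IsReeb C R ∧ evalForm C.form R = v := by
  choose R hR using exists_isReebNear C v
  have he (m : M) : ∀ᶠ m' in 𝓝 m, R m' m' = R m m' := by
    filter_upwards [(hR m).eventually_nhds] with m' h using (hR m').unique h
  refine ⟨⟨fun m => R m m, fun m => ?_⟩, fun Y hY m => ?_, ?_⟩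
  · refine ((R m).contMDiff m).congr_of_eventuallyEq ?_
    filter_upwards [he m] with m' h
    rw [h]
  · have h := (hR m).self_of_nhds.2 Y hY
    have h2 : (fun m => R m m) =ᶠ[𝓝 m] R m := he m
    have h3 := h2.mlieBracket_vectorField_eq
      (Filter.EventuallyEq.refl (𝓝 m) (Y : ∀ m, TangentSpace 𝓘(ℝ, E) m))
    exact (congrArg (C.form m) h3).trans h
  · ext m
    exact (hR m).self_of_nhds.1

theorem reeb_spec (C : ContactForm E L) (v : Sections E L) :
    IsReeb C (reeb C v) ∧ evalForm C.form (reeb C v) = v := by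
  rw [reeb, dif_pos (exists_isReeb C v)]
  exact (exists_isReeb C v).choose_spec

theorem form_reeb (C : ContactForm E L) (v : Sections E L) (m : M) :
    C.form m (reeb C v m) = v m :=
  congrArg (fun w : Sections E L => w m) (reeb_spec C v).2

theorem IsFramedChart.isReebVector_reeb {D : OpenPartialHomeomorph M X} {s : Sections E L}
    (hD : IsFramedChart D s) (C : ContactForm E L) (v : Sections E L) {m : M} (hm : m ∈ D.source) :
    IsReebVector (coordForm C s D) (D m)
      (coordSection s v D (D m), fderiv ℝ (coordSection s v D) (D m))
      (chartDeriv E D m (reeb C v m)) := by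
  have := hD.isReebVector C hm (.of_forall (form_reeb C v))
    fun Y hY => (reeb_spec C v).1 Y hY m
  rwa [chartField, D.left_inv hm] at this

/-- The field R_{gv} - g R_v is horizontal, so its bracket with R_u is killed by θ. The Leibniz rule
for [R_u, g R_v] leaves the derivative of g along R_u. -/
theorem hasAnchor_reeb (C : ContactForm E L) (u : Sections E L) (m : M) :
    HasAnchor (reebBracket C) u m (reeb C u m) := by
  intro g v
  have := FiniteDimensional.complete ℝ E
  have : IsManifold 𝓘(ℝ, E) (minSmoothness ℝ 2) M := by
    rw [minSmoothness_of_isRCLikeNormedField]; infer_instance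
  set W : VectorFields E M := ⟨fun m => g m • reeb C v m, g.contMDiff.smul_section
    (reeb C v).contMDiff⟩ with hW
  set Z : VectorFields E M := reeb C (fsmul g v) - W with hZ
  have hZh : IsHorizontal C.form Z := by
    intro m
    have h1 : Z m = reeb C (fsmul g v) m - g m • reeb C v m := rfl
    rw [h1, map_sub, map_smul, form_reeb, form_reeb]
    exact sub_self _
  have hd (Y : VectorFields E M) : MDifferentiableAt 𝓘(ℝ, E) 𝓘(ℝ, E).tangent
      (fun m => (⟨m, Y m⟩ : TangentBundle 𝓘(ℝ, E) M)) m :=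
    (Y.contMDiff m).mdifferentiableAt (by simp)
  have h1 : (reeb C (fsmul g v) : ∀ m, TangentSpace 𝓘(ℝ, E) m) = (Z : ∀ m, _) + (W : ∀ m, _) := by
    funext m
    exact (sub_add_cancel (reeb C (fsmul g v) m) (W m)).symm
  have h2 : (W : ∀ m, TangentSpace 𝓘(ℝ, E) m) = (g : M → ℝ) • (reeb C v : ∀ m, _) := rfl
  have h3 := VectorField.mlieBracket_add_right (V := (reeb C u : ∀ m, TangentSpace 𝓘(ℝ, E) m))
    (hd Z) (hd W)
  have h4 := VectorField.mlieBracket_smul_right (V := (reeb C u : ∀ m, TangentSpace 𝓘(ℝ, E) m))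
    ((g.contMDiff m).mdifferentiableAt (by simp)) (hd (reeb C v))
  change C.form m (VectorField.mlieBracket 𝓘(ℝ, E) (reeb C u) (reeb C (fsmul g v)) m) =
    g m • C.form m (VectorField.mlieBracket 𝓘(ℝ, E) (reeb C u) (reeb C v) m) + _
  rw [h1, h3, h2, h4, map_add, map_add, map_smul, map_smul, form_reeb,
    (reeb_spec C u).1 Z hZh m, zero_add, add_comm]

end CoordForm

/-! ### Uniqueness of the anchor -/

section Anchor

variable {E : Type*} [NormedAddCommGroup E] [NormedSpace ℝ E] [FiniteDimensional ℝ E]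
  {P : Type*} [TopologicalSpace P] [ChartedSpace E P] [IsManifold 𝓘(ℝ, E) ∞ P] [T2Space P]
  {L : P → Type*} [TopologicalSpace (TotalSpace ℝ L)] [∀ p, TopologicalSpace (L p)]
  [∀ p, AddCommGroup (L p)] [∀ p, Module ℝ (L p)] [FiberBundle ℝ L] [VectorBundle ℝ ℝ L]
  [ContMDiffVectorBundle ∞ ℝ L 𝓘(ℝ, E)]

theorem exists_mvfderiv_eq (p : P) (l : E →L[ℝ] ℝ) : ∃ f : C^∞⟮𝓘(ℝ, E), P; 𝓘(ℝ, ℝ), ℝ⟯,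
    ∀ X : TangentSpace 𝓘(ℝ, E) p, mvfderiv 𝓘(ℝ, E) f p X =
      l (mfderiv 𝓘(ℝ, E) 𝓘(ℝ, E) (chartAt E p) p X) := by
  have hc : ContMDiffOn 𝓘(ℝ, E) 𝓘(ℝ, ℝ) ∞ (fun x => l (chartAt E p x)) (chartAt E p).source :=
    l.contMDiff.comp_contMDiffOn (contMDiffOn_chart (I := 𝓘(ℝ, E)))
  obtain ⟨χ, h1, h2⟩ := exists_cutoff (E := E)
    ((chartAt E p).open_source.mem_nhds (mem_chart_source E p))
  refine ⟨⟨fun x => χ x * l (chartAt E p x), fun x => ?_⟩, fun X => ?_⟩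
  · by_cases hx : x ∈ (chartAt E p).source
    · exact (χ.contMDiff x).mul (hc.contMDiffAt ((chartAt E p).open_source.mem_nhds hx))
    · refine contMDiffAt_const (c := (0 : ℝ)) |>.congr_of_eventuallyEq ?_
      filter_upwards [(isClosed_tsupport χ).isOpen_compl.mem_nhds fun h => hx (h1 h)] with y hy
      rw [image_eq_zero_of_notMem_tsupport hy, zero_mul]
  · have h3 : (fun x => χ x * l (chartAt E p x)) =ᶠ[𝓝 p] fun x => l (chartAt E p x) := by
      filter_upwards [h2] with x hx
      rw [hx, one_mul]
    have h4 : MDifferentiableAt 𝓘(ℝ, E) 𝓘(ℝ, E) (chartAt E p) p :=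
      (mdifferentiable_chart p).mdifferentiableAt (mem_chart_source E p)
    have h5 := (((l.hasMFDerivAt (x := chartAt E p p)).comp p h4.hasMFDerivAt).congr_of_eventuallyEq
      h3).mfderiv
    exact congrArg (fun T : E →L[ℝ] ℝ => T X) h5

/-- If two vectors differ, some global function has different derivatives along them. Testing the
Leibniz identity on this function and on a section that does not vanish at p gives a contradiction.
-/
theorem HasAnchor.unique {b : Sections E L → Sections E L → Sections E L} {u : Sections E L}
    {p : P} {X X' : TangentSpace 𝓘(ℝ, E) p} (h : HasAnchor b u p X) (h' : HasAnchor b u p X') :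
    X = X' := by
  obtain ⟨v, hv⟩ := exists_section_ne_zero (E := E) (L := L) p
  apply (mdifferentiable_chart (I := 𝓘(ℝ, E)) p).mfderiv_injective (mem_chart_source E p)
  by_contra hne
  obtain ⟨l, hl⟩ := SeparatingDual.exists_separating_of_ne (R := ℝ) (V := E) hne
  obtain ⟨f, hf⟩ := exists_mvfderiv_eq p l
  have h1 := (h f v).symm.trans (h' f v)
  rw [add_right_inj] at h1
  have h2 := smul_left_injective ℝ hv h1
  rw [hf, hf] at h2
  exact hl h2

end Anchor

/-! ### Composition and restriction of charts -/

section SmoothChart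

variable {E : Type*} [NormedAddCommGroup E] [NormedSpace ℝ E]
  {M : Type*} [TopologicalSpace M] [ChartedSpace E M]
  {X : Type*} [NormedAddCommGroup X] [NormedSpace ℝ X]
  {Y : Type*} [NormedAddCommGroup Y] [NormedSpace ℝ Y]

theorem isSmoothChart_chartAt [IsManifold 𝓘(ℝ, E) ∞ M] (m : M) : IsSmoothChart (E := E) (chartAt E m) :=
  ⟨contMDiffOn_chart (I := 𝓘(ℝ, E)), contMDiffOn_chart_symm (I := 𝓘(ℝ, E))⟩

variable {D : OpenPartialHomeomorph M X} (hD : IsSmoothChart (E := E) D)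
include hD

theorem IsSmoothChart.trans {e : OpenPartialHomeomorph X Y} (h : ContDiffOn ℝ ∞ e e.source)
    (h' : ContDiffOn ℝ ∞ e.symm e.target) : IsSmoothChart (E := E) (D.trans e) :=
  ⟨h.contMDiffOn.comp (hD.contMDiffOn.mono fun _ h => h.1) fun _ h => h.2,
    hD.contMDiffOn_symm.comp (h'.contMDiffOn.mono fun _ h => h.1) fun _ h => h.2⟩

theorem IsSmoothChart.restr (O : Set M) : IsSmoothChart (E := E) (D.restr O) :=
  ⟨hD.contMDiffOn.mono fun _ h => h.1, hD.contMDiffOn_symm.mono fun _ h => h.1⟩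

theorem IsSmoothChart.chartDeriv_trans {e : OpenPartialHomeomorph X Y}
    (h : ContDiffOn ℝ ∞ e e.source) {m : M} (hm : m ∈ (D.trans e).source)
    (v : TangentSpace 𝓘(ℝ, E) m) :
    chartDeriv E (D.trans e) m v = fderiv ℝ e (D m) (chartDeriv E D m v) := by
  rw [OpenPartialHomeomorph.trans_source] at hm
  have h1 : DifferentiableAt ℝ e (D m) :=
    (h.contDiffAt (e.open_source.mem_nhds hm.2)).differentiableAt (by simp)
  have h2 := h1.hasFDerivAt.hasMFDerivAt.comp m
    ((hD.contMDiffAt hm.1).mdifferentiableAt (by simp)).hasMFDerivAt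
  exact congrArg (fun T : E →L[ℝ] Y => T v) h2.mfderiv

end SmoothChart

/-! ### Jets of global sections -/

section Jets

variable {E : Type*} [NormedAddCommGroup E] [NormedSpace ℝ E] [FiniteDimensional ℝ E]
  {P : Type*} [TopologicalSpace P] [ChartedSpace E P] [IsManifold 𝓘(ℝ, E) ∞ P] [T2Space P]
  {L : P → Type*} [TopologicalSpace (TotalSpace ℝ L)] [∀ p, TopologicalSpace (L p)]
  [∀ p, AddCommGroup (L p)] [∀ p, Module ℝ (L p)] [FiberBundle ℝ L] [VectorBundle ℝ ℝ L]
  [ContMDiffVectorBundle ∞ ℝ L 𝓘(ℝ, E)]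

/-- A section that is affine in the preferred chart and trivialisation has any prescribed value and
derivative. -/
theorem exists_jet_eq (p : P) (a : (jetCore E L).Fiber p) :
    ∃ u : Sections E L, jet E L p u = a := by
  have hc : ContMDiffOn 𝓘(ℝ, E) 𝓘(ℝ, ℝ) ∞
      (fun x => a.1 + a.2 (chartAt E p x - chartAt E p p)) (chartAt E p).source :=
    contMDiffOn_const.add (a.2.contMDiff.comp_contMDiffOn
      ((contMDiffOn_chart (I := 𝓘(ℝ, E))).sub contMDiffOn_const))
  obtain ⟨u, hu⟩ := exists_section_coord (L := L)
    ((chartAt E p).open_source.mem_nhds (mem_chart_source E p)) hc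
  refine ⟨u, Prod.ext ?_ ?_⟩
  · have := hu.self_of_nhds
    rw [sub_self, map_zero, add_zero] at this
    exact this
  · have hcont := (chartAt E p).continuousAt_symm (mem_chart_target E p)
    have hu' : ∀ᶠ m in 𝓝 ((chartAt E p).symm (chartAt E p p)),
        (trivializationAt ℝ L p ⟨m, u m⟩).2 = a.1 + a.2 (chartAt E p m - chartAt E p p) := by
      rwa [(chartAt E p).left_inv (mem_chart_source E p)]
    have h1 : (fun y => (trivializationAt ℝ L p
        ⟨(chartAt E p).symm y, u ((chartAt E p).symm y)⟩).2) =ᶠ[𝓝 (chartAt E p p)]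
        fun y => a.1 + a.2 (y - chartAt E p p) := by
      filter_upwards [hcont.eventually hu', (chartAt E p).open_target.mem_nhds
        (mem_chart_target E p)] with y hy hy'
      rw [hy, (chartAt E p).right_inv hy']
    change fderiv ℝ _ _ = _
    rw [h1.fderiv_eq]
    have h2 : HasFDerivAt (fun y => a.1 + a.2 (y - chartAt E p p)) a.2 (chartAt E p p) := by
      simp only [map_sub]
      exact (a.2.hasFDerivAt.sub_const _).const_add a.1
    exact h2.fderiv

/-- The coordinate expression at `i` of an element of the jet bundle. -/
def jetCoord (i : P) (α : J1 E L) : ℝ × (E →L[ℝ] ℝ) := ((jetCore E L).localTriv i α).2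

theorem exists_jetCoord_eq {i p : P} (hp : p ∈ jetBaseSet E L i) (a : ℝ × (E →L[ℝ] ℝ)) :
    ∃ b : (jetCore E L).Fiber p, jetCoord i (⟨p, b⟩ : J1 E L) = a :=
  ⟨((jetCore E L).localTriv i).symm p a,
    congrArg Prod.snd (((jetCore E L).localTriv i).apply_mk_symm hp a)⟩

/-- The coordinate expression of a section in the preferred chart and trivialisation at `i`. -/
def localSection (i : P) (u : Sections E L) (e : E) : ℝ :=
  (trivializationAt ℝ L i ⟨(chartAt E i).symm e, u ((chartAt E i).symm e)⟩).2

theorem jetCoord_jet {i p : P} (hp : p ∈ jetBaseSet E L i) (u : Sections E L) :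
    jetCoord i ⟨p, jet E L p u⟩ =
      (localSection i u (chartAt E i p), fderiv ℝ (localSection i u) (chartAt E i p)) := by
  rw [jetCoord, localTriv_jet E L i p hp, localSection, (chartAt E i).left_inv hp.1]
  rfl

theorem differentiableAt_localSection {i p : P} (hp : p ∈ jetBaseSet E L i) (u : Sections E L) :
    DifferentiableAt ℝ (localSection i u) (chartAt E i p) := by
  have h2 : ContMDiffAt 𝓘(ℝ, E) 𝓘(ℝ, E) ∞ (chartAt E i).symm (chartAt E i p) :=
    (contMDiffOn_chart_symm (I := 𝓘(ℝ, E)) (n := ∞)).contMDiffAt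
      ((chartAt E i).open_target.mem_nhds ((chartAt E i).map_source hp.1))
  have h1 : ContMDiffAt 𝓘(ℝ, E) 𝓘(ℝ, ℝ) ∞ (fun x => (trivializationAt ℝ L i ⟨x, u x⟩).2)
      ((chartAt E i).symm (chartAt E i p)) := by
    rw [(chartAt E i).left_inv hp.1]
    exact ((trivializationAt ℝ L i).contMDiffAt_section_iff hp.2).1 (u.contMDiff p)
  exact (contMDiffAt_iff_contDiffAt.1 (h1.comp _ h2)).differentiableAt (by simp)

end Jets

/-! ### The normal form of a contact isotropic realisation -/

section Realisation

variable {E : Type*} [NormedAddCommGroup E] [NormedSpace ℝ E] [FiniteDimensional ℝ E]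
  {P : Type*} [TopologicalSpace P] [ChartedSpace E P] [IsManifold 𝓘(ℝ, E) ∞ P] [T2Space P]
  {L : P → Type*} [TopologicalSpace (TotalSpace ℝ L)] [∀ p, TopologicalSpace (L p)]
  [∀ p, AddCommGroup (L p)] [∀ p, Module ℝ (L p)] [FiberBundle ℝ L] [VectorBundle ℝ ℝ L]
  [ContMDiffVectorBundle ∞ ℝ L 𝓘(ℝ, E)]
  {E' : Type*} [NormedAddCommGroup E'] [NormedSpace ℝ E'] [FiniteDimensional ℝ E']
  {M : Type*} [TopologicalSpace M] [ChartedSpace E' M] [IsManifold 𝓘(ℝ, E') ∞ M] [T2Space M]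
  {L' : M → Type*} [TopologicalSpace (TotalSpace ℝ L')] [∀ m, TopologicalSpace (L' m)]
  [∀ m, AddCommGroup (L' m)] [∀ m, Module ℝ (L' m)] [FiberBundle ℝ L'] [VectorBundle ℝ ℝ L']
  [∀ m, IsTopologicalAddGroup (L' m)] [∀ m, ContinuousSMul ℝ (L' m)]
  [ContMDiffVectorBundle ∞ ℝ L' 𝓘(ℝ, E')]
  {k : ℕ} {J : JacobiStructure E L} {C : ContactForm E' L'} {φ : M → P}
  {F : BundleComponent E L E' L' φ}

/-- The anchors correspond under Dφ. Since F∘φ^*(fv) = (f∘φ) F∘φ^*v and φ is a Jacobi map, the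
Leibniz identity of R_{F∘φ^*u} on M becomes one for the bracket on P after cancelling the
isomorphism F. -/
theorem hasAnchor_mfderiv_reeb (hφ : IsContactIsotropicRealisation J C φ F) (u : Sections E L)
    (m : M) : HasAnchor (J.bracket · ·) u (φ m)
      (mfderiv 𝓘(ℝ, E') 𝓘(ℝ, E) φ m (reeb C (F.pullback u) m)) := by
  intro f v
  set g : C^∞⟮𝓘(ℝ, E'), M; 𝓘(ℝ, ℝ), ℝ⟯ := ⟨f ∘ φ, f.contMDiff.comp hφ.contMDiff⟩
  have h1 : F.pullback (fsmul f v) = fsmul g (F.pullback v) := by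
    ext m
    exact (F.equiv m).map_smul (f (φ m)) (v (φ m))
  have h2 := hasAnchor_reeb C (F.pullback u) m g (F.pullback v)
  rw [← h1, hφ.jacobi_map, hφ.jacobi_map] at h2
  have h3 : mvfderiv 𝓘(ℝ, E') g m (reeb C (F.pullback u) m) = mvfderiv 𝓘(ℝ, E) f (φ m)
      (mfderiv 𝓘(ℝ, E') 𝓘(ℝ, E) φ m (reeb C (F.pullback u) m)) := by
    have := mfderiv_comp (I := 𝓘(ℝ, E')) (I' := 𝓘(ℝ, E)) (I'' := 𝓘(ℝ, ℝ)) m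
      ((f.contMDiff (φ m)).mdifferentiableAt (by simp))
      ((hφ.contMDiff m).mdifferentiableAt (by simp))
    exact congrArg (fun T : E' →L[ℝ] ℝ => T (reeb C (F.pullback u) m)) this
  rw [h3] at h2
  apply (F.equiv m).injective
  rw [map_add, map_smul, map_smul]
  exact h2

/-- A chart of `M` adapted to `φ` and to the preferred chart and trivialisation at `i`. -/
structure IsAdaptedChart (F : BundleComponent E L E' L' φ) (i : P) (u₀ : Sections E L)
    (D : OpenPartialHomeomorph M (E × (Fin k → ℝ))) : Prop extends
    IsFramedChart D (F.pullback u₀) where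
  mem_jetBaseSet : ∀ m ∈ D.source, φ m ∈ jetBaseSet E L i
  coord_eq_one : ∀ m ∈ D.source, (trivializationAt ℝ L i ⟨φ m, u₀ (φ m)⟩).2 = 1
  fst_eq : ∀ m ∈ D.source, (D m).1 = chartAt E i (φ m)

/-- A submersion is in suitable charts a linear projection. -/
theorem exists_adapted_chart (hφ : ContMDiff 𝓘(ℝ, E') 𝓘(ℝ, E) ∞ φ)
    (hk : Module.finrank ℝ E' = Module.finrank ℝ E + k) {i : P} {m₀ : M}
    (hs : Function.Surjective (mfderiv 𝓘(ℝ, E') 𝓘(ℝ, E) φ m₀)) {N : Set P} (hN : IsOpen N)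
    (hmN : φ m₀ ∈ N) (hi : φ m₀ ∈ (chartAt E i).source) :
    ∃ D : OpenPartialHomeomorph M (E × (Fin k → ℝ)), m₀ ∈ D.source ∧
      IsSmoothChart (E := E') D ∧
      (∀ m ∈ D.source, φ m ∈ N ∩ (chartAt E i).source) ∧
      ∀ m ∈ D.source, (D m).1 = chartAt E i (φ m) := by
  have := FiniteDimensional.complete ℝ E'
  set c := chartAt E' m₀ with hc
  have hm₀ : m₀ ∈ c.source := mem_chart_source E' m₀
  have hcs := isSmoothChart_chartAt (E := E') m₀
  have his := isSmoothChart_chartAt (E := E) i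
  set N' : Set M := φ ⁻¹' (N ∩ (chartAt E i).source)
  have hN' : IsOpen N' := (hN.inter (chartAt E i).open_source).preimage hφ.continuous
  set S := c.target ∩ c.symm ⁻¹' N' with hS
  have hSo : IsOpen S := c.isOpen_inter_preimage_symm hN'
  set f : E' → E := fun y => chartAt E i (φ (c.symm y)) with hf
  have hfS : ContDiffOn ℝ ∞ f S := by
    intro y hy
    have h1 : ContMDiffAt 𝓘(ℝ, E') 𝓘(ℝ, E) ∞ (chartAt E i ∘ (φ ∘ c.symm)) y :=
      ContMDiffAt.comp y (his.contMDiffAt hy.2.2)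
        (ContMDiffAt.comp y (hφ _) (hcs.contMDiffAt_symm hy.1))
    exact (contMDiffAt_iff_contDiffAt.1 h1).contDiffWithinAt
  have hy₀ : c m₀ ∈ S := by
    refine ⟨c.map_source hm₀, ?_⟩
    rw [mem_preimage, c.left_inv hm₀]
    exact ⟨hmN, hi⟩
  obtain ⟨A, hA, hAs⟩ : ∃ A : E' →L[ℝ] E, HasFDerivAt f A (c m₀) ∧ Function.Surjective A := by
    have h1 := hcs.mdifferentiable.mdifferentiableAt_symm (c.map_source hm₀)
    have h2 := (hφ (c.symm (c m₀))).mdifferentiableAt (by simp)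
    have h3 : MDifferentiableAt 𝓘(ℝ, E) 𝓘(ℝ, E) (chartAt E i) (φ (c.symm (c m₀))) :=
      his.mdifferentiable.mdifferentiableAt (by rwa [c.left_inv hm₀])
    have h4 := h3.hasMFDerivAt.comp (c m₀) (h2.hasMFDerivAt.comp (c m₀) h1.hasMFDerivAt)
    refine ⟨_, h4.hasFDerivAt, ?_⟩
    have s1 := hcs.mdifferentiable.symm.mfderiv_surjective (c.map_source hm₀)
    have s2 : Function.Surjective (mfderiv 𝓘(ℝ, E') 𝓘(ℝ, E) φ (c.symm (c m₀))) := by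
      rwa [c.left_inv hm₀]
    have s3 : Function.Surjective
        (mfderiv 𝓘(ℝ, E) 𝓘(ℝ, E) (chartAt E i) (φ (c.symm (c m₀)))) :=
      his.mdifferentiable.mfderiv_surjective (by rwa [c.left_inv hm₀])
    exact s3.comp (s2.comp s1)
  -- T is a projection to the kernel of A followed by a linear isomorphism to ℝᵏ. The pair (A, T) is
  -- injective, and therefore bijective by the dimension hypothesis.
  obtain ⟨T, hT⟩ : ∃ T : E' →L[ℝ] (Fin k → ℝ), ∀ x, A x = 0 → T x = 0 → x = 0 := by
    obtain ⟨g, hg⟩ := LinearMap.exists_leftInverse_of_injective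
      (LinearMap.ker (A : E' →ₗ[ℝ] E)).subtype (Submodule.ker_subtype _)
    have hr : Module.finrank ℝ (LinearMap.ker (A : E' →ₗ[ℝ] E)) =
        Module.finrank ℝ (Fin k → ℝ) := by
      have h1 := LinearMap.finrank_range_add_finrank_ker (A : E' →ₗ[ℝ] E)
      rw [LinearMap.range_eq_top.2 hAs, finrank_top] at h1
      rw [Module.finrank_fin_fun]
      omega
    have l := LinearEquiv.ofFinrankEq _ _ hr
    refine ⟨LinearMap.toContinuousLinearMap (l.toLinearMap.comp g), fun x h1 h2 => ?_⟩
    have h3 : g x = ⟨x, h1⟩ := LinearMap.congr_fun hg ⟨x, h1⟩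
    have h4 : l (g x) = 0 := h2
    rw [h3, LinearEquiv.map_eq_zero_iff] at h4
    exact congrArg Subtype.val h4
  have hinj : Function.Injective (A.prod T : E' →ₗ[ℝ] E × (Fin k → ℝ)) := by
    refine (injective_iff_map_eq_zero _).2 fun x hx => ?_
    exact hT x (congrArg Prod.fst hx) (congrArg Prod.snd hx)
  have hfr : Module.finrank ℝ E' = Module.finrank ℝ (E × (Fin k → ℝ)) := by
    rw [Module.finrank_prod, Module.finrank_fin_fun, hk]
  set l := (LinearEquiv.ofInjectiveOfFinrankEq _ hinj hfr).toContinuousLinearEquiv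
  have hl : HasFDerivAt (fun y => (f y, T y)) (l : E' →L[ℝ] E × (Fin k → ℝ)) (c m₀) :=
    hA.prodMk T.hasFDerivAt
  obtain ⟨e, he1, he2, he3, he4⟩ := exists_openPartialHomeomorph_of_hasFDerivAt hSo
    (hfS.prodMk T.contDiff.contDiffOn) hy₀ hl
  have he5 : ContDiffOn ℝ ∞ e e.source := by
    rw [he3]
    exact (hfS.prodMk T.contDiff.contDiffOn).mono he2
  have hsrc : ∀ m ∈ (c.trans e).source, m ∈ c.source ∧ c m ∈ S := fun m hm => ⟨hm.1, he2 hm.2⟩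
  refine ⟨c.trans e, ⟨hm₀, he1⟩, hcs.trans he5 he4, fun m hm => ?_, fun m hm => ?_⟩
  · have h := (hsrc m hm).2.2
    rwa [mem_preimage, c.left_inv (hsrc m hm).1] at h
  · change (e (c m)).1 = _
    rw [he3]
    change chartAt E i (φ (c.symm (c m))) = _
    rw [c.left_inv (hsrc m hm).1]

theorem exists_isAdaptedChart (hφ : IsContactIsotropicRealisation J C φ F)
    (hk : Module.finrank ℝ E' = Module.finrank ℝ E + k) {i : P} {u₀ : Sections E L} {m₀ : M}
    (hi : φ m₀ ∈ jetBaseSet E L i)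
    (hu₀ : ∀ᶠ p in 𝓝 (φ m₀), (trivializationAt ℝ L i ⟨p, u₀ p⟩).2 = 1) :
    ∃ D : OpenPartialHomeomorph M (E × (Fin k → ℝ)), m₀ ∈ D.source ∧
      IsAdaptedChart F i u₀ D := by
  obtain ⟨N, hN1, hN2, hN3⟩ := eventually_nhds_iff.1 hu₀
  obtain ⟨D, hD1, hD2, hD3, hD4⟩ := exists_adapted_chart hφ.contMDiff hk (hφ.submersion m₀)
    (hN2.inter (isOpen_jetBaseSet E L i)) ⟨hN3, hi⟩ hi.1
  refine ⟨D, hD1, ⟨hD2, fun m hm => ?_⟩, fun m hm => (hD3 m hm).1.2,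
    fun m hm => hN1 _ (hD3 m hm).1.1, hD4⟩
  have h1 := hN1 _ (hD3 m hm).1.1
  have h2 : u₀ (φ m) ≠ 0 := by
    rw [← snd_trivialization_ne_zero _ (hD3 m hm).1.2.2, h1]
    exact one_ne_zero
  exact (F.equiv m).map_ne_zero_iff.2 h2

namespace IsAdaptedChart

variable {i : P} {u₀ : Sections E L} {D : OpenPartialHomeomorph M (E × (Fin k → ℝ))}
  (hD : IsAdaptedChart F i u₀ D)
include hD

/-- In the frame pulled back from the base, F∘φ^*u reads as a function of the base coordinates
alone. Hence its Reeb vectors solve the Reeb equations of a jet of the form `pullJet`. -/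
theorem coordSection_pullback (u : Sections E L) {x : E × (Fin k → ℝ)} (hx : x ∈ D.target) :
    coordSection (F.pullback u₀) (F.pullback u) D x = localSection i u x.1 := by
  have hm := D.map_target hx
  have h1 := hD.fst_eq _ hm
  rw [D.right_inv hx] at h1
  have hb := hD.mem_jetBaseSet _ hm
  rw [localSection, h1, (chartAt E i).left_inv hb.1]
  refine coef_eq_of_smul (hD.ne_zero _ hm) ?_
  have : (trivializationAt ℝ L i ⟨φ (D.symm x), u (φ (D.symm x))⟩).2 • u₀ (φ (D.symm x)) =
      u (φ (D.symm x)) := by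
    apply snd_trivialization_injective _ hb.2
    simp only [snd_trivialization_smul _ hb.2, hD.coord_eq_one _ hm, mul_one]
  exact ((F.equiv _).map_smul _ _).symm.trans (congrArg (F.equiv _) this)

theorem isReebVector_pullback (C : ContactForm E' L') (u : Sections E L) {m : M}
    (hm : m ∈ D.source) :
    IsReebVector (coordForm C (F.pullback u₀) D) (D m)
      (pullJet (jetCoord i ⟨φ m, jet E L (φ m) u⟩))
      (chartDeriv E' D m (reeb C (F.pullback u) m)) := by
  have h := hD.isReebVector_reeb C (F.pullback u) hm
  have hx := D.map_source hm
  have hb := hD.mem_jetBaseSet _ hm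
  have he : coordSection (F.pullback u₀) (F.pullback u) D =ᶠ[𝓝 (D m)]
      localSection i u ∘ Prod.fst := by
    filter_upwards [D.open_target.mem_nhds hx] with x hx
    exact hD.coordSection_pullback u hx
  have hd := differentiableAt_localSection hb u
  rw [← hD.fst_eq m hm] at hd
  rw [he.fderiv_eq, he.self_of_nhds, (hd.hasFDerivAt.comp (D m) hasFDerivAt_fst).fderiv] at h
  rw [jetCoord_jet hb, ← hD.fst_eq m hm]
  exact h

theorem fst_chartDeriv {m : M} (hφ : MDifferentiableAt 𝓘(ℝ, E') 𝓘(ℝ, E) φ m)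
    (hm : m ∈ D.source) (r : TangentSpace 𝓘(ℝ, E') m) :
    (chartDeriv E' D m r).1 = chartDeriv E (chartAt E i) (φ m)
      (mfderiv 𝓘(ℝ, E') 𝓘(ℝ, E) φ m r) := by
  have h1 := ((ContinuousLinearMap.fst ℝ E (Fin k → ℝ)).hasMFDerivAt (x := D m)).comp m
    ((hD.contMDiffAt hm).mdifferentiableAt (by simp)).hasMFDerivAt
  have h2 := (((isSmoothChart_chartAt (E := E) i).contMDiffAt
    (hD.mem_jetBaseSet m hm).1).mdifferentiableAt (by simp)).hasMFDerivAt.comp m hφ.hasMFDerivAt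
  have he : ⇑(ContinuousLinearMap.fst ℝ E (Fin k → ℝ)) ∘ D =ᶠ[𝓝 m] chartAt E i ∘ φ := by
    filter_upwards [D.open_source.mem_nhds hm] with m' h using hD.fst_eq m' h
  exact congrArg (fun T : E' →L[ℝ] E => T r)
    (hasMFDerivAt_unique h1 (h2.congr_of_eventuallyEq he))

theorem mfderiv_eq_zero_iff {m : M} (hφ : MDifferentiableAt 𝓘(ℝ, E') 𝓘(ℝ, E) φ m)
    (hm : m ∈ D.source) (r : TangentSpace 𝓘(ℝ, E') m) :
    mfderiv 𝓘(ℝ, E') 𝓘(ℝ, E) φ m r = 0 ↔ ∃ κ, chartDeriv E' D m r = (0, κ) := by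
  have h1 := hD.fst_chartDeriv hφ hm r
  constructor
  · intro h
    refine ⟨(chartDeriv E' D m r).2, Prod.ext ?_ rfl⟩
    rw [h1, h, map_zero]
  · rintro ⟨κ, h⟩
    rw [h] at h1
    apply (isSmoothChart_chartAt (E := E) i).mdifferentiable.mfderiv_injective
      (hD.mem_jetBaseSet m hm).1
    exact h1.symm.trans (map_zero _).symm

/-- Transversality becomes the existence of a vertical vector not in the kernel of θ: a tangent
vector with non-zero θ has a vertical component with the same value. For isotropy, uniqueness of the
anchor identifies the given vertical vector with a Reeb vector. -/
theorem isotropicOn (hφ : IsContactIsotropicRealisation J C φ F) :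
    IsotropicOn (coordForm C (F.pullback u₀) D) D.target := by
  have hφd (m : M) : MDifferentiableAt 𝓘(ℝ, E') 𝓘(ℝ, E) φ m :=
    (hφ.contMDiff m).mdifferentiableAt (by simp)
  refine ⟨D.open_target, hD.contDiffOn_coordForm C, fun x hx => hD.contactAt C hx,
    fun x hx => ?_, fun x hx κ => ?_⟩
  · have hm := D.map_target hx
    obtain ⟨r, hr⟩ := C.surjective (D.symm x) (F.pullback u₀ (D.symm x))
    obtain ⟨Y, Z, hY, hZ, hYZ⟩ := hφ.transversal _ r
    obtain ⟨κ, hκ⟩ := (hD.mfderiv_eq_zero_iff (hφd _) hm Z).1 hZ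
    refine ⟨κ, fun h => ?_⟩
    have h1 := hD.coordForm_chartDeriv C hm Z
    rw [D.right_inv hx, hκ, h] at h1
    have h2 := (hD.coef_eq_zero_iff hm).1 h1.symm
    rw [hYZ, map_add, hY, h2, zero_add] at hr
    exact hD.ne_zero _ hm hr.symm
  · have hm := D.map_target hx
    set r := (chartDeriv E' D (D.symm x)).inverse (0, κ)
    have hr : chartDeriv E' D (D.symm x) r = (0, κ) := hD.chartDeriv_inverse hm _
    obtain ⟨u, hu⟩ := hφ.isotropic _ r ((hD.mfderiv_eq_zero_iff (hφd _) hm r).2 ⟨κ, hr⟩)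
    have h1 := hD.isReebVector_pullback C u hm
    rw [(hasAnchor_reeb C _ _).unique hu, hr, D.right_inv hx] at h1
    exact ⟨_, h1⟩

theorem chartDeriv_reeb (hφ : IsContactIsotropicRealisation J C φ F) {m : M} (hm : m ∈ D.source)
    {u : Sections E L} {κ : Fin k → ℝ} (hu : jetCoord i ⟨φ m, jet E L (φ m) u⟩ =
      vertJet (coordForm C (F.pullback u₀) D) (D m) κ) :
    chartDeriv E' D m (reeb C (F.pullback u) m) = (0, κ) := by
  have h := ((hD.isotropicOn hφ).isReebVector_iff (D.map_source hm)).2 hu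
  exact (hD.isReebVector_pullback C u hm).unique (hD.contactAt C (D.map_source hm)) h

/-- In an adapted chart the kernel of the anchor is the image of `vertJet`, and the Reeb vector
fields of sections with 1-jet in it are vertical. -/
theorem mem_kerAnchor_iff (hφ : IsContactIsotropicRealisation J C φ F) {m : M} (hm : m ∈ D.source)
    {α : J1 E L} (hα : α.proj = φ m) : α ∈ kerAnchor J ↔
      ∃ κ, jetCoord i α = vertJet (coordForm C (F.pullback u₀) D) (D m) κ := by
  obtain ⟨p, a⟩ := α
  obtain rfl : p = φ m := hα
  have hφd : MDifferentiableAt 𝓘(ℝ, E') 𝓘(ℝ, E) φ m :=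
    (hφ.contMDiff m).mdifferentiableAt (by simp)
  constructor
  · rintro ⟨u, hu, hu'⟩
    change jet E L (φ m) u = a at hu
    subst hu
    have h1 := (hasAnchor_mfderiv_reeb hφ u m).unique hu'
    obtain ⟨κ, hκ⟩ := (hD.mfderiv_eq_zero_iff hφd hm _).1 h1
    have h2 := hD.isReebVector_pullback C u hm
    rw [hκ] at h2
    exact ⟨κ, ((hD.isotropicOn hφ).isReebVector_iff (D.map_source hm)).1 h2⟩
  · rintro ⟨κ, hκ⟩
    obtain ⟨u, rfl⟩ := exists_jet_eq (φ m) a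
    refine ⟨u, rfl, ?_⟩
    have h1 := (hD.mfderiv_eq_zero_iff hφd hm _).2 ⟨κ, hD.chartDeriv_reeb hφ hm hκ⟩
    have h2 := hasAnchor_mfderiv_reeb hφ u m
    rwa [h1] at h2

end IsAdaptedChart

/-- A linear map `Q` trivialising `ker ρ` over the open set `U` through `a ↦ Q a`, with inverse
`s`, such that `M` has over `U` charts in which the infinitesimal action is constant. -/
structure FlowModel (J : JacobiStructure E L) (C : ContactForm E' L') (F : BundleComponent E L E' L' φ)
    (k : ℕ) (i : P) where
  U : Set P
  isOpen : IsOpen U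
  mem : i ∈ U
  subset : U ⊆ jetBaseSet E L i
  Q : ℝ × (E →L[ℝ] ℝ) →L[ℝ] (Fin k → ℝ)
  s : P → (Fin k → ℝ) →L[ℝ] ℝ × (E →L[ℝ] ℝ)
  contMDiffOn_s : ContMDiffOn 𝓘(ℝ, E) 𝓘(ℝ, (Fin k → ℝ) →L[ℝ] ℝ × (E →L[ℝ] ℝ)) ∞ s U
  Q_s : ∀ p ∈ U, ∀ b, Q (s p b) = b
  mem_kerAnchor_iff : ∀ α : J1 E L, α.proj ∈ U →
    (α ∈ kerAnchor J ↔ s α.proj (Q (jetCoord i α)) = jetCoord i α)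
  exists_chart : ∀ m₀, φ m₀ ∈ U → ∃ Θ : OpenPartialHomeomorph M (E × (Fin k → ℝ)),
    m₀ ∈ Θ.source ∧ IsSmoothChart (E := E') Θ ∧ (∀ m ∈ Θ.source, φ m ∈ U) ∧
    (∀ m ∈ Θ.source, (Θ m).1 = chartAt E i (φ m)) ∧
    ∀ m ∈ Θ.source, ∀ u : Sections E L, (⟨φ m, jet E L (φ m) u⟩ : J1 E L) ∈ kerAnchor J →
      chartDeriv E' Θ m (reeb C (F.pullback u) m) = (0, Q (jetCoord i ⟨φ m, jet E L (φ m) u⟩))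

/-- Q is a left inverse of `vertJet` at a single point m over i. The image of `vertJet` is ker ρ,
which depends only on the base point. So Q is injective on `vertJet` not just near m but all along
the fibres over a neighbourhood U of i, and the same Q gives the normal form everywhere over U. -/
theorem exists_flowModel (hφ : IsContactIsotropicRealisation J C φ F)
    (hk : Module.finrank ℝ E' = Module.finrank ℝ E + k) (i : P) :
    Nonempty (FlowModel J C F k i) := by
  obtain ⟨u₀, hu₀⟩ := exists_section_coord (E := E) (L := L) (m₀ := i) (g := fun _ => 1)
    Filter.univ_mem contMDiffOn_const
  obtain ⟨N, hN1, hN2, hN3⟩ := eventually_nhds_iff.1 hu₀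
  obtain ⟨m, rfl⟩ := hφ.surjective i
  have hib : φ m ∈ jetBaseSet E L (φ m) := (jetCore E L).mem_baseSet_at (φ m)
  obtain ⟨D, hmD, hD⟩ := exists_isAdaptedChart (k := k) hφ hk hib hu₀
  have hI := hD.isotropicOn hφ
  set T := vertJet (coordForm C (F.pullback u₀) D)
  set i := φ m with hi
  obtain ⟨g, hg⟩ := LinearMap.exists_leftInverse_of_injective
    (T (D m) : (Fin k → ℝ) →ₗ[ℝ] ℝ × (E →L[ℝ] ℝ))
    (LinearMap.ker_eq_bot.2 (hI.vertJet_injective (D.map_source hmD)))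
  set Q : ℝ × (E →L[ℝ] ℝ) →L[ℝ] (Fin k → ℝ) := LinearMap.toContinuousLinearMap g
  have hQ : Q.comp (T (D m)) = ContinuousLinearMap.id ℝ _ :=
    ContinuousLinearMap.ext fun κ => LinearMap.congr_fun hg κ
  -- A slice of the chart through m. Evaluating `vertJet` along it describes ker ρ as a smooth
  -- family of images over the base.
  set c : P → E × (Fin k → ℝ) := fun p => (chartAt E i p, (D m).2)
  have hc : ContMDiffOn 𝓘(ℝ, E) 𝓘(ℝ, E × (Fin k → ℝ)) ∞ c (chartAt E i).source :=
    (contMDiffOn_chart (I := 𝓘(ℝ, E))).prodMk_space contMDiffOn_const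
  have hci : c i = D m := Prod.ext (hD.fst_eq m hmD).symm rfl
  set W := (jetBaseSet E L i ∩ N) ∩ c ⁻¹' D.target
  have hWs : W ⊆ (chartAt E i).source := fun p hp => hp.1.1.1
  have hW : IsOpen W := (hc.continuousOn.mono fun p hp => hp.1.1).isOpen_inter_preimage
    ((isOpen_jetBaseSet E L i).inter hN2) D.open_target
  have hT : ContMDiffOn 𝓘(ℝ, E) 𝓘(ℝ, (Fin k → ℝ) →L[ℝ] ℝ × (E →L[ℝ] ℝ)) ∞
      (fun p => T (c p)) W :=
    hI.contDiffOn_vertJet.contMDiffOn.comp (hc.mono hWs) fun p hp => hp.2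
  have hA : ContMDiffOn 𝓘(ℝ, E) 𝓘(ℝ, (Fin k → ℝ) →L[ℝ] (Fin k → ℝ)) ∞
      (fun p => Q.comp (T (c p))) W := contMDiffOn_const.clm_comp hT
  set U := W ∩ (fun p => Q.comp (T (c p))) ⁻¹'
    range ((↑) : ((Fin k → ℝ) ≃L[ℝ] (Fin k → ℝ)) → (Fin k → ℝ) →L[ℝ] (Fin k → ℝ))
  have hUi (p : P) (hp : p ∈ U) : (Q.comp (T (c p))).IsInvertible := hp.2
  have hU : IsOpen U := hA.continuousOn.isOpen_inter_preimage hW ContinuousLinearEquiv.isOpen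
  -- Renormalising by the inverse of Q ∘ T makes s a right inverse of Q with image ker ρ.
  set s : P → (Fin k → ℝ) →L[ℝ] ℝ × (E →L[ℝ] ℝ) :=
    fun p => (T (c p)).comp (Q.comp (T (c p))).inverse
  have hs : ContMDiffOn 𝓘(ℝ, E) 𝓘(ℝ, (Fin k → ℝ) →L[ℝ] ℝ × (E →L[ℝ] ℝ)) ∞ s U := by
    refine (hT.mono inter_subset_left).clm_comp fun p hp => ?_
    obtain ⟨l, hl⟩ := hUi p hp
    have h1 : ContDiffAt ℝ ∞ ContinuousLinearMap.inverse (Q.comp (T (c p))) := by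
      rw [← hl]
      exact contDiffAt_map_inverse l
    exact (contMDiffAt_iff_contDiffAt.2 h1).comp_contMDiffWithinAt p
      ((hA p hp.1).mono inter_subset_left)
  have hQs : ∀ p ∈ U, ∀ b, Q (s p b) = b := fun p hp b => (hUi p hp).self_apply_inverse b
  have hker : ∀ α : J1 E L, α.proj ∈ U →
      (α ∈ kerAnchor J ↔ s α.proj (Q (jetCoord i α)) = jetCoord i α) := by
    intro α hα
    have hx : c α.proj ∈ D.target := hα.1.2
    have hm := D.map_target hx
    have h1 : α.proj = φ (D.symm (c α.proj)) := by
      have h2 := hD.fst_eq _ hm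
      rw [D.right_inv hx] at h2
      exact (chartAt E i).injOn (hWs hα.1) (hD.mem_jetBaseSet _ hm).1 h2
    rw [hD.mem_kerAnchor_iff hφ hm h1, D.right_inv hx]
    constructor
    · rintro ⟨κ, hκ⟩
      rw [hκ]
      exact congrArg (T (c α.proj)) ((hUi _ hα).inverse_apply_self κ)
    · intro h
      exact ⟨_, h.symm⟩
  refine ⟨⟨U, hU, ⟨⟨⟨hib, hN3⟩, ?_⟩, ?_⟩, fun p hp => hp.1.1.1, Q, s, hs, hQs, hker, ?_⟩⟩
  · rw [mem_preimage, hci]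
    exact D.map_source hmD
  · rw [mem_preimage, hci, hQ]
    exact ⟨.refl ℝ _, rfl⟩
  intro m₀ hm₀
  obtain ⟨D', hmD', hD'⟩ := exists_isAdaptedChart (k := k) (u₀ := u₀) hφ hk hm₀.1.1.1
    (by filter_upwards [hN2.mem_nhds hm₀.1.1.2] with p hp using hN1 p hp)
  have hI' := hD'.isotropicOn hφ
  -- At another point of M over U: the jets `vertJet` κ lie in ker ρ, on which s ∘ Q is the
  -- identity, so Q κ-coordinates cannot vanish unless κ does.
  have hinj : Function.Injective
      (Q.comp (vertJet (coordForm C (F.pullback u₀) D') (D' m₀))) := by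
    refine (injective_iff_map_eq_zero _).2 fun κ hκ => ?_
    obtain ⟨b, hb⟩ := exists_jetCoord_eq hm₀.1.1.1
      (vertJet (coordForm C (F.pullback u₀) D') (D' m₀) κ)
    have h1 := (hker ⟨φ m₀, b⟩ hm₀).1 ((hD'.mem_kerAnchor_iff hφ hmD' rfl).2 ⟨κ, hb⟩)
    rw [hb] at h1
    have h2 : Q (vertJet (coordForm C (F.pullback u₀) D') (D' m₀) κ) = 0 := hκ
    rw [h2, map_zero] at h1
    exact hI'.vertJet_injective (D'.map_source hmD') (h1.symm.trans (map_zero _).symm)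
  obtain ⟨e, he1, he2, he3, he4, he5, he6⟩ := hI'.exists_chart (D'.map_source hmD') hinj
  have hφU : IsOpen (φ ⁻¹' U) := hU.preimage hφ.contMDiff.continuous
  have hsrc : ∀ m ∈ ((D'.trans e).restr (φ ⁻¹' U)).source,
      m ∈ (D'.trans e).source ∧ φ m ∈ U := by
    intro m hm
    rwa [OpenPartialHomeomorph.restr_source' _ _ hφU] at hm
  refine ⟨(D'.trans e).restr (φ ⁻¹' U), ?_, (hD'.toIsSmoothChart.trans he3 he4).restr _,
    fun m hm => (hsrc m hm).2, fun m hm => ?_, fun m hm u hu => ?_⟩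
  · rw [OpenPartialHomeomorph.restr_source' _ _ hφU]
    exact ⟨⟨hmD', he1⟩, hm₀⟩
  · exact (he5 _ (hsrc m hm).1.2).trans (hD'.fst_eq m (hsrc m hm).1.1)
  · have hm' := (hsrc m hm).1
    obtain ⟨κ, hκ⟩ := (hD'.mem_kerAnchor_iff hφ hm'.1 rfl).1 hu
    have h1 := hD'.toIsSmoothChart.chartDeriv_trans he3 hm' (reeb C (F.pullback u) m)
    rw [hD'.chartDeriv_reeb hφ hm'.1 hκ, he6 (D' m) hm'.2, ← hκ] at h1
    exact h1

end Realisation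

/-! ### Completeness from a uniform existence time -/

section UniformTime

variable {E : Type*} [NormedAddCommGroup E] [NormedSpace ℝ E]
  {M : Type*} [TopologicalSpace M] [ChartedSpace E M] [IsManifold 𝓘(ℝ, E) 1 M] [T2Space M]
  {v : ∀ m : M, TangentSpace 𝓘(ℝ, E) m}

/-- Two integral curves in `S` that meet fit together to an integral curve in `S`. -/
theorem exists_isMIntegralCurveOn_union {S : Set M}
    (hv : ContMDiff 𝓘(ℝ, E) 𝓘(ℝ, E).tangent 1 (fun m => (⟨m, v m⟩ : TangentBundle 𝓘(ℝ, E) M)))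
    {γ γ' : ℝ → M} {a b a' b' t₀ : ℝ} (hγ : IsMIntegralCurveOn γ v (Ioo a b))
    (hγS : ∀ t ∈ Ioo a b, γ t ∈ S) (hγ' : IsMIntegralCurveOn γ' v (Ioo a' b'))
    (hγS' : ∀ t ∈ Ioo a' b', γ' t ∈ S) (ht₀ : t₀ ∈ Ioo a b ∩ Ioo a' b') (h : γ t₀ = γ' t₀) :
    ∃ γ'' : ℝ → M, EqOn γ'' γ (Ioo a b) ∧ IsMIntegralCurveOn γ'' v (Ioo a b ∪ Ioo a' b') ∧
      ∀ t ∈ Ioo a b ∪ Ioo a' b', γ'' t ∈ S := by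
  classical
  have h2 := isMIntegralCurveOn_piecewise hv hγ hγ' ht₀ h
  refine ⟨piecewise (Ioo a b) γ γ', fun t ht => piecewise_eq_of_mem _ _ _ ht, ?_, ?_⟩
  · convert h2
  · intro t ht
    by_cases h : t ∈ Ioo a b
    · rw [piecewise_eq_of_mem _ _ _ h]
      exact hγS t h
    · rw [piecewise_eq_of_notMem _ _ _ h]
      exact hγS' t (ht.resolve_left h)

/-- If the integral curves starting in `S` exist in `S` for a uniform time, they exist in `S`
forever. -/
theorem exists_isMIntegralCurve_mem {S : Set M}
    (hv : ContMDiff 𝓘(ℝ, E) 𝓘(ℝ, E).tangent 1 (fun m => (⟨m, v m⟩ : TangentBundle 𝓘(ℝ, E) M)))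
    {ε : ℝ} (hε : 0 < ε) (h : ∀ m ∈ S, ∃ γ : ℝ → M, γ 0 = m ∧ IsMIntegralCurveOn γ v (Ioo (-ε) ε) ∧
      ∀ t ∈ Ioo (-ε) ε, γ t ∈ S) {m : M} (hm : m ∈ S) :
    ∃ γ : ℝ → M, γ 0 = m ∧ IsMIntegralCurve γ v ∧ ∀ t, γ t ∈ S := by
  have step (n : ℕ) : ∃ γ : ℝ → M, γ 0 = m ∧
      IsMIntegralCurveOn γ v (Ioo (-(ε + n * (ε / 2))) (ε + n * (ε / 2))) ∧
      ∀ t ∈ Ioo (-(ε + n * (ε / 2))) (ε + n * (ε / 2)), γ t ∈ S := by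
    induction n with
    | zero => simpa using h m hm
    | succ n ih =>
      obtain ⟨γ, h0, hγ, hγS⟩ := ih
      -- Restarting at ±(a - ε/2), strictly inside the interval, gains ε/2 at either end and leaves
      -- an overlap on which the curves can be joined.
      set a := ε + n * (ε / 2)
      have ha : ε ≤ a := le_add_of_nonneg_right (by positivity)
      obtain ⟨γ₁, h1, h1', h1S⟩ := h (γ (a - ε / 2)) (hγS _ ⟨by linarith, by linarith⟩)
      obtain ⟨γ₂, h2, h2', h2S⟩ := h (γ (-(a - ε / 2))) (hγS _ ⟨by linarith, by linarith⟩)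
      have e1 : IsMIntegralCurveOn (γ₁ ∘ (· - (a - ε / 2))) v
          (Ioo (a - ε / 2 - ε) (a - ε / 2 + ε)) :=
        (isMIntegralCurveOn_comp_sub.2 h1').mono fun t ht => ⟨by linarith [ht.1], by linarith [ht.2]⟩
      have e2 : IsMIntegralCurveOn (γ₂ ∘ (· + (a - ε / 2))) v
          (Ioo (-(a - ε / 2) - ε) (-(a - ε / 2) + ε)) :=
        (isMIntegralCurveOn_comp_add.2 h2').mono fun t ht => ⟨by linarith [ht.1], by linarith [ht.2]⟩
      obtain ⟨γ₃, e3, h3, h3S⟩ := exists_isMIntegralCurveOn_union hv hγ hγS e1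
        (fun t ht => h1S _ ⟨by linarith [ht.1], by linarith [ht.2]⟩) (t₀ := a - ε / 2)
        ⟨⟨by linarith, by linarith⟩, ⟨by linarith, by linarith⟩⟩ (by simp [h1])
      have hs : Ioo (-a) (a + ε / 2) ⊆ Ioo (-a) a ∪ Ioo (a - ε / 2 - ε) (a - ε / 2 + ε) := by
        intro t ht
        by_cases h : t < a
        · exact Or.inl ⟨ht.1, h⟩
        · exact Or.inr ⟨by linarith, by linarith [ht.2]⟩
      obtain ⟨γ₄, e4, h4, h4S⟩ := exists_isMIntegralCurveOn_union hv (h3.mono hs)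
        (fun t ht => h3S t (hs ht)) e2
        (fun t ht => h2S _ ⟨by linarith [ht.1], by linarith [ht.2]⟩) (t₀ := -(a - ε / 2))
        ⟨⟨by linarith, by linarith⟩, ⟨by linarith, by linarith⟩⟩
        (by rw [e3 ⟨by linarith, by linarith⟩]; simp [h2])
      have hs' : Ioo (-(a + ε / 2)) (a + ε / 2) ⊆
          Ioo (-a) (a + ε / 2) ∪ Ioo (-(a - ε / 2) - ε) (-(a - ε / 2) + ε) := by
        intro t ht
        by_cases h : -a < t
        · exact Or.inl ⟨h, ht.2⟩
        · exact Or.inr ⟨by linarith [ht.1], by linarith⟩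
      have ea : ε + ((n + 1 : ℕ) : ℝ) * (ε / 2) = a + ε / 2 := by
        simp only [a]; push_cast; ring
      rw [ea]
      refine ⟨γ₄, ?_, h4.mono hs', fun t ht => h4S t (hs' ht)⟩
      rw [e4 ⟨by linarith, by linarith⟩, e3 ⟨by linarith, by linarith⟩, h0]
  have step' (a : ℝ) : ∃ γ : ℝ → M, γ 0 = m ∧ IsMIntegralCurveOn γ v (Ioo (-a) a) ∧
      ∀ t ∈ Ioo (-a) a, γ t ∈ S := by
    obtain ⟨n, hn⟩ := exists_nat_gt (a / (ε / 2))
    rw [div_lt_iff₀ (by positivity)] at hn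
    obtain ⟨γ, h0, h1, h2⟩ := step n
    have hs : Ioo (-a) a ⊆ Ioo (-(ε + n * (ε / 2))) (ε + n * (ε / 2)) :=
      Ioo_subset_Ioo (by linarith) (by linarith)
    exact ⟨γ, h0, h1.mono hs, fun t ht => h2 t (hs ht)⟩
  choose γ h0 h1 h2 using step'
  refine ⟨fun t => γ (|t| + 1) t, h0 _,
    isMIntegralCurve_abs_add_one_of_isMIntegralCurveOn_Ioo hv γ h0 fun a _ => h1 a, fun t => ?_⟩
  exact h2 _ _ (abs_lt.1 (lt_add_one _))

end UniformTime

/-! ### The action of ker ρ on the fibres -/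

section Flow

variable {E : Type*} [NormedAddCommGroup E] [NormedSpace ℝ E] [FiniteDimensional ℝ E]
  {P : Type*} [TopologicalSpace P] [ChartedSpace E P] [IsManifold 𝓘(ℝ, E) ∞ P] [T2Space P]
  {L : P → Type*} [TopologicalSpace (TotalSpace ℝ L)] [∀ p, TopologicalSpace (L p)]
  [∀ p, AddCommGroup (L p)] [∀ p, Module ℝ (L p)] [FiberBundle ℝ L] [VectorBundle ℝ ℝ L]
  [ContMDiffVectorBundle ∞ ℝ L 𝓘(ℝ, E)]
  {E' : Type*} [NormedAddCommGroup E'] [NormedSpace ℝ E'] [FiniteDimensional ℝ E']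
  {M : Type*} [TopologicalSpace M] [ChartedSpace E' M] [IsManifold 𝓘(ℝ, E') ∞ M] [T2Space M]
  {L' : M → Type*} [TopologicalSpace (TotalSpace ℝ L')] [∀ m, TopologicalSpace (L' m)]
  [∀ m, AddCommGroup (L' m)] [∀ m, Module ℝ (L' m)] [FiberBundle ℝ L'] [VectorBundle ℝ ℝ L']
  [∀ m, IsTopologicalAddGroup (L' m)] [∀ m, ContinuousSMul ℝ (L' m)]
  [ContMDiffVectorBundle ∞ ℝ L' 𝓘(ℝ, E')]
  {k : ℕ} {J : JacobiStructure E L} {C : ContactForm E' L'} {φ : M → P}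
  {F : BundleComponent E L E' L' φ} {i : P}

namespace FlowModel

variable (W : FlowModel J C F k i)

/-- The coordinate of an element of `ker ρ`. -/
def coord (α : J1 E L) : Fin k → ℝ := W.Q (jetCoord i α)

/-- The element of `ker ρ` with given coordinate. -/
def elem (p : P) (b : Fin k → ℝ) : J1 E L := ⟨p, ((jetCore E L).localTriv i).symm p (W.s p b)⟩

theorem jetCoord_elem {p : P} (hp : p ∈ W.U) (b : Fin k → ℝ) :
    jetCoord i (W.elem p b) = W.s p b :=
  congrArg Prod.snd (((jetCore E L).localTriv i).apply_mk_symm (W.subset hp) (W.s p b))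

theorem coord_elem {p : P} (hp : p ∈ W.U) (b : Fin k → ℝ) : W.coord (W.elem p b) = b := by
  rw [coord, W.jetCoord_elem hp, W.Q_s p hp]

theorem elem_mem {p : P} (hp : p ∈ W.U) (b : Fin k → ℝ) : W.elem p b ∈ kerAnchor J := by
  refine (W.mem_kerAnchor_iff (W.elem p b) hp).2 ?_
  rw [W.jetCoord_elem hp, W.Q_s p hp]
  rfl

theorem jetCoord_injective {p : P} (hp : p ∈ W.U) {a b : (jetCore E L).Fiber p}
    (h : jetCoord i (⟨p, a⟩ : J1 E L) = jetCoord i (⟨p, b⟩ : J1 E L)) : a = b := by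
  have h1 := ((jetCore E L).localTriv i).symm_apply_apply_mk (W.subset hp) a
  have h2 := ((jetCore E L).localTriv i).symm_apply_apply_mk (W.subset hp) b
  rw [← h1, ← h2]
  exact congrArg (((jetCore E L).localTriv i).symm p) h

theorem elem_coord {α : J1 E L} (hα : α ∈ kerAnchor J) (hp : α.proj ∈ W.U) :
    W.elem α.proj (W.coord α) = α := by
  obtain ⟨p, a⟩ := α
  have h1 := W.jetCoord_elem hp (W.coord ⟨p, a⟩)
  rw [coord, (W.mem_kerAnchor_iff _ hp).1 hα] at h1
  exact congrArg (TotalSpace.mk p) (W.jetCoord_injective hp h1)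

/-- A chart of `M` in which the infinitesimal action of `ker ρ` is constant. -/
structure IsFlowChart (Θ : OpenPartialHomeomorph M (E × (Fin k → ℝ))) : Prop extends
    IsSmoothChart (E := E') Θ where
  mem_U : ∀ m ∈ Θ.source, φ m ∈ W.U
  fst_eq : ∀ m ∈ Θ.source, (Θ m).1 = chartAt E i (φ m)
  chartDeriv_eq : ∀ m ∈ Θ.source, ∀ u : Sections E L,
    (⟨φ m, jet E L (φ m) u⟩ : J1 E L) ∈ kerAnchor J →
      chartDeriv E' Θ m (reeb C (F.pullback u) m) = (0, W.coord ⟨φ m, jet E L (φ m) u⟩)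

theorem exists_isFlowChart {m : M} (hm : φ m ∈ W.U) :
    ∃ Θ : OpenPartialHomeomorph M (E × (Fin k → ℝ)), m ∈ Θ.source ∧ W.IsFlowChart Θ := by
  obtain ⟨Θ, h1, h2, h3, h4, h5⟩ := W.exists_chart m hm
  exact ⟨Θ, h1, ⟨h2, h3, h4, h5⟩⟩

/-- The section `u` represents the element of `ker ρ` over `p` with coordinate `b`. -/
def IsRep (p : P) (b : Fin k → ℝ) (u : Sections E L) : Prop :=
  (⟨p, jet E L p u⟩ : J1 E L) = W.elem p b

theorem exists_isRep (p : P) (b : Fin k → ℝ) : ∃ u : Sections E L, W.IsRep p b u := by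
  obtain ⟨u, hu⟩ := exists_jet_eq p (W.elem p b).2
  exact ⟨u, congrArg (TotalSpace.mk p) hu⟩

variable {W}

theorem IsFlowChart.chartDeriv_reeb {Θ : OpenPartialHomeomorph M (E × (Fin k → ℝ))}
    (hΘ : W.IsFlowChart Θ) {m : M} (hm : m ∈ Θ.source) {b : Fin k → ℝ} {u : Sections E L}
    (hu : W.IsRep (φ m) b u) : chartDeriv E' Θ m (reeb C (F.pullback u) m) = (0, b) := by
  have hp := hΘ.mem_U m hm
  have h := hΘ.chartDeriv_eq m hm u (by rw [hu]; exact W.elem_mem hp b)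
  rw [h, hu, W.coord_elem hp]

/-- In a flow chart the Reeb vector is (0, b), linear in the coordinate of the jet. The case c = 1
says that on the fibre the field depends only on the jet and not on the representing section. -/
theorem reeb_eq_smul {m : M} (hm : φ m ∈ W.U) {b : Fin k → ℝ} {c : ℝ} {u u' : Sections E L}
    (hu : W.IsRep (φ m) b u) (hu' : W.IsRep (φ m) (c • b) u') :
    reeb C (F.pullback u') m = c • reeb C (F.pullback u) m := by
  obtain ⟨Θ, hmΘ, hΘ⟩ := W.exists_isFlowChart hm
  apply hΘ.mdifferentiable.mfderiv_injective hmΘ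
  refine (hΘ.chartDeriv_reeb hmΘ hu').trans ?_
  refine Eq.trans ?_ ((chartDeriv E' Θ m).map_smul c (reeb C (F.pullback u) m)).symm
  rw [hΘ.chartDeriv_reeb hmΘ hu, Prod.smul_mk, smul_zero]

theorem IsFlowChart.fst_symm {Θ : OpenPartialHomeomorph M (E × (Fin k → ℝ))}
    (hΘ : W.IsFlowChart Θ) {m : M} (hm : m ∈ Θ.source) {x : E × (Fin k → ℝ)} (hx : x ∈ Θ.target)
    (h : x.1 = (Θ m).1) : φ (Θ.symm x) = φ m := by
  have hx' := Θ.map_target hx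
  have h1 := hΘ.fst_eq _ hx'
  rw [Θ.right_inv hx, h, hΘ.fst_eq m hm] at h1
  exact ((chartAt E i).injOn (W.subset (hΘ.mem_U _ hm)).1 (W.subset (hΘ.mem_U _ hx')).1 h1).symm

/-- The straight line stays in the fibre over φ m, so u represents the same element of ker ρ along
it and the field reads as the constant (0, b). -/
theorem IsFlowChart.isMIntegralCurveOn {Θ : OpenPartialHomeomorph M (E × (Fin k → ℝ))}
    (hΘ : W.IsFlowChart Θ) {m : M} (hm : m ∈ Θ.source) {b : Fin k → ℝ} {u : Sections E L}
    (hu : W.IsRep (φ m) b u) {I : Set ℝ}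
    (hI : ∀ t ∈ I, Θ m + t • ((0, b) : E × (Fin k → ℝ)) ∈ Θ.target) :
    IsMIntegralCurveOn (fun t => Θ.symm (Θ m + t • ((0, b) : E × (Fin k → ℝ))))
      (reeb C (F.pullback u)) I := by
  intro t ht
  have hx := hI t ht
  have hm' := Θ.map_target hx
  have hφm : φ (Θ.symm (Θ m + t • ((0, b) : E × (Fin k → ℝ)))) = φ m :=
    hΘ.fst_symm hm hx (by simp)
  have h1 : HasFDerivAt (fun t : ℝ => Θ m + t • ((0, b) : E × (Fin k → ℝ)))
      ((1 : ℝ →L[ℝ] ℝ).smulRight ((0, b) : E × (Fin k → ℝ))) t :=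
    ((ContinuousLinearMap.id ℝ ℝ).smulRight ((0, b) : E × (Fin k → ℝ))).hasFDerivAt.const_add _
  have h2 := ((hΘ.contMDiffAt_symm hx).mdifferentiableAt (by simp)).hasMFDerivAt.comp t
    h1.hasMFDerivAt
  refine HasMFDerivAt.hasMFDerivWithinAt ?_
  have h3 := hΘ.chartDeriv_reeb hm' (hφm ▸ hu)
  have h4 := hΘ.mdifferentiable.symm_comp_deriv hm'
  rw [Θ.right_inv hx] at h4
  have h5 := congrArg (fun T : E' →L[ℝ] E' =>
    T (reeb C (F.pullback u) (Θ.symm (Θ m + t • ((0, b) : E × (Fin k → ℝ)))))) h4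
  set T : E × (Fin k → ℝ) →L[ℝ] E' := mfderiv 𝓘(ℝ, E × (Fin k → ℝ)) 𝓘(ℝ, E') Θ.symm
    (Θ m + t • ((0, b) : E × (Fin k → ℝ))) with hT
  have h6 : T (0, b) = reeb C (F.pullback u) (Θ.symm (Θ m + t • ((0, b) : E × (Fin k → ℝ)))) := by
    exact (congrArg T h3).symm.trans h5
  have h7 : (1 : ℝ →L[ℝ] ℝ).smulRight (show E' from reeb C (F.pullback u)
      (Θ.symm (Θ m + t • ((0, b) : E × (Fin k → ℝ))))) =
      T.comp ((1 : ℝ →L[ℝ] ℝ).smulRight ((0, b) : E × (Fin k → ℝ))) :=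
    ContinuousLinearMap.ext fun c : ℝ =>
      (congrArg (c • ·) h6).symm.trans (T.map_smul c (0, b)).symm
  exact h7 ▸ h2

/-- Charts around the points of a compact fibre have a Lebesgue number. -/
theorem exists_uniform_isFlowChart (hφ : IsContactIsotropicRealisation J C φ F) {p : P}
    (hp : p ∈ W.U) : ∃ ε > 0, ∀ m, φ m = p → ∃ Θ : OpenPartialHomeomorph M (E × (Fin k → ℝ)),
      m ∈ Θ.source ∧ W.IsFlowChart Θ ∧ Metric.ball (Θ m) ε ⊆ Θ.target := by
  suffices h : ∃ ε > 0, ∀ m ∈ φ ⁻¹' {p}, ∃ Θ : OpenPartialHomeomorph M (E × (Fin k → ℝ)),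
      m ∈ Θ.source ∧ W.IsFlowChart Θ ∧ Metric.ball (Θ m) ε ⊆ Θ.target from h
  refine (hφ.isCompact_fibre p).induction_on (p := fun S => ∃ ε > 0, ∀ m ∈ S,
    ∃ Θ : OpenPartialHomeomorph M (E × (Fin k → ℝ)),
      m ∈ Θ.source ∧ W.IsFlowChart Θ ∧ Metric.ball (Θ m) ε ⊆ Θ.target) ?_ ?_ ?_ ?_
  · exact ⟨1, one_pos, fun m hm => hm.elim⟩
  · rintro S T hST ⟨ε, hε, h⟩
    exact ⟨ε, hε, fun m hm => h m (hST hm)⟩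
  · rintro S T ⟨ε, hε, h⟩ ⟨ε', hε', h'⟩
    refine ⟨min ε ε', lt_min hε hε', ?_⟩
    rintro m (hm | hm)
    · obtain ⟨Θ, h1, h2, h3⟩ := h m hm
      exact ⟨Θ, h1, h2, (Metric.ball_subset_ball (min_le_left _ _)).trans h3⟩
    · obtain ⟨Θ, h1, h2, h3⟩ := h' m hm
      exact ⟨Θ, h1, h2, (Metric.ball_subset_ball (min_le_right _ _)).trans h3⟩
  · rintro m (rfl : φ m = p)
    obtain ⟨Θ, h1, h2⟩ := W.exists_isFlowChart hp
    obtain ⟨r, hr, hr'⟩ := Metric.isOpen_iff.1 Θ.open_target _ (Θ.map_source h1)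
    -- Half the radius is spent on moving the centre, the other half remains as room around it.
    refine ⟨Θ.source ∩ Θ ⁻¹' Metric.ball (Θ m) (r / 2), mem_nhdsWithin_of_mem_nhds
      ((Θ.isOpen_inter_preimage Metric.isOpen_ball).mem_nhds
        ⟨h1, Metric.mem_ball_self (half_pos hr)⟩), r / 2, half_pos hr, fun m' hm' => ?_⟩
    refine ⟨Θ, hm'.1, h2, fun x hx => hr' ?_⟩
    have h3 := dist_triangle x (Θ m') (Θ m)
    have h4 : dist (Θ m') (Θ m) < r / 2 := hm'.2
    rw [Metric.mem_ball] at hx ⊢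
    linarith

theorem contMDiff_reeb (C : ContactForm E' L') (v : Sections E' L') :
    ContMDiff 𝓘(ℝ, E') 𝓘(ℝ, E').tangent 1
      (fun m => (⟨m, reeb C v m⟩ : TangentBundle 𝓘(ℝ, E') M)) :=
  (reeb C v).contMDiff.of_le (by exact_mod_cast le_top)

theorem add_smul_mem_ball {x : E × (Fin k → ℝ)} {b : Fin k → ℝ} {t r : ℝ} (h : |t| * ‖b‖ < r) :
    x + t • ((0, b) : E × (Fin k → ℝ)) ∈ Metric.ball x r := by
  rw [mem_ball_iff_norm, add_sub_cancel_left, norm_smul, Real.norm_eq_abs]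
  simpa using h

/-- All points of the compact fibre have flow charts of size ε, in which the line with velocity b
survives for the time ε / (‖b‖ + 1); the summand 1 allows b = 0. A uniform time suffices for
completeness. -/
theorem exists_flowLine (hφ : IsContactIsotropicRealisation J C φ F) {m : M} (hm : φ m ∈ W.U)
    {b : Fin k → ℝ} {u : Sections E L} (hu : W.IsRep (φ m) b u) :
    ∃ γ : ℝ → M, γ 0 = m ∧ IsMIntegralCurve γ (reeb C (F.pullback u)) ∧ ∀ t, φ (γ t) = φ m := by
  have : IsManifold 𝓘(ℝ, E') 1 M := IsManifold.of_le (n := ∞) (by exact_mod_cast le_top)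
  obtain ⟨ε, hε, h⟩ := exists_uniform_isFlowChart (W := W) hφ hm
  have hb : 0 < ‖b‖ + 1 := by positivity
  refine exists_isMIntegralCurve_mem (S := φ ⁻¹' {φ m}) (contMDiff_reeb C _)
    (div_pos hε hb) ?_ rfl
  intro m' hm'
  obtain ⟨Θ, h1, h2, h3⟩ := h m' hm'
  have hI : ∀ t ∈ Ioo (-(ε / (‖b‖ + 1))) (ε / (‖b‖ + 1)),
      Θ m' + t • ((0, b) : E × (Fin k → ℝ)) ∈ Θ.target := by
    intro t ht
    refine h3 (add_smul_mem_ball ?_)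
    have h4 := abs_lt.2 ht
    rw [lt_div_iff₀ hb] at h4
    nlinarith [abs_nonneg t]
  have hm'' : φ m' = φ m := hm'
  refine ⟨_, ?_, h2.isMIntegralCurveOn h1 (hm'' ▸ hu) hI, fun t ht => ?_⟩
  · simp [Θ.left_inv h1]
  · exact (h2.fst_symm h1 (hI t ht) (by simp)).trans hm'

variable (W) in
open Classical in
/-- The time-one flow of the element of `ker ρ` with coordinate `b`. -/
def flow (b : Fin k → ℝ) (m : M) : M :=
  -- Over `W.U` flow lines always exist, so the default m is never used there.
  if h : ∃ m', FlowsTo C F (W.elem (φ m) b) m m' then h.choose else m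

/-- Independence of the choices in `flow`. Two sections with the same jet have Reeb fields that
agree on the fibre, and there is an integral curve staying in the fibre; uniqueness of integral
curves identifies any other curve with it. -/
theorem flow_eq (hφ : IsContactIsotropicRealisation J C φ F) {m : M} (hm : φ m ∈ W.U)
    {b : Fin k → ℝ} {u : Sections E L} (hu : W.IsRep (φ m) b u) {γ : ℝ → M} (h0 : γ 0 = m)
    (hγ : IsMIntegralCurve γ (reeb C (F.pullback u))) : W.flow b m = γ 1 := by
  have : IsManifold 𝓘(ℝ, E') 1 M := IsManifold.of_le (n := ∞) (by exact_mod_cast le_top)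
  have h : ∃ m', FlowsTo C F (W.elem (φ m) b) m m' := by
    refine ⟨γ 1, rfl, u, γ, ?_, hγ, h0, rfl⟩
    exact eq_of_heq (TotalSpace.mk.inj hu).2
  rw [flow, dif_pos h]
  obtain ⟨-, u', γ', hu', hγ', h0', h1'⟩ := h.choose_spec
  rw [← h1']
  obtain ⟨c, hc0, hc, hcφ⟩ := exists_flowLine hφ hm hu
  have hu'' : W.IsRep (φ m) b u' := congrArg (TotalSpace.mk (φ m)) hu'
  have e1 : γ = c := isMIntegralCurve_Ioo_eq_of_contMDiff_boundaryless (t₀ := 0)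
    (contMDiff_reeb C _) hγ hc (h0.trans hc0.symm)
  have hc' : IsMIntegralCurve c (reeb C (F.pullback u')) := by
    intro t
    have h2 := reeb_eq_smul (W := W) (m := c t) (b := b) (c := 1) (u := u) (u' := u')
      ((hcφ t).symm ▸ hm) ((hcφ t).symm ▸ hu) (by rw [one_smul, hcφ t]; exact hu'')
    rw [h2, one_smul]
    exact hc t
  have e2 : γ' = c := isMIntegralCurve_Ioo_eq_of_contMDiff_boundaryless (t₀ := 0)
    (contMDiff_reeb C _) hγ' hc' (h0'.trans hc0.symm)
  rw [e1, e2]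

theorem flowsTo_iff (hφ : IsContactIsotropicRealisation J C φ F) {m m' : M} (hm : φ m ∈ W.U)
    {b : Fin k → ℝ} : FlowsTo C F (W.elem (φ m) b) m m' ↔ m' = W.flow b m := by
  constructor
  · rintro ⟨-, u, γ, hu, hγ, h0, rfl⟩
    exact (flow_eq hφ hm (congrArg (TotalSpace.mk (φ m)) hu) h0 hγ).symm
  · rintro rfl
    obtain ⟨u, hu⟩ := W.exists_isRep (φ m) b
    obtain ⟨γ, h0, hγ, -⟩ := exists_flowLine hφ hm hu
    exact ⟨rfl, u, γ, eq_of_heq (TotalSpace.mk.inj hu).2, hγ, h0, (flow_eq hφ hm hu h0 hγ).symm⟩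

theorem map_flow (hφ : IsContactIsotropicRealisation J C φ F) {m : M} (hm : φ m ∈ W.U)
    (b : Fin k → ℝ) : φ (W.flow b m) = φ m := by
  obtain ⟨u, hu⟩ := W.exists_isRep (φ m) b
  obtain ⟨γ, h0, hγ, h⟩ := exists_flowLine hφ hm hu
  rw [flow_eq hφ hm hu h0 hγ, h]

/-- Short flows are translations in a flow chart. -/
theorem IsFlowChart.flow_eq (hφ : IsContactIsotropicRealisation J C φ F)
    {Θ : OpenPartialHomeomorph M (E × (Fin k → ℝ))} (hΘ : W.IsFlowChart Θ) {m : M}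
    (hm : m ∈ Θ.source) {b : Fin k → ℝ} {r : ℝ} (hr : Metric.ball (Θ m) r ⊆ Θ.target)
    (hb : ‖b‖ < r) : W.flow b m = Θ.symm (Θ m + (0, b)) := by
  have : IsManifold 𝓘(ℝ, E') 1 M := IsManifold.of_le (n := ∞) (by exact_mod_cast le_top)
  obtain ⟨u, hu⟩ := W.exists_isRep (φ m) b
  obtain ⟨γ, h0, hγ, -⟩ := exists_flowLine hφ (hΘ.mem_U m hm) hu
  rw [FlowModel.flow_eq hφ (hΘ.mem_U m hm) hu h0 hγ]
  -- Curves are compared on an open interval, which has to reach beyond the time 1.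
  obtain ⟨T, hT1, hT⟩ : ∃ T > 1, T * ‖b‖ < r := by
    have hb' : 0 < ‖b‖ + 1 := by positivity
    refine ⟨1 + (r - ‖b‖) / (‖b‖ + 1), lt_add_of_pos_right _ (div_pos (sub_pos.2 hb) hb'), ?_⟩
    have h1 : (r - ‖b‖) / (‖b‖ + 1) * (‖b‖ + 1) = r - ‖b‖ := div_mul_cancel₀ _ hb'.ne'
    have h2 : 0 < (r - ‖b‖) / (‖b‖ + 1) := div_pos (sub_pos.2 hb) hb'
    nlinarith
  have hI : ∀ t ∈ Ioo (-T) T, Θ m + t • ((0, b) : E × (Fin k → ℝ)) ∈ Θ.target := by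
    intro t ht
    refine hr (add_smul_mem_ball (lt_of_le_of_lt ?_ hT))
    exact mul_le_mul_of_nonneg_right (abs_lt.2 ht).le (norm_nonneg b)
  have h2 := isMIntegralCurveOn_Ioo_eqOn_of_contMDiff_boundaryless (t₀ := 0)
    ⟨by linarith, by linarith⟩ (contMDiff_reeb C (F.pullback u)) (hγ.isMIntegralCurveOn (Ioo (-T) T))
    (hΘ.isMIntegralCurveOn hm hu hI) (by simp [h0, Θ.left_inv hm])
  have h3 := h2 (x := 1) ⟨by linarith, hT1⟩
  simpa using h3

/-- Rescaling time turns the flow of c • b at time one into that of b at time c, so multiples of b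
stay on one flow line. -/
theorem flow_succ_smul (hφ : IsContactIsotropicRealisation J C φ F) {m : M} (hm : φ m ∈ W.U)
    (b : Fin k → ℝ) (n : ℕ) :
    W.flow (((n + 1 : ℕ) : ℝ) • b) m = W.flow b (W.flow ((n : ℝ) • b) m) := by
  obtain ⟨u, hu⟩ := W.exists_isRep (φ m) b
  obtain ⟨γ, h0, hγ, h⟩ := exists_flowLine hφ hm hu
  have key (c : ℝ) : W.flow (c • b) m = γ c := by
    obtain ⟨u', hu'⟩ := W.exists_isRep (φ m) (c • b)
    have h1 : IsMIntegralCurve (γ ∘ (· * c)) (reeb C (F.pullback u')) := by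
      intro t
      have h2 := hγ.comp_mul c t
      have h3 := reeb_eq_smul (W := W) (m := γ (t * c)) (b := b) (c := c) (u := u) (u' := u')
        ((h _).symm ▸ hm) ((h _).symm ▸ hu) ((h _).symm ▸ hu')
      rw [Function.comp_apply, h3]
      exact h2
    have h2 := flow_eq hφ hm hu' (by simp [h0]) h1
    simpa using h2
  have h1 : W.flow b (γ n) = γ (n + 1) := by
    have h2 := flow_eq hφ (m := γ n) ((h _).symm ▸ hm) ((h _).symm ▸ hu) (by simp)
      (hγ.comp_add n)
    simpa [add_comm] using h2
  rw [key, key, h1, Nat.cast_succ]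

theorem flow_zero (hφ : IsContactIsotropicRealisation J C φ F) {m : M} (hm : φ m ∈ W.U) :
    W.flow 0 m = m := by
  obtain ⟨Θ, h1, h2⟩ := W.exists_isFlowChart hm
  obtain ⟨r, hr, hr'⟩ := Metric.isOpen_iff.1 Θ.open_target _ (Θ.map_source h1)
  rw [h2.flow_eq hφ h1 hr' (by simpa using hr)]
  rw [Prod.mk_zero_zero, add_zero, Θ.left_inv h1]

/-- Two short flows are translations in the same chart, which gives additivity for small arguments.
In general b = n c and b' = n c' with c, c' small; the short flows commute, and induction reorders
them. -/
theorem flow_add (hφ : IsContactIsotropicRealisation J C φ F) {m : M} (hm : φ m ∈ W.U)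
    (b b' : Fin k → ℝ) : W.flow (b + b') m = W.flow b (W.flow b' m) := by
  obtain ⟨ε, hε, hΘ⟩ := exists_uniform_isFlowChart (W := W) hφ hm
  have small (b b' : Fin k → ℝ) (hb : ‖b‖ < ε / 2) (hb' : ‖b'‖ < ε / 2) (m' : M)
      (hm' : φ m' = φ m) : W.flow (b + b') m' = W.flow b (W.flow b' m') := by
    obtain ⟨Θ, h1, h2, h3⟩ := hΘ m' hm'
    have e0 : Θ m' + (0, b') ∈ Metric.ball (Θ m') (ε / 2) := by
      rw [mem_ball_iff_norm, add_sub_cancel_left]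
      simpa [hε] using hb'
    have h4 : Metric.ball (Θ m' + (0, b')) (ε / 2) ⊆ Θ.target := by
      refine subset_trans (fun x hx => ?_) h3
      rw [Metric.mem_ball] at hx e0 ⊢
      linarith [dist_triangle x (Θ m' + (0, b')) (Θ m')]
    have e1 := h2.flow_eq hφ h1 h3 (hb'.trans (half_lt_self hε))
    have e2 : Θ m' + (0, b') ∈ Θ.target := h4 (Metric.mem_ball_self (half_pos hε))
    have e3 : Θ (W.flow b' m') = Θ m' + (0, b') := by rw [e1, Θ.right_inv e2]
    have e4 : W.flow b' m' ∈ Θ.source := by rw [e1]; exact Θ.map_target e2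
    have e5 : Θ m' + (0, b + b') = Θ m' + (0, b') + (0, b) := by
      refine Prod.ext (by simp) ?_
      simp only [Prod.snd_add]
      abel
    rw [h2.flow_eq hφ e4 (e3.symm ▸ h4) hb, e3, h2.flow_eq hφ h1 h3
      ((norm_add_le _ _).trans_lt (by linarith)), e5]
  obtain ⟨n, hn⟩ := exists_nat_gt (max ‖b‖ ‖b'‖ / (ε / 2))
  rw [div_lt_iff₀ (half_pos hε)] at hn
  have hn0 : 0 < (n : ℝ) := by
    by_contra h
    have : (n : ℝ) * (ε / 2) ≤ 0 := mul_nonpos_of_nonpos_of_nonneg (not_lt.1 h) (by positivity)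
    linarith [(norm_nonneg b).trans (le_max_left ‖b‖ ‖b'‖)]
  have hc (b : Fin k → ℝ) (hb : ‖b‖ < n * (ε / 2)) : ‖(n : ℝ)⁻¹ • b‖ < ε / 2 := by
    rw [norm_smul, norm_inv, Real.norm_of_nonneg hn0.le, inv_mul_lt_iff₀ hn0]
    exact hb
  obtain ⟨c, hc1, hc2⟩ : ∃ c, (n : ℝ) • c = b ∧ ‖c‖ < ε / 2 :=
    ⟨_, smul_inv_smul₀ hn0.ne' b, hc b ((le_max_left _ _).trans_lt hn)⟩
  obtain ⟨c', hc1', hc2'⟩ : ∃ c, (n : ℝ) • c = b' ∧ ‖c‖ < ε / 2 :=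
    ⟨_, smul_inv_smul₀ hn0.ne' b', hc b' ((le_max_right _ _).trans_lt hn)⟩
  rw [← hc1, ← hc1', ← smul_add]
  have hU {m' : M} (h : φ m' = φ m) : φ m' ∈ W.U := h.symm ▸ hm
  have hmf {m' : M} (h : φ m' = φ m) (b : Fin k → ℝ) : φ (W.flow b m') = φ m :=
    (map_flow hφ (hU h) b).trans h
  -- Commutation of one short flow with multiples of another follows from the small case, since
  -- addition of c and c' is commutative.
  have hcomm (j : ℕ) : ∀ m', φ m' = φ m →
      W.flow ((j : ℝ) • c) (W.flow c' m') = W.flow c' (W.flow ((j : ℝ) • c) m') := by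
    induction j with
    | zero =>
      intro m' hm'
      simp only [Nat.cast_zero, zero_smul]
      rw [flow_zero hφ (hU (hmf hm' _)), flow_zero hφ (hU hm')]
    | succ j ih =>
      intro m' hm'
      rw [flow_succ_smul hφ (hU (hmf hm' _)), flow_succ_smul hφ (hU hm'), ih m' hm',
        ← small c c' hc2 hc2' _ (hmf hm' _), add_comm c, small c' c hc2' hc2 _ (hmf hm' _)]
  have main (j : ℕ) : W.flow ((j : ℝ) • (c + c')) m =
      W.flow ((j : ℝ) • c) (W.flow ((j : ℝ) • c') m) := by
    induction j with
    | zero =>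
      simp only [Nat.cast_zero, zero_smul]
      rw [flow_zero hφ hm, flow_zero hφ hm]
    | succ j ih =>
      rw [flow_succ_smul hφ hm, ih, small c c' hc2 hc2' _ (hmf (hmf rfl _) _),
        ← hcomm j _ (hmf rfl _), ← flow_succ_smul hφ hm,
        ← flow_succ_smul hφ (hU (hmf rfl _))]
  exact main n

/-- The action of `ker ρ` on the fibres is transitive. -/
theorem exists_flow_eq (hφ : IsContactIsotropicRealisation J C φ F) {m m' : M} (hm : φ m ∈ W.U)
    (h : φ m' = φ m) : ∃ b, W.flow b m = m' := by
  have hU {m' : M} (h : φ m' = φ m) : φ m' ∈ W.U := h.symm ▸ hm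
  -- Near m₁ the fibre is a slice of a flow chart, reached by translations. So orbits are open in
  -- the fibre, hence also closed, and connectedness leaves only one.
  have near (m₁ : M) (h₁ : φ m₁ = φ m) : ∀ᶠ m₂ in 𝓝 m₁, φ m₂ = φ m → ∃ b, W.flow b m₁ = m₂ := by
    obtain ⟨Θ, h1, h2⟩ := W.exists_isFlowChart (hU h₁)
    obtain ⟨r, hr, hr'⟩ := Metric.isOpen_iff.1 Θ.open_target _ (Θ.map_source h1)
    filter_upwards [(Θ.isOpen_inter_preimage Metric.isOpen_ball).mem_nhds
        (⟨h1, Metric.mem_ball_self hr⟩ : m₁ ∈ Θ.source ∩ Θ ⁻¹' Metric.ball (Θ m₁) r)] with m₂ hm₂ h₂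
    have e1 : (Θ m₂).1 = (Θ m₁).1 := by
      rw [h2.fst_eq _ h1, h2.fst_eq _ hm₂.1, h₁, h₂]
    have e2 : Θ m₁ + (0, (Θ m₂).2 - (Θ m₁).2) = Θ m₂ := by
      ext
      · simp [e1]
      · simp
    refine ⟨(Θ m₂).2 - (Θ m₁).2, ?_⟩
    rw [h2.flow_eq hφ h1 hr', e2, Θ.left_inv hm₂.1]
    have h3 : dist (Θ m₂) (Θ m₁) < r := hm₂.2
    rw [dist_eq_norm] at h3
    exact (norm_snd_le (Θ m₂ - Θ m₁)).trans_lt h3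
  have hc : IsPreconnected (φ ⁻¹' {φ m}) := (hφ.isConnected_fibre _).isPreconnected
  have : PreconnectedSpace (φ ⁻¹' {φ m}) := Subtype.preconnectedSpace hc
  set A : Set (φ ⁻¹' {φ m}) := {x | ∃ b, W.flow b m = x}
  have hA : IsClopen A := by
    have h1 (x : φ ⁻¹' {φ m}) : ∀ᶠ y : φ ⁻¹' {φ m} in 𝓝 x, ∃ b, W.flow b (x : M) = y := by
      have : ∀ᶠ y : φ ⁻¹' {φ m} in 𝓝 x, φ y = φ m → ∃ b, W.flow b (x : M) = y :=
        (continuous_subtype_val.tendsto x).eventually (near x x.2)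
      filter_upwards [this] with y hy using hy y.2
    constructor
    · rw [← isOpen_compl_iff, isOpen_iff_mem_nhds]
      intro x hx
      filter_upwards [h1 x] with y ⟨b, hb⟩ ⟨b', hb'⟩
      refine hx ⟨-b + b', ?_⟩
      rw [flow_add hφ hm, hb', ← hb, ← flow_add hφ (hU x.2), neg_add_cancel,
        flow_zero hφ (hU x.2)]
    · rw [isOpen_iff_mem_nhds]
      rintro x ⟨b', hb'⟩
      filter_upwards [h1 x] with y ⟨b, hb⟩
      exact ⟨b + b', by rw [flow_add hφ hm, hb', hb]⟩
  have h2 := hA.eq_univ ⟨⟨m, rfl⟩, 0, flow_zero hφ hm⟩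
  exact (h2 ▸ mem_univ _ : (⟨m', h⟩ : φ ⁻¹' {φ m}) ∈ A)

theorem contMDiffAt_flow_of_small (hφ : IsContactIsotropicRealisation J C φ F) {m₀ : M}
    {b₀ : Fin k → ℝ} {Θ : OpenPartialHomeomorph M (E × (Fin k → ℝ))} (hΘ : W.IsFlowChart Θ)
    (hm₀ : m₀ ∈ Θ.source) {r : ℝ} (hr : Metric.ball (Θ m₀) r ⊆ Θ.target) (hb₀ : ‖b₀‖ < r) :
    ContMDiffAt (𝓘(ℝ, E').prod 𝓘(ℝ, Fin k → ℝ)) 𝓘(ℝ, E') ∞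
      (fun x : M × (Fin k → ℝ) => W.flow x.2 x.1) (m₀, b₀) := by
  -- Half of the slack: a centre moved by less than δ still has a ball of radius r - δ > ‖b₀‖ inside
  -- the target.
  set δ := (r - ‖b₀‖) / 2 with hδ
  have hδ0 : 0 < δ := half_pos (sub_pos.2 hb₀)
  have h0 : Θ m₀ + (0, b₀) ∈ Θ.target := by
    refine hr ?_
    rw [mem_ball_iff_norm, add_sub_cancel_left]
    simpa [(norm_nonneg _).trans_lt hb₀] using hb₀
  have h1 : ContMDiffAt (𝓘(ℝ, E').prod 𝓘(ℝ, Fin k → ℝ)) 𝓘(ℝ, E × (Fin k → ℝ)) ∞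
      (fun x : M × (Fin k → ℝ) => Θ x.1 + ((0, x.2) : E × (Fin k → ℝ))) (m₀, b₀) := by
    have h2 : ContMDiffAt (𝓘(ℝ, E').prod 𝓘(ℝ, Fin k → ℝ)) 𝓘(ℝ, E × (Fin k → ℝ)) ∞
        (fun x : M × (Fin k → ℝ) => Θ x.1) (m₀, b₀) :=
      ContMDiffAt.comp (m₀, b₀) (g := Θ) (hΘ.contMDiffAt hm₀) contMDiffAt_fst
    have h3 : ContMDiffAt (𝓘(ℝ, E').prod 𝓘(ℝ, Fin k → ℝ)) 𝓘(ℝ, E × (Fin k → ℝ)) ∞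
        (fun x : M × (Fin k → ℝ) => ContinuousLinearMap.inr ℝ E (Fin k → ℝ) x.2) (m₀, b₀) :=
      (ContinuousLinearMap.inr ℝ E (Fin k → ℝ)).contMDiff.contMDiffAt.comp (m₀, b₀)
        contMDiffAt_snd
    exact h2.add h3
  have h2 := ContMDiffAt.comp (m₀, b₀) (g := Θ.symm) (hΘ.contMDiffAt_symm h0) h1
  refine h2.congr_of_eventuallyEq ?_
  have e1 : ∀ᶠ x : M × (Fin k → ℝ) in 𝓝 (m₀, b₀), x.1 ∈ Θ.source ∩ Θ ⁻¹' Metric.ball (Θ m₀) δ :=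
    continuousAt_fst.eventually ((Θ.isOpen_inter_preimage Metric.isOpen_ball).mem_nhds
      ⟨hm₀, Metric.mem_ball_self hδ0⟩)
  have e2 : ∀ᶠ x : M × (Fin k → ℝ) in 𝓝 (m₀, b₀), ‖x.2‖ < r - δ := by
    have : ContinuousAt (fun x : M × (Fin k → ℝ) => ‖x.2‖) (m₀, b₀) := continuousAt_snd.norm
    exact this.eventually (gt_mem_nhds (by simp only [hδ]; linarith))
  filter_upwards [e1, e2] with x hx1 hx2
  refine hΘ.flow_eq hφ hx1.1 (subset_trans (fun y hy => ?_) hr) hx2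
  have h3 : dist (Θ x.1) (Θ m₀) < δ := hx1.2
  rw [Metric.mem_ball] at hy ⊢
  linarith [dist_triangle y (Θ x.1) (Θ m₀)]

/-- The flow of b is the n-th iterate of the flow of b/n. Every intermediate point lies on the same
compact fibre, where one bound ε makes the flow of b₀/n a translation; compositions of smooth maps
are smooth. -/
theorem contMDiffAt_flow (hφ : IsContactIsotropicRealisation J C φ F) {m₀ : M} (hm₀ : φ m₀ ∈ W.U)
    (b₀ : Fin k → ℝ) :
    ContMDiffAt (𝓘(ℝ, E').prod 𝓘(ℝ, Fin k → ℝ)) 𝓘(ℝ, E') ∞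
      (fun x : M × (Fin k → ℝ) => W.flow x.2 x.1) (m₀, b₀) := by
  obtain ⟨ε, hε, hΘ⟩ := exists_uniform_isFlowChart (W := W) hφ hm₀
  obtain ⟨n, hn⟩ := exists_nat_gt (‖b₀‖ / ε)
  rw [div_lt_iff₀ hε] at hn
  have hn0 : 0 < (n : ℝ) := by
    by_contra h
    have : (n : ℝ) * ε ≤ 0 := mul_nonpos_of_nonpos_of_nonneg (not_lt.1 h) hε.le
    linarith [norm_nonneg b₀]
  have hc : ‖(n : ℝ)⁻¹ • b₀‖ < ε := by
    rw [norm_smul, norm_inv, Real.norm_of_nonneg hn0.le, inv_mul_lt_iff₀ hn0]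
    exact hn
  have hev : ∀ᶠ x : M × (Fin k → ℝ) in 𝓝 (m₀, b₀), φ x.1 ∈ W.U :=
    (hφ.contMDiff.continuous.comp continuous_fst).continuousAt.eventually
      (W.isOpen.mem_nhds hm₀)
  have hsm : ContMDiffAt (𝓘(ℝ, E').prod 𝓘(ℝ, Fin k → ℝ)) 𝓘(ℝ, Fin k → ℝ) ∞
      (fun x : M × (Fin k → ℝ) => (n : ℝ)⁻¹ • x.2) (m₀, b₀) :=
    ((n : ℝ)⁻¹ • ContinuousLinearMap.id ℝ (Fin k → ℝ)).contMDiff.contMDiffAt.comp (m₀, b₀)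
      contMDiffAt_snd
  have step (j : ℕ) : ContMDiffAt (𝓘(ℝ, E').prod 𝓘(ℝ, Fin k → ℝ)) 𝓘(ℝ, E') ∞
      (fun x : M × (Fin k → ℝ) => W.flow ((j : ℝ) • (n : ℝ)⁻¹ • x.2) x.1) (m₀, b₀) := by
    induction j with
    | zero =>
      refine contMDiffAt_fst.congr_of_eventuallyEq ?_
      filter_upwards [hev] with x hx
      rw [Nat.cast_zero, zero_smul, flow_zero hφ hx]
    | succ j ih =>
      obtain ⟨Θ, h1, h2, h3⟩ := hΘ _ (map_flow hφ hm₀ ((j : ℝ) • (n : ℝ)⁻¹ • b₀))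
      have h4 := contMDiffAt_flow_of_small hφ h2 h1 h3 hc
      refine (ContMDiffAt.comp (m₀, b₀) (g := fun x : M × (Fin k → ℝ) => W.flow x.2 x.1)
        (f := fun x : M × (Fin k → ℝ) => (W.flow ((j : ℝ) • (n : ℝ)⁻¹ • x.2) x.1,
          (n : ℝ)⁻¹ • x.2)) h4 (ih.prodMk hsm)).congr_of_eventuallyEq ?_
      filter_upwards [hev] with x hx
      exact flow_succ_smul hφ hx _ _
  refine (step n).congr_of_eventuallyEq (.of_forall fun x => ?_)
  simp only [smul_inv_smul₀ hn0.ne']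

end FlowModel

end Flow

/-! ### Manifold structures from compatible charts and from slices -/

section Charts

variable {V : Type*} [NormedAddCommGroup V] [NormedSpace ℝ V]

/-- Compatible charts around the points of a space make it a manifold. -/
theorem exists_chartedSpace {S : Type*} [TopologicalSpace S] (D : S → OpenPartialHomeomorph S V)
    (hD : ∀ x, x ∈ (D x).source)
    (h : ∀ x y, ContDiffOn ℝ ∞ (D y ∘ (D x).symm) ((D x).symm ≫ₕ D y).source) :
    ∃ _ : ChartedSpace V S, IsManifold 𝓘(ℝ, V) ∞ S ∧ ∀ x, IsSmoothChart (E := V) (D x) := by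
  let cs : ChartedSpace V S :=
    { atlas := range D
      chartAt := D
      mem_chart_source := hD
      chart_mem_atlas := mem_range_self }
  have hm : IsManifold 𝓘(ℝ, V) ∞ S := by
    refine isManifold_of_contDiffOn _ _ _ ?_
    rintro _ _ ⟨x, rfl⟩ ⟨y, rfl⟩
    simpa using! h x y
  exact ⟨cs, hm, fun x => isSmoothChart_chartAt x⟩

variable {C E₀ H : Type*} [NormedAddCommGroup C] [NormedSpace ℝ C] [NormedAddCommGroup E₀]
  [NormedSpace ℝ E₀] [TopologicalSpace H] {I : ModelWithCorners ℝ E₀ H}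
  {N : Type*} [TopologicalSpace N] [ChartedSpace H N] {S : Set N}

open Classical in
/-- The chart of a subset which is the slice `C = 0` in a chart. -/
def sliceChart (hI : range I = univ) (D : OpenPartialHomeomorph N H) (e : (V × C) ≃L[ℝ] E₀)
    (hS : ∀ y ∈ D.source, y ∈ S ↔ (e.symm (I (D y))).2 = 0) (x : S) :
    OpenPartialHomeomorph S V where
  toFun y := (e.symm (I (D y))).1
  -- Off the target the value is the arbitrary point x of the subset.
  invFun v := if h : I.symm (e (v, 0)) ∈ D.target then
    ⟨D.symm (I.symm (e (v, 0))), (hS _ (D.map_target h)).2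
      (by rw [D.right_inv h, I.right_inv (hI ▸ mem_univ _), e.symm_apply_apply])⟩ else x
  source := Subtype.val ⁻¹' D.source
  target := {v | I.symm (e (v, 0)) ∈ D.target}
  map_source' y hy := by
    have h1 : (e.symm (I (D y))) = ((e.symm (I (D y))).1, 0) := Prod.ext rfl ((hS _ hy).1 y.2)
    rw [mem_ofPred_eq, ← h1, e.apply_symm_apply, I.left_inv]
    exact D.map_source hy
  map_target' v hv := by
    rw [mem_ofPred_eq] at hv
    rw [dif_pos hv]
    exact D.map_target hv
  left_inv' y hy := by
    have h1 : (e.symm (I (D y))) = ((e.symm (I (D y))).1, 0) := Prod.ext rfl ((hS _ hy).1 y.2)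
    have h2 : I.symm (e ((e.symm (I (D y))).1, 0)) = D y := by
      rw [← h1, e.apply_symm_apply, I.left_inv]
    rw [dif_pos (by rw [h2]; exact D.map_source hy)]
    refine Subtype.ext ?_
    simp only [h2]
    exact D.left_inv hy
  right_inv' v hv := by
    rw [mem_ofPred_eq] at hv
    rw [dif_pos hv, D.right_inv hv, I.right_inv (hI ▸ mem_univ _), e.symm_apply_apply]
  open_source := D.open_source.preimage continuous_subtype_val
  open_target := D.open_target.preimage (by
    exact I.continuous_symm.comp (e.continuous.comp (by fun_prop)))
  continuousOn_toFun := by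
    have h : Continuous fun x => (e.symm (I x)).1 :=
      continuous_fst.comp (e.symm.continuous.comp I.continuous)
    exact h.comp_continuousOn (D.continuousOn.comp continuous_subtype_val.continuousOn fun _ h => h)
  continuousOn_invFun := by
    have h : Continuous fun v : V => I.symm (e (v, (0 : C))) :=
      I.continuous_symm.comp (e.continuous.comp (by fun_prop))
    refine IsInducing.subtypeVal.continuousOn_iff.2
      ((D.continuousOn_symm.comp h.continuousOn fun _ h => h).congr fun v hv => ?_)
    have hv' : I.symm (e (v, 0)) ∈ D.target := hv
    simp [dif_pos hv']

theorem coe_sliceChart_symm (hI : range I = univ) (D : OpenPartialHomeomorph N H)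
    (e : (V × C) ≃L[ℝ] E₀) (hS : ∀ y ∈ D.source, y ∈ S ↔ (e.symm (I (D y))).2 = 0) (x : S)
    {v : V} (hv : v ∈ (sliceChart hI D e hS x).target) :
    ((sliceChart hI D e hS x).symm v : N) = D.symm (I.symm (e (v, 0))) := by
  have hv' : I.symm (e (v, 0)) ∈ D.target := hv
  exact congrArg Subtype.val (dif_pos hv')

/-- A subset which is a slice in charts is an embedded submanifold. -/
theorem exists_submanifold [IsManifold I ∞ N] (C : Type*) [NormedAddCommGroup C] [NormedSpace ℝ C]
    (hI : range I = univ)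
    (h : ∀ x ∈ S, ∃ D ∈ IsManifold.maximalAtlas I ∞ N, ∃ e : (V × C) ≃L[ℝ] E₀, x ∈ D.source ∧
      ∀ y ∈ D.source, y ∈ S ↔ (e.symm (I (D y))).2 = 0) :
    ∃ _ : ChartedSpace V S, IsManifold 𝓘(ℝ, V) ∞ S ∧
      IsSmoothEmbedding 𝓘(ℝ, V) I ∞ (Subtype.val : S → N) := by
  have h' (x : S) := h x x.2
  choose D hD e hx hS' using h'
  obtain ⟨cs, hm, hc⟩ := exists_chartedSpace (fun x : S => sliceChart hI (D x) (e x) (hS' x) x)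
    hx (by
      intro x y v hv
      rw [OpenPartialHomeomorph.trans_source] at hv
      have hv1 : I.symm (e x (v, 0)) ∈ (D x).target := hv.1
      have hv2 : (D x).symm (I.symm (e x (v, 0))) ∈ (D y).source := by
        rw [← coe_sliceChart_symm hI (D x) (e x) (hS' x) x hv.1]
        exact hv.2
      have h1 : ContMDiffAt 𝓘(ℝ, V) 𝓘(ℝ, E₀) ∞ (fun v : V => e x (v, (0 : C))) v := by
        refine ContDiff.contMDiff ?_ |>.contMDiffAt
        exact (e x).contDiff.comp (contDiff_id.prodMk contDiff_const)
      have h2 : ContMDiffAt 𝓘(ℝ, E₀) I ∞ I.symm (e x (v, (0 : C))) :=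
        I.contMDiffOn_symm.contMDiffAt (hI ▸ Filter.univ_mem)
      have h3 := contMDiffAt_symm_of_mem_maximalAtlas (hD x) hv1
      have h4 := contMDiffAt_of_mem_maximalAtlas (hD y) hv2
      have h5 : ContMDiffAt I 𝓘(ℝ, E₀) ∞ I (D y ((D x).symm (I.symm (e x (v, 0))))) :=
        I.contMDiff _
      have h6 : ContMDiffAt 𝓘(ℝ, E₀) 𝓘(ℝ, V) ∞ (fun w => ((e y).symm w).1)
          (I (D y ((D x).symm (I.symm (e x (v, 0)))))) := by
        refine ContDiff.contMDiff ?_ |>.contMDiffAt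
        exact contDiff_fst.comp (e y).symm.contDiff
      have h7 := ContMDiffAt.comp v (g := (D x).symm) h3 (ContMDiffAt.comp v (g := I.symm) h2 h1)
      have h8 := ContMDiffAt.comp v (g := fun w => ((e y).symm w).1) h6
        (ContMDiffAt.comp v (g := I) h5 (ContMDiffAt.comp v (g := D y) h4 h7))
      refine ContDiffWithinAt.congr (contMDiffAt_iff_contDiffAt.1 h8).contDiffWithinAt ?_ ?_
      all_goals try intro w hw
      all_goals
        exact congrArg (fun z => ((e y).symm (I (D y z))).1) (coe_sliceChart_symm hI (D x) (e x)
          (hS' x) x (by first | exact hw.1 | exact hv.1)))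
  refine ⟨cs, hm, ?_, IsEmbedding.subtypeVal⟩
  -- In the slice charts the inclusion reads v ↦ e(v, 0), which is the normal form of an immersion.
  have : IsImmersionOfComplement C 𝓘(ℝ, V) I ∞ (Subtype.val : S → N) := by
    intro x
    refine IsImmersionAtOfComplement.mk_of_continuousAt continuous_subtype_val.continuousAt (e x)
      (sliceChart hI (D x) (e x) (hS' x) x) (D x) (hx x) (hx x)
      (OpenPartialHomeomorph.mem_maximalAtlas_of_contMDiffOn _ (hc x).contMDiffOn
        (hc x).contMDiffOn_symm) (hD x) ?_
    intro v hv
    have hv' : v ∈ (sliceChart hI (D x) (e x) (hS' x) x).target := by simpa using hv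
    have h1 := coe_sliceChart_symm hI (D x) (e x) (hS' x) x hv'
    have h2 : I.symm (e x (v, 0)) ∈ (D x).target := hv'
    simp only [Function.comp_apply, OpenPartialHomeomorph.extend_coe,
      OpenPartialHomeomorph.extend_coe_symm, modelWithCornersSelf_coe_symm, id]
    rw [h1, (D x).right_inv h2, I.right_inv (hI ▸ mem_univ _)]
  exact this.isImmersion

end Charts

/-! ### Quotient manifolds -/

section Quotient

variable {V : Type*} [NormedAddCommGroup V] [NormedSpace ℝ V]
  {N : Type*} [TopologicalSpace N] [ChartedSpace V N] [IsManifold 𝓘(ℝ, V) ∞ N]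
  {Q : Type*} [TopologicalSpace Q] {q : N → Q}

/-- A quotient by smooth local identifications is a manifold if the projection is open and locally
injective. -/
theorem exists_quotient_manifold (hc : Continuous q) (ho : IsOpenMap q)
    (hs : Function.Surjective q) (hi : ∀ a, ∃ O ∈ 𝓝 a, InjOn q O)
    (ht : ∀ a b, q a = q b → ∃ h : N → N, ContMDiffAt 𝓘(ℝ, V) 𝓘(ℝ, V) ∞ h a ∧ h a = b ∧
      ∀ᶠ x in 𝓝 a, q (h x) = q x) :
    ∃ _ : ChartedSpace V Q, IsManifold 𝓘(ℝ, V) ∞ Q ∧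
      IsLocalDiffeomorph 𝓘(ℝ, V) 𝓘(ℝ, V) ∞ q := by
  have hl (a : N) : ∃ T : OpenPartialHomeomorph N Q, a ∈ T.source ∧ ⇑T = q := by
    obtain ⟨O, hO, hOi⟩ := hi a
    obtain ⟨O', hO', hO'o, ha⟩ := mem_nhds_iff.1 hO
    have hinj := hOi.mono hO'
    have : Nonempty N := ⟨a⟩
    refine ⟨OpenPartialHomeomorph.ofContinuousOpenRestrict (hinj.toPartialEquiv q O')
      hc.continuousOn ?_ hO'o, ha, rfl⟩
    exact ho.comp hO'o.isOpenMap_subtype_val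
  choose T haT hT using hl
  -- A change between local inverses of q agrees, by injectivity of q on the source of `T b`, with
  -- the smooth identification h. This one fact gives the compatibility of the charts and the
  -- smoothness of q and of its local inverses.
  have htr (a b : N) {x : N} (hx : x ∈ (T a).source) (hx' : q x ∈ (T b).target) :
      ContMDiffAt 𝓘(ℝ, V) 𝓘(ℝ, V) ∞ (fun y => (T b).symm (q y)) x := by
    have h1 : q ((T b).symm (q x)) = q x := by
      have := (T b).right_inv hx'
      rwa [hT] at this
    obtain ⟨h, h2, h3, h4⟩ := ht x _ h1.symm
    refine h2.congr_of_eventuallyEq ?_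
    have h5 : ∀ᶠ y in 𝓝 x, h y ∈ (T b).source :=
      h2.continuousAt.eventually ((T b).open_source.mem_nhds
        (by rw [h3]; exact (T b).map_target hx'))
    filter_upwards [h4, h5] with y hy hy'
    have h6 := (T b).left_inv hy'
    rw [hT b, hy] at h6
    exact h6
  set g : Q → N := Function.surjInv hs
  have hg (x : Q) : q (g x) = x := Function.surjInv_eq hs x
  have hcs (a : N) := isSmoothChart_chartAt (E := V) a
  obtain ⟨cs, hm, hD⟩ := exists_chartedSpace
    (fun x => (T (g x)).symm ≫ₕ chartAt V (g x)) (fun x => by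
      have h1 := (T (g x)).map_source (haT (g x))
      have h2 := (T (g x)).left_inv (haT (g x))
      rw [hT, hg] at h1 h2
      rw [OpenPartialHomeomorph.trans_source]
      refine ⟨h1, ?_⟩
      rw [mem_preimage, h2]
      exact mem_chart_source V (g x)) (by
    intro x y v hv
    simp only [OpenPartialHomeomorph.trans_source, OpenPartialHomeomorph.trans_symm_eq_symm_trans_symm,
      OpenPartialHomeomorph.coe_trans, OpenPartialHomeomorph.symm_symm, mem_inter_iff, mem_preimage,
      OpenPartialHomeomorph.symm_source, Function.comp_apply, hT] at hv
    obtain ⟨⟨h1, h2⟩, h3, h4⟩ := hv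
    have h5 := ContMDiffAt.comp v (htr _ _ h2 h3) ((hcs (g x)).contMDiffAt_symm h1)
    have h6 := ContMDiffAt.comp v ((hcs (g y)).contMDiffAt h4) h5
    refine ContDiffAt.contDiffWithinAt ?_
    refine (contMDiffAt_iff_contDiffAt.1 h6).congr_of_eventuallyEq (.of_forall fun w => ?_)
    simp [hT])
  refine ⟨cs, hm, fun a => ?_⟩
  have e1 (x : N) : ContMDiffAt 𝓘(ℝ, V) 𝓘(ℝ, V) ∞ q x := by
    have h1 := (T (g (q x))).map_source (haT (g (q x)))
    have h2 := (T (g (q x))).left_inv (haT (g (q x)))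
    rw [hT, hg] at h1 h2
    have hxs : q x ∈ ((T (g (q x))).symm ≫ₕ chartAt V (g (q x))).source :=
      ⟨h1, mem_preimage.2 (h2.symm ▸ mem_chart_source V _)⟩
    have h3 := ContMDiffAt.comp x ((hcs (g (q x))).contMDiffAt
      (by rw [h2]; exact mem_chart_source V _)) (htr x _ (haT x) h1)
    have h4 := ContMDiffAt.comp x ((hD (q x)).contMDiffAt_symm (x := chartAt V (g (q x))
      ((T (g (q x))).symm (q x))) ?_) h3
    · refine h4.congr_of_eventuallyEq ?_
      have h5 : ∀ᶠ y in 𝓝 x, q y ∈ ((T (g (q x))).symm ≫ₕ chartAt V (g (q x))).source :=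
        hc.continuousAt.eventually ((OpenPartialHomeomorph.open_source
          ((T (g (q x))).symm ≫ₕ chartAt V (g (q x)))).mem_nhds hxs)
      filter_upwards [h5] with y hy
      exact (OpenPartialHomeomorph.left_inv _ hy).symm
    · exact OpenPartialHomeomorph.map_source ((T (g (q x))).symm ≫ₕ chartAt V (g (q x))) hxs
  have e2 {x : Q} (hx : x ∈ (T a).target) : ContMDiffAt 𝓘(ℝ, V) 𝓘(ℝ, V) ∞ (T a).symm x := by
    have h1 := (T (g x)).map_source (haT (g x))
    have h2 := (T (g x)).left_inv (haT (g x))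
    rw [hT, hg] at h1 h2
    have hxs : x ∈ ((T (g x)).symm ≫ₕ chartAt V (g x)).source :=
      ⟨h1, mem_preimage.2 (h2.symm ▸ mem_chart_source V _)⟩
    have h3 : ContMDiffAt 𝓘(ℝ, V) 𝓘(ℝ, V) ∞ ((chartAt V (g x)).symm ∘
        ((T (g x)).symm ≫ₕ chartAt V (g x))) x :=
      ContMDiffAt.comp x ((hcs (g x)).contMDiffAt_symm
        ((chartAt V (g x)).map_source hxs.2)) ((hD x).contMDiffAt hxs)
    have h4 : ((chartAt V (g x)).symm ∘ ((T (g x)).symm ≫ₕ chartAt V (g x))) x = g x :=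
      ((chartAt V (g x)).left_inv hxs.2).trans h2
    have h5 := ContMDiffAt.comp x (g := fun y => (T a).symm (q y))
      (by rw [h4]; exact htr (g x) a (haT _) (by rwa [hg])) h3
    refine h5.congr_of_eventuallyEq ?_
    filter_upwards [(OpenPartialHomeomorph.open_source _).mem_nhds hxs] with y hy
    have h6 := (T (g x)).right_inv hy.1
    rw [hT] at h6
    have h7 : (chartAt V (g x)).symm (chartAt V (g x) ((T (g x)).symm y)) = (T (g x)).symm y :=
      (chartAt V (g x)).left_inv hy.2
    simp only [Function.comp_apply, OpenPartialHomeomorph.coe_trans]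
    rw [h7, h6]
  refine ⟨⟨(T a).toPartialEquiv, (T a).open_source, (T a).open_target, ?_, ?_⟩, haT a, ?_⟩
  · intro x _
    have := (e1 x).contMDiffWithinAt (s := (T a).source)
    rw [← hT a] at this
    exact this
  · intro x hx
    exact (e2 hx).contMDiffWithinAt
  · intro x _
    exact congrFun (hT a).symm x

end Quotient

/-! ### Smooth maps to and from finite products -/

section Pi

variable {𝕜 : Type*} [NontriviallyNormedField 𝕜] {ι : Type*} [Fintype ι]
  {E : ι → Type*} [∀ i, NormedAddCommGroup (E i)] [∀ i, NormedSpace 𝕜 (E i)]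
  {H : ι → Type*} [∀ i, TopologicalSpace (H i)] {I : ∀ i, ModelWithCorners 𝕜 (E i) (H i)}
  {N : ι → Type*} [∀ i, TopologicalSpace (N i)] [∀ i, ChartedSpace (H i) (N i)]
  {E' H' X : Type*} [NormedAddCommGroup E'] [NormedSpace 𝕜 E'] [TopologicalSpace H']
  {I' : ModelWithCorners 𝕜 E' H'} [TopologicalSpace X] [ChartedSpace H' X] {n : ℕ∞ω}

theorem contMDiffAt_pi_of {f : X → ∀ i, N i} {x : X}
    (h : ∀ i, ContMDiffAt I' (I i) n (fun y => f y i) x) :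
    ContMDiffAt I' (ModelWithCorners.pi I) n f x := by
  refine contMDiffAt_iff.2 ⟨continuousAt_pi.2 fun i => (h i).continuousAt, ?_⟩
  exact contDiffWithinAt_pi.2 fun i => (contMDiffAt_iff.1 (h i)).2

theorem contMDiff_pi_apply (i : ι) :
    ContMDiff (ModelWithCorners.pi I) (I i) n (fun y : ∀ i, N i => y i) := by
  intro y
  refine contMDiffAt_iff.2 ⟨continuousAt_apply i _, ?_⟩
  have h : ContDiffWithinAt 𝕜 n (fun z : ∀ i, E i => z i) (range (ModelWithCorners.pi I))
      (extChartAt (ModelWithCorners.pi I) y y) :=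
    (ContinuousLinearMap.proj (R := 𝕜) (φ := E) i).contDiff.contDiffWithinAt
  refine h.congr_of_eventuallyEq_of_mem ?_ ⟨_, rfl⟩
  filter_upwards [extChartAt_target_mem_nhdsWithin y] with z hz
  exact congrFun ((extChartAt (ModelWithCorners.pi I) y).right_inv hz) i

end Pi

/-! ### Local logarithms on the circle -/

section Circle

/-- Rotating z₀ to 1 keeps the branch cut of the argument away from the point in question. -/
theorem exists_circle_log (z₀ : Circle) : ∃ f : Circle → ℝ,
    ContMDiffAt (𝓡 1) 𝓘(ℝ, ℝ) ∞ f z₀ ∧ ∀ z, Circle.exp (f z) = z := by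
  refine ⟨fun z => Complex.arg (z * z₀⁻¹ : Circle) + Complex.arg z₀, ?_, fun z => ?_⟩
  · have : LieGroup (𝓡 1) ∞ Circle := inferInstance
    have h1 : ContMDiffAt (𝓡 1) (𝓡 1) ∞ (fun z : Circle => z * z₀⁻¹) z₀ :=
      (contMDiff_id.mul contMDiff_const).contMDiffAt
    have h2 : ContMDiff (𝓡 1) 𝓘(ℝ, ℂ) ∞ (fun z : Circle => (z : ℂ)) :=
      have := finrank_real_complex_fact'
      contMDiff_coe_sphere (n := 1) (E := ℂ)
    have h3 : ContDiffAt ℝ ∞ Complex.arg 1 := by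
      have h4 : ContDiffAt ℝ ∞ Complex.log 1 :=
        (Complex.contDiffAt_log Complex.one_mem_slitPlane).restrict_scalars ℝ
      have h5 := Complex.imCLM.contDiff.contDiffAt.comp (1 : ℂ) h4
      exact h5.congr_of_eventuallyEq (.of_forall fun z => (Complex.log_im z).symm)
    have h6 : ContMDiffAt (𝓡 1) 𝓘(ℝ, ℂ) ∞ (fun z : Circle => ((z * z₀⁻¹ : Circle) : ℂ)) z₀ :=
      h2.contMDiffAt.comp z₀ h1
    have h7 := ContMDiffAt.comp z₀ (g := Complex.arg) (f := fun z : Circle => ((z * z₀⁻¹ : Circle) : ℂ))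
      (by simpa using h3.contMDiffAt) h6
    exact h7.add contMDiffAt_const
  · rw [Circle.exp_add, Circle.exp_arg, Circle.exp_arg, inv_mul_cancel_right]

end Circle

/-! ### Straightening a family of complements; shears -/

section Straightening

variable {E : Type*} [NormedAddCommGroup E] [NormedSpace ℝ E]
  {K : Type*} [NormedAddCommGroup K] [NormedSpace ℝ K]
  {V : Type*} [NormedAddCommGroup V] [NormedSpace ℝ V]

/-- V is the direct sum of the image of s₀ and of the kernel of Q, the second component of v being v
- s₀(Q v). The number r is the dimension of that kernel. -/
theorem exists_complement_equiv [FiniteDimensional ℝ V] (Q : V →L[ℝ] K) (s₀ : K →L[ℝ] V)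
    (h : ∀ b, Q (s₀ b) = b) {r : ℕ} (hr : r = Module.finrank ℝ V - Module.finrank ℝ K) :
    ∃ g : V ≃L[ℝ] K × (Fin r → ℝ), ∀ v, (g v).2 = 0 ↔ s₀ (Q v) = v := by
  have hQ : Function.RightInverse s₀ Q := h
  have hf : Module.finrank ℝ Q.ker = Module.finrank ℝ (Fin r → ℝ) := by
    have h1 := LinearMap.finrank_range_add_finrank_ker (Q : V →ₗ[ℝ] K)
    rw [LinearMap.range_eq_top.2 hQ.surjective, finrank_top] at h1
    rw [Module.finrank_fin_fun, hr, ← h1]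
    exact (Nat.add_sub_cancel_left _ _).symm
  obtain ⟨e⟩ := FiniteDimensional.nonempty_continuousLinearEquiv_of_finrank_eq hf
  refine ⟨(ContinuousLinearEquiv.equivOfRightInverse Q s₀ hQ).trans
    ((ContinuousLinearEquiv.refl ℝ _).prodCongr e), fun v => ?_⟩
  have h1 : (((ContinuousLinearEquiv.equivOfRightInverse Q s₀ hQ).trans
    ((ContinuousLinearEquiv.refl ℝ _).prodCongr e)) v).2 =
      e (ContinuousLinearEquiv.equivOfRightInverse Q s₀ hQ v).2 := rfl
  rw [h1, map_eq_zero_iff e e.injective, Subtype.ext_iff,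
    ContinuousLinearEquiv.snd_equivOfRightInverse, ZeroMemClass.coe_zero, sub_eq_zero, eq_comm]

/-- Charts of the jet bundle take values in a `ModelProd`, while straightening is done in the normed
space E × V; the two models agree. -/
theorem contMDiffOn_modelProd {f : ModelProd E V → ModelProd E V} {A : Set (ModelProd E V)}
    (hf : ContDiffOn ℝ ∞ (E := E × V) (F := E × V) f A) :
    ContMDiffOn (𝓘(ℝ, E).prod 𝓘(ℝ, V)) (𝓘(ℝ, E).prod 𝓘(ℝ, V)) ∞ f A := by
  rw [← modelWithCornersSelf_prod]
  exact hf.contMDiffOn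

/-- The diffeomorphism that straightens the family `range (s e)` of complements of `ker Q`. -/
def straighten (Q : V →L[ℝ] K) (s : E → K →L[ℝ] V) (s₀ : K →L[ℝ] V) {A : Set E} (hA : IsOpen A)
    (hs : ContDiffOn ℝ ∞ s A) (h : ∀ e ∈ A, ∀ b, Q (s e b) = b) (h₀ : ∀ b, Q (s₀ b) = b) :
    OpenPartialHomeomorph (E × V) (E × V) where
  toFun x := (x.1, x.2 - s x.1 (Q x.2) + s₀ (Q x.2))
  invFun x := (x.1, x.2 - s₀ (Q x.2) + s x.1 (Q x.2))
  source := Prod.fst ⁻¹' A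
  target := Prod.fst ⁻¹' A
  map_source' x hx := hx
  map_target' x hx := hx
  -- Both maps preserve Q of the second component, so the added and subtracted terms cancel.
  left_inv' x hx := by
    refine Prod.ext rfl ?_
    simp only [map_add, map_sub, h x.1 hx, h₀]
    abel
  right_inv' x hx := by
    refine Prod.ext rfl ?_
    simp only [map_add, map_sub, h x.1 hx, h₀]
    abel
  open_source := hA.preimage continuous_fst
  open_target := hA.preimage continuous_fst
  continuousOn_toFun := by
    have h1 : ContinuousOn (fun x : E × V => s x.1 (Q x.2)) (Prod.fst ⁻¹' A) :=
      (hs.continuousOn.comp continuous_fst.continuousOn fun _ h => h).clm_apply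
        (Q.continuous.comp continuous_snd).continuousOn
    exact continuous_fst.continuousOn.prodMk ((continuous_snd.continuousOn.sub h1).add
      (s₀.continuous.comp (Q.continuous.comp continuous_snd)).continuousOn)
  continuousOn_invFun := by
    have h1 : ContinuousOn (fun x : E × V => s x.1 (Q x.2)) (Prod.fst ⁻¹' A) :=
      (hs.continuousOn.comp continuous_fst.continuousOn fun _ h => h).clm_apply
        (Q.continuous.comp continuous_snd).continuousOn
    exact continuous_fst.continuousOn.prodMk ((continuous_snd.continuousOn.sub
      (s₀.continuous.comp (Q.continuous.comp continuous_snd)).continuousOn).add h1)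

theorem contDiffOn_straighten (Q : V →L[ℝ] K) (s : E → K →L[ℝ] V) (s₀ : K →L[ℝ] V) {A : Set E}
    (hA : IsOpen A) (hs : ContDiffOn ℝ ∞ s A) (h : ∀ e ∈ A, ∀ b, Q (s e b) = b)
    (h₀ : ∀ b, Q (s₀ b) = b) :
    ContDiffOn ℝ ∞ (straighten Q s s₀ hA hs h h₀) (Prod.fst ⁻¹' A) ∧
      ContDiffOn ℝ ∞ (straighten Q s s₀ hA hs h h₀).symm (Prod.fst ⁻¹' A) := by
  have h1 : ContDiffOn ℝ ∞ (fun x : E × V => s x.1 (Q x.2)) (Prod.fst ⁻¹' A) :=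
    (hs.comp contDiff_fst.contDiffOn fun _ h => h).clm_apply
      (Q.contDiff.comp contDiff_snd).contDiffOn
  have h2 : ContDiff ℝ ∞ (fun x : E × V => s₀ (Q x.2)) :=
    s₀.contDiff.comp (Q.contDiff.comp contDiff_snd)
  exact ⟨contDiff_fst.contDiffOn.prodMk ((contDiff_snd.contDiffOn.sub h1).add h2.contDiffOn),
    contDiff_fst.contDiffOn.prodMk ((contDiff_snd.contDiffOn.sub h2.contDiffOn).add h1)⟩

/-- The diffeomorphism `(e, b) ↦ (e, b + c(e))`. -/
def shear {c : E → K} {A : Set E} (hA : IsOpen A) (hc : ContDiffOn ℝ ∞ c A) :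
    OpenPartialHomeomorph (E × K) (E × K) where
  toFun x := (x.1, x.2 + c x.1)
  invFun x := (x.1, x.2 - c x.1)
  source := Prod.fst ⁻¹' A
  target := Prod.fst ⁻¹' A
  map_source' x hx := hx
  map_target' x hx := hx
  left_inv' x hx := by simp
  right_inv' x hx := by simp
  open_source := hA.preimage continuous_fst
  open_target := hA.preimage continuous_fst
  continuousOn_toFun := by
    have h1 : ContinuousOn (fun x : E × K => c x.1) (Prod.fst ⁻¹' A) :=
      hc.continuousOn.comp continuous_fst.continuousOn fun _ h => h
    exact continuous_fst.continuousOn.prodMk (continuous_snd.continuousOn.add h1)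
  continuousOn_invFun := by
    have h1 : ContinuousOn (fun x : E × K => c x.1) (Prod.fst ⁻¹' A) :=
      hc.continuousOn.comp continuous_fst.continuousOn fun _ h => h
    exact continuous_fst.continuousOn.prodMk (continuous_snd.continuousOn.sub h1)

theorem contDiffOn_shear {c : E → K} {A : Set E} (hA : IsOpen A) (hc : ContDiffOn ℝ ∞ c A) :
    ContDiffOn ℝ ∞ (shear hA hc) (Prod.fst ⁻¹' A) ∧
      ContDiffOn ℝ ∞ (shear hA hc).symm (Prod.fst ⁻¹' A) := by
  have h1 : ContDiffOn ℝ ∞ (fun x : E × K => c x.1) (Prod.fst ⁻¹' A) :=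
    hc.comp contDiff_fst.contDiffOn fun _ h => h
  exact ⟨contDiff_fst.contDiffOn.prodMk (contDiff_snd.contDiffOn.add h1),
    contDiff_fst.contDiffOn.prodMk (contDiff_snd.contDiffOn.sub h1)⟩

end Straightening

/-! ### The kernel of the anchor as a submanifold -/

section KerAnchor

variable {E : Type*} [NormedAddCommGroup E] [NormedSpace ℝ E] [FiniteDimensional ℝ E]
  {P : Type*} [TopologicalSpace P] [ChartedSpace E P] [IsManifold 𝓘(ℝ, E) ∞ P] [T2Space P]
  {L : P → Type*} [TopologicalSpace (TotalSpace ℝ L)] [∀ p, TopologicalSpace (L p)]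
  [∀ p, AddCommGroup (L p)] [∀ p, Module ℝ (L p)] [FiberBundle ℝ L] [VectorBundle ℝ ℝ L]
  [ContMDiffVectorBundle ∞ ℝ L 𝓘(ℝ, E)]
  {E' : Type*} [NormedAddCommGroup E'] [NormedSpace ℝ E'] [FiniteDimensional ℝ E']
  {M : Type*} [TopologicalSpace M] [ChartedSpace E' M] [IsManifold 𝓘(ℝ, E') ∞ M] [T2Space M]
  {L' : M → Type*} [TopologicalSpace (TotalSpace ℝ L')] [∀ m, TopologicalSpace (L' m)]
  [∀ m, AddCommGroup (L' m)] [∀ m, Module ℝ (L' m)] [FiberBundle ℝ L'] [VectorBundle ℝ ℝ L']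
  [∀ m, IsTopologicalAddGroup (L' m)] [∀ m, ContinuousSMul ℝ (L' m)]
  [ContMDiffVectorBundle ∞ ℝ L' 𝓘(ℝ, E')]
  {k : ℕ} {J : JacobiStructure E L} {C : ContactForm E' L'} {φ : M → P}
  {F : BundleComponent E L E' L' φ} {i : P}

theorem chartAt_jet_eq (α y : J1 E L) : chartAt (ModelProd E (ℝ × (E →L[ℝ] ℝ))) α y =
    (chartAt E α.proj y.proj, jetCoord α.proj y) := by
  rw [FiberBundle.chartedSpace_chartAt]
  rfl

theorem mem_chartAt_jet_source (α y : J1 E L) :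
    y ∈ (chartAt (ModelProd E (ℝ × (E →L[ℝ] ℝ))) α).source ↔
      y.proj ∈ jetBaseSet E L α.proj := by
  rw [FiberBundle.chartedSpace_chartAt]
  have h : y ∈ (trivializationAt (ℝ × (E →L[ℝ] ℝ)) (jetCore E L).Fiber α.proj).source ↔
      y.proj ∈ jetBaseSet E L α.proj := ((jetCore E L).localTriv α.proj).mem_source
  simp only [OpenPartialHomeomorph.trans_source, mem_inter_iff, h]
  refine ⟨fun h => h.1, fun h => ⟨h, ?_⟩⟩
  exact ⟨h.1, mem_univ _⟩

instance (i : P) : MemTrivializationAtlas ((jetCore E L).localTriv i) :=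
  inferInstanceAs (MemTrivializationAtlas
    (trivializationAt (ℝ × (E →L[ℝ] ℝ)) (jetCore E L).Fiber i))

theorem contMDiffAt_jetCoord {α : J1 E L} (h : α.proj ∈ jetBaseSet E L i) :
    ContMDiffAt (𝓘(ℝ, E).prod 𝓘(ℝ, ℝ × (E →L[ℝ] ℝ))) 𝓘(ℝ, ℝ × (E →L[ℝ] ℝ)) ∞ (jetCoord i) α := by
  have h1 := (((jetCore E L).localTriv i).contMDiffOn (IB := 𝓘(ℝ, E)) (n := ∞)).contMDiffAt
    (((jetCore E L).localTriv i).open_source.mem_nhds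
      (((jetCore E L).localTriv i).mem_source.2 h))
  exact contMDiffAt_snd.comp α h1

namespace FlowModel

variable (W : FlowModel J C F k i)

theorem contMDiffAt_coord {α : J1 E L} (h : α.proj ∈ W.U) :
    ContMDiffAt (𝓘(ℝ, E).prod 𝓘(ℝ, ℝ × (E →L[ℝ] ℝ))) 𝓘(ℝ, Fin k → ℝ) ∞ W.coord α :=
  W.Q.contMDiff.contMDiffAt.comp α (contMDiffAt_jetCoord (W.subset h))

theorem contMDiffAt_elem {p : P} (hp : p ∈ W.U) (b : Fin k → ℝ) :
    ContMDiffAt (𝓘(ℝ, E).prod 𝓘(ℝ, Fin k → ℝ)) (𝓘(ℝ, E).prod 𝓘(ℝ, ℝ × (E →L[ℝ] ℝ))) ∞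
      (fun x : P × (Fin k → ℝ) => W.elem x.1 x.2) (p, b) := by
  have h1 : ContMDiffAt (𝓘(ℝ, E).prod 𝓘(ℝ, Fin k → ℝ)) 𝓘(ℝ, ℝ × (E →L[ℝ] ℝ)) ∞
      (fun x : P × (Fin k → ℝ) => W.s x.1 x.2) (p, b) :=
    (ContMDiffAt.comp (p, b) (g := W.s) (f := Prod.fst)
      (W.contMDiffOn_s.contMDiffAt (W.isOpen.mem_nhds hp)) contMDiffAt_fst).clm_apply
      contMDiffAt_snd
  have h2 := (((jetCore E L).localTriv i).contMDiffOn_symm (IB := 𝓘(ℝ, E)) (n := ∞)).contMDiffAt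
    (x := (p, W.s p b)) (((jetCore E L).localTriv i).open_target.mem_nhds
      (((jetCore E L).localTriv i).mem_target.2 (W.subset hp)))
  have h3 := ContMDiffAt.comp (p, b) (f := fun x : P × (Fin k → ℝ) => (x.1, W.s x.1 x.2)) h2
    (contMDiffAt_fst.prodMk h1)
  refine h3.congr_of_eventuallyEq ?_
  filter_upwards [continuousAt_fst.eventually (W.isOpen.mem_nhds hp)] with x hx
  exact ((jetCore E L).localTriv i).mk_symm (W.subset hx) _

open Classical in
/-- The chart of `ker ρ` given by the coordinates of a flow model. -/
def coordChart : OpenPartialHomeomorph (kerAnchor J) (E × (Fin k → ℝ)) where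
  toFun α := (chartAt E i α.1.proj, W.coord α)
  -- Off the target the value is the zero element over i.
  invFun x := if h : (chartAt E i).symm x.1 ∈ W.U then
    ⟨W.elem ((chartAt E i).symm x.1) x.2, W.elem_mem h x.2⟩ else ⟨W.elem i 0, W.elem_mem W.mem 0⟩
  source := {α | α.1.proj ∈ W.U}
  target := {x | x.1 ∈ (chartAt E i).target ∩ (chartAt E i).symm ⁻¹' W.U}
  map_source' α hα := by
    have h := (W.subset hα).1
    refine ⟨(chartAt E i).map_source h, ?_⟩
    rw [mem_preimage, (chartAt E i).left_inv h]
    exact hα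
  map_target' x hx := by
    have h : (chartAt E i).symm x.1 ∈ W.U := hx.2
    rw [dif_pos h]
    exact h
  left_inv' α hα := by
    have h := (chartAt E i).left_inv (W.subset hα).1
    rw [dif_pos (by rw [h]; exact hα)]
    refine Subtype.ext ?_
    simp only [h]
    exact W.elem_coord α.2 hα
  right_inv' x hx := by
    have h : (chartAt E i).symm x.1 ∈ W.U := hx.2
    rw [dif_pos h]
    exact Prod.ext ((chartAt E i).right_inv hx.1) (W.coord_elem hx.2 _)
  open_source := W.isOpen.preimage ((FiberBundle.continuous_proj _ _).comp continuous_subtype_val)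
  open_target := ((chartAt E i).isOpen_inter_preimage_symm W.isOpen).preimage continuous_fst
  continuousOn_toFun := by
    intro α hα
    have h1 : ContinuousAt (fun α : kerAnchor J => chartAt E i α.1.proj) α :=
      ContinuousAt.comp (g := chartAt E i) ((chartAt E i).continuousAt (W.subset hα).1)
        ((FiberBundle.continuous_proj _ _).comp continuous_subtype_val).continuousAt
    have h2 : ContinuousAt (fun α : kerAnchor J => W.coord α) α :=
      ContinuousAt.comp (g := W.coord) (W.contMDiffAt_coord hα).continuousAt
        continuous_subtype_val.continuousAt
    exact (h1.prodMk h2).continuousWithinAt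
  continuousOn_invFun := by
    refine IsInducing.subtypeVal.continuousOn_iff.2 fun x hx => ?_
    have h1 : ContinuousAt (fun x : E × (Fin k → ℝ) => W.elem ((chartAt E i).symm x.1) x.2) x := by
      refine ContinuousAt.comp (g := fun x : P × (Fin k → ℝ) => W.elem x.1 x.2)
        (f := fun x : E × (Fin k → ℝ) => ((chartAt E i).symm x.1, x.2))
        (W.contMDiffAt_elem hx.2 x.2).continuousAt ?_
      exact (ContinuousAt.comp (g := (chartAt E i).symm)
        ((chartAt E i).continuousAt_symm hx.1) continuousAt_fst).prodMk continuousAt_snd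
    refine h1.continuousWithinAt.congr (fun y hy => ?_) ?_
    · simp [dif_pos (show (chartAt E i).symm y.1 ∈ W.U from hy.2)]
    · simp [dif_pos (show (chartAt E i).symm x.1 ∈ W.U from hx.2)]

theorem coe_coordChart_symm {x : E × (Fin k → ℝ)} (hx : x ∈ W.coordChart.target) :
    (W.coordChart.symm x : J1 E L) = W.elem ((chartAt E i).symm x.1) x.2 := by
  have h : (chartAt E i).symm x.1 ∈ W.U := hx.2
  exact congrArg Subtype.val (dif_pos h)

theorem isSmoothChart_coordChart [ChartedSpace (E × (Fin k → ℝ)) (kerAnchor J)]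
    [IsManifold 𝓘(ℝ, E × (Fin k → ℝ)) ∞ (kerAnchor J)]
    (he : IsSmoothEmbedding 𝓘(ℝ, E × (Fin k → ℝ)) (𝓘(ℝ, E).prod 𝓘(ℝ, ℝ × (E →L[ℝ] ℝ))) ∞
      (Subtype.val : kerAnchor J → J1 E L)) :
    IsSmoothChart (E := E × (Fin k → ℝ)) W.coordChart := by
  have hc := isSmoothChart_chartAt (E := E) i
  constructor
  · intro α hα
    have hα' : α.1.proj ∈ W.U := hα
    have h0 := he.contMDiff α
    have h1 : ContMDiffAt 𝓘(ℝ, E × (Fin k → ℝ)) 𝓘(ℝ, E) ∞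
        (fun α : kerAnchor J => chartAt E i α.1.proj) α :=
      ContMDiffAt.comp α (g := chartAt E i) (hc.contMDiffAt (W.subset hα').1)
        (ContMDiffAt.comp α (g := fun α : J1 E L => α.proj) (contMDiff_proj _ _) h0)
    have h2 : ContMDiffAt 𝓘(ℝ, E × (Fin k → ℝ)) 𝓘(ℝ, Fin k → ℝ) ∞
        (fun α : kerAnchor J => W.coord α) α :=
      ContMDiffAt.comp α (g := W.coord) (W.contMDiffAt_coord hα') h0
    exact (h1.prodMk_space h2).contMDiffWithinAt
  · intro x hx
    refine ContMDiffAt.contMDiffWithinAt ?_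
    -- A continuous map to ker ρ is smooth as soon as it is smooth into the jet bundle, because the
    -- inclusion is an immersion.
    refine (ContMDiffAt.iff_comp_isImmersionAt (he.isImmersion.isImmersionAt _)).2
      ⟨W.coordChart.continuousAt_symm hx, ?_⟩
    have h1 : ContMDiffAt 𝓘(ℝ, E × (Fin k → ℝ)) (𝓘(ℝ, E).prod 𝓘(ℝ, Fin k → ℝ)) ∞
        (fun x : E × (Fin k → ℝ) => ((chartAt E i).symm x.1, x.2)) x :=
      (ContMDiffAt.comp x (g := (chartAt E i).symm) (hc.contMDiffAt_symm hx.1)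
        contDiff_fst.contMDiff.contMDiffAt).prodMk contDiff_snd.contMDiff.contMDiffAt
    have h2 := ContMDiffAt.comp x (g := fun x : P × (Fin k → ℝ) => W.elem x.1 x.2)
      (W.contMDiffAt_elem hx.2 x.2) h1
    refine h2.congr_of_eventuallyEq ?_
    filter_upwards [W.coordChart.open_target.mem_nhds hx] with y hy using W.coe_coordChart_symm hy

end FlowModel

set_option synthInstance.maxHeartbeats 100000 in
/-- The kernel of the anchor is an embedded submanifold of the jet bundle. -/
theorem exists_kerAnchor_submanifold (hφ : IsContactIsotropicRealisation J C φ F)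
    (hk : Module.finrank ℝ E' = Module.finrank ℝ E + k) :
    ∃ _ : ChartedSpace (E × (Fin k → ℝ)) (kerAnchor J),
      IsManifold 𝓘(ℝ, E × (Fin k → ℝ)) ∞ (kerAnchor J) ∧
      IsSmoothEmbedding 𝓘(ℝ, E × (Fin k → ℝ)) (𝓘(ℝ, E).prod 𝓘(ℝ, ℝ × (E →L[ℝ] ℝ))) ∞
        (Subtype.val : kerAnchor J → J1 E L) := by
  have hI : range (𝓘(ℝ, E).prod 𝓘(ℝ, ℝ × (E →L[ℝ] ℝ))) = univ :=
    ModelWithCorners.range_eq_univ _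
  refine exists_submanifold (Fin (Module.finrank ℝ (ℝ × (E →L[ℝ] ℝ)) - k) → ℝ) hI ?_
  intro α hα
  obtain ⟨W⟩ := exists_flowModel hφ hk α.proj
  have hi : α.proj ∈ W.U := W.mem
  set A := (chartAt E α.proj).target ∩ (chartAt E α.proj).symm ⁻¹' W.U
  have hA : IsOpen A := (chartAt E α.proj).isOpen_inter_preimage_symm W.isOpen
  have hc := isSmoothChart_chartAt (E := E) α.proj
  have hs : ContDiffOn ℝ ∞ (fun e : E => W.s ((chartAt E α.proj).symm e)) A := by
    intro e he
    exact (contMDiffAt_iff_contDiffAt.1 (ContMDiffAt.comp e (g := W.s)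
      (W.contMDiffOn_s.contMDiffAt (W.isOpen.mem_nhds he.2))
      (hc.contMDiffAt_symm he.1))).contDiffWithinAt
  -- Over `W.U`, ker ρ is the family of the images of s p. Straightening moves all of them to the
  -- image of s at the centre, a fixed linear subspace, and so produces slice charts.
  set G := straighten W.Q _ (W.s α.proj) hA hs (fun e he => W.Q_s _ he.2) (W.Q_s _ hi) with hG
  have hGs := contDiffOn_straighten W.Q _ (W.s α.proj) hA hs (fun e he => W.Q_s _ he.2)
    (W.Q_s _ hi)
  have hG1 := contMDiffOn_modelProd hGs.1
  have hG2 := contMDiffOn_modelProd hGs.2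
  set D₀ := chartAt (ModelProd E (ℝ × (E →L[ℝ] ℝ))) α with hD₀
  have hD₀s := IsManifold.chart_mem_maximalAtlas (I := 𝓘(ℝ, E).prod 𝓘(ℝ, ℝ × (E →L[ℝ] ℝ))) (n := ∞) α
  let D : OpenPartialHomeomorph (J1 E L) (ModelProd E (ℝ × (E →L[ℝ] ℝ))) := D₀ ≫ₕ G
  have hD1 : ContMDiffOn (𝓘(ℝ, E).prod 𝓘(ℝ, ℝ × (E →L[ℝ] ℝ)))
      (𝓘(ℝ, E).prod 𝓘(ℝ, ℝ × (E →L[ℝ] ℝ))) ∞ D D.source :=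
    hG1.comp ((contMDiffOn_of_mem_maximalAtlas hD₀s).mono fun _ h => h.1) fun _ h => h.2
  have hD2 : ContMDiffOn (𝓘(ℝ, E).prod 𝓘(ℝ, ℝ × (E →L[ℝ] ℝ)))
      (𝓘(ℝ, E).prod 𝓘(ℝ, ℝ × (E →L[ℝ] ℝ))) ∞ D.symm D.target :=
    (contMDiffOn_symm_of_mem_maximalAtlas hD₀s).comp (hG2.mono fun _ h => h.1) fun _ h => h.2
  obtain ⟨g, hg⟩ := exists_complement_equiv W.Q (W.s α.proj) (W.Q_s _ hi)
    (r := Module.finrank ℝ (ℝ × (E →L[ℝ] ℝ)) - k) (by rw [Module.finrank_fin_fun])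
  have hDs (y : J1 E L) (hy : y.proj ∈ jetBaseSet E L α.proj) :
      y ∈ D.source ↔ y.proj ∈ W.U := by
    have h1 : D₀ y ∈ G.source ↔ chartAt E α.proj y.proj ∈ A := by
      rw [hD₀, chartAt_jet_eq]
      rfl
    have h2 : y ∈ D.source ↔ y ∈ D₀.source ∧ D₀ y ∈ G.source := Iff.rfl
    rw [h2, h1, hD₀, mem_chartAt_jet_source]
    have h3 := (chartAt E α.proj).left_inv hy.1
    refine ⟨fun h => ?_, fun h => ⟨hy, (chartAt E α.proj).map_source hy.1, ?_⟩⟩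
    · have h4 := h.2.2
      rwa [mem_preimage, h3] at h4
    · rwa [mem_preimage, h3]
  refine ⟨D, OpenPartialHomeomorph.mem_maximalAtlas_of_contMDiffOn D hD1 hD2,
    (ContinuousLinearEquiv.prodAssoc ℝ E (Fin k → ℝ) _).trans
      ((ContinuousLinearEquiv.refl ℝ E).prodCongr g.symm), ?_, ?_⟩
  · exact (hDs α (W.subset hi)).2 hi
  · intro y hy
    have hy0 : y.proj ∈ jetBaseSet E L α.proj := (mem_chartAt_jet_source α y).1 hy.1
    have hy1 : y.proj ∈ W.U := (hDs y hy0).1 hy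
    rw [W.mem_kerAnchor_iff y hy1]
    have h1 : D y = (chartAt E α.proj y.proj, jetCoord α.proj y -
        W.s y.proj (W.Q (jetCoord α.proj y)) + W.s α.proj (W.Q (jetCoord α.proj y))) := by
      have h2 : D y = G (D₀ y) := rfl
      rw [h2, hD₀, chartAt_jet_eq]
      refine Prod.ext rfl ?_
      simp only [hG, straighten, OpenPartialHomeomorph.coe_mk, (chartAt E α.proj).left_inv hy0.1]
    rw [h1]
    refine Iff.trans ?_ (hg (jetCoord α.proj y - W.s y.proj (W.Q (jetCoord α.proj y)) +
      W.s α.proj (W.Q (jetCoord α.proj y)))).symm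
    have h2 : W.Q (jetCoord α.proj y - W.s y.proj (W.Q (jetCoord α.proj y)) +
        W.s α.proj (W.Q (jetCoord α.proj y))) = W.Q (jetCoord α.proj y) := by
      rw [map_add, map_sub, W.Q_s _ hy1, W.Q_s _ hi]
      abel
    rw [h2, eq_comm (b := _ + _), add_eq_right, sub_eq_zero, eq_comm]

end KerAnchor

/-! ### Periods, the quotient relation and the flow from a section -/

section Period

variable {E : Type*} [NormedAddCommGroup E] [NormedSpace ℝ E] [FiniteDimensional ℝ E]
  {P : Type*} [TopologicalSpace P] [ChartedSpace E P] [IsManifold 𝓘(ℝ, E) ∞ P] [T2Space P]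
  {L : P → Type*} [TopologicalSpace (TotalSpace ℝ L)] [∀ p, TopologicalSpace (L p)]
  [∀ p, AddCommGroup (L p)] [∀ p, Module ℝ (L p)] [FiberBundle ℝ L] [VectorBundle ℝ ℝ L]
  [ContMDiffVectorBundle ∞ ℝ L 𝓘(ℝ, E)]
  {E' : Type*} [NormedAddCommGroup E'] [NormedSpace ℝ E'] [FiniteDimensional ℝ E']
  {M : Type*} [TopologicalSpace M] [ChartedSpace E' M] [IsManifold 𝓘(ℝ, E') ∞ M] [T2Space M]
  {L' : M → Type*} [TopologicalSpace (TotalSpace ℝ L')] [∀ m, TopologicalSpace (L' m)]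
  [∀ m, AddCommGroup (L' m)] [∀ m, Module ℝ (L' m)] [FiberBundle ℝ L'] [VectorBundle ℝ ℝ L']
  [∀ m, IsTopologicalAddGroup (L' m)] [∀ m, ContinuousSMul ℝ (L' m)]
  [ContMDiffVectorBundle ∞ ℝ L' 𝓘(ℝ, E')]
  {k : ℕ} {J : JacobiStructure E L} {C : ContactForm E' L'} {φ : M → P}
  {F : BundleComponent E L E' L' φ} {i : P}

namespace FlowModel

variable {W : FlowModel J C F k i}

theorem flow_sub_eq_iff (hφ : IsContactIsotropicRealisation J C φ F) {m : M} (hm : φ m ∈ W.U)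
    (b b' : Fin k → ℝ) : W.flow (b - b') m = m ↔ W.flow b m = W.flow b' m := by
  constructor
  · intro h
    have h1 := flow_add hφ hm b' (b - b')
    rwa [add_sub_cancel, h] at h1
  · intro h
    have h1 := flow_add hφ hm (-b') b
    rw [h, ← flow_add hφ hm, neg_add_cancel, flow_zero hφ hm, neg_add_eq_sub] at h1
    exact h1

/-- In a transitive abelian action all points have the same stabiliser. Hence a period can be tested
at a single point of the fibre. -/
theorem flow_eq_self_of_flow_eq_self (hφ : IsContactIsotropicRealisation J C φ F) {m m' : M}
    (hm : φ m ∈ W.U) (hm' : φ m' = φ m) {b : Fin k → ℝ} (h : W.flow b m = m) :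
    W.flow b m' = m' := by
  obtain ⟨c, rfl⟩ := exists_flow_eq (W := W) hφ hm hm'
  rw [← flow_add hφ hm, add_comm, flow_add hφ hm, h]

theorem flowsTo_iff_coord (hφ : IsContactIsotropicRealisation J C φ F) {α : J1 E L}
    (hα : α ∈ kerAnchor J) (hp : α.proj ∈ W.U) {m m' : M} (hm : φ m = α.proj) :
    FlowsTo C F α m m' ↔ m' = W.flow (W.coord α) m := by
  have h := flowsTo_iff (W := W) hφ (m := m) (m' := m') (hm.symm ▸ hp) (b := W.coord α)
  rwa [hm, W.elem_coord hα hp] at h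

theorem mem_periodLattice_iff (hφ : IsContactIsotropicRealisation J C φ F) {α : kerAnchor J}
    (hp : α.1.proj ∈ W.U) {m : M} (hm : φ m = α.1.proj) :
    α ∈ periodLattice J C F ↔ W.flow (W.coord α) m = m := by
  constructor
  · intro h
    exact ((flowsTo_iff_coord hφ α.2 hp hm).1 (h m hm)).symm
  · intro h m' hm'
    exact (flowsTo_iff_coord hφ α.2 hp hm').2
      (flow_eq_self_of_flow_eq_self hφ (hm ▸ hp) (hm'.trans hm.symm) h).symm

theorem jetCoord_sub {p : P} (hp : p ∈ jetBaseSet E L i) (a b : (jetCore E L).Fiber p) :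
    jetCoord i (⟨p, a - b⟩ : J1 E L) = jetCoord i (⟨p, a⟩ : J1 E L) - jetCoord i ⟨p, b⟩ :=
  (((jetCore E L).localTriv i).linear ℝ (b := p) hp).map_sub a b

theorem coord_sub {p : P} (hp : p ∈ W.U) (a b : (jetCore E L).Fiber p) :
    W.coord (⟨p, a - b⟩ : J1 E L) = W.coord (⟨p, a⟩ : J1 E L) - W.coord ⟨p, b⟩ := by
  rw [coord, jetCoord_sub (W.subset hp), map_sub]
  rfl

theorem sub_mem_kerAnchor {p : P} (hp : p ∈ W.U) {a b : (jetCore E L).Fiber p}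
    (ha : (⟨p, a⟩ : J1 E L) ∈ kerAnchor J) (hb : (⟨p, b⟩ : J1 E L) ∈ kerAnchor J) :
    (⟨p, a - b⟩ : J1 E L) ∈ kerAnchor J := by
  rw [W.mem_kerAnchor_iff _ hp] at ha hb ⊢
  rw [jetCoord_sub (W.subset hp), map_sub, map_sub, ha, hb]

/-- That a - b is a period means, by additivity of the flow, that a and b move one point m of the
fibre to the same place. -/
theorem periodRel_iff (hφ : IsContactIsotropicRealisation J C φ F) {α β : kerAnchor J}
    (hp : α.1.proj ∈ W.U) {m : M} (hm : φ m = α.1.proj) :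
    PeriodRel J C F α β ↔
      β.1.proj = α.1.proj ∧ W.flow (W.coord α) m = W.flow (W.coord β) m := by
  obtain ⟨⟨p, a⟩, hα⟩ := α
  obtain ⟨⟨p', b⟩, hβ⟩ := β
  have hm' : φ m ∈ W.U := hm ▸ hp
  constructor
  · rintro ⟨p₁, a₁, b₁, h1, h2, σ, hσ, hσ'⟩
    obtain rfl : p = p₁ := congrArg TotalSpace.proj h1
    obtain rfl : p' = p := congrArg TotalSpace.proj h2
    refine ⟨rfl, ?_⟩
    have h3 : σ.1.proj = p' := congrArg TotalSpace.proj hσ'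
    have h4 := (mem_periodLattice_iff (W := W) hφ (by rw [h3]; exact hp)
      (hm.trans h3.symm)).1 hσ
    rw [hσ', coord_sub hp, flow_sub_eq_iff hφ hm', ← h1, ← h2] at h4
    exact h4
  · rintro ⟨h1, h2⟩
    obtain rfl : p' = p := h1
    refine ⟨p', a, b, rfl, rfl, ⟨_, sub_mem_kerAnchor hp hα hβ⟩, ?_, rfl⟩
    refine (mem_periodLattice_iff (W := W) (α := ⟨⟨p', a - b⟩, sub_mem_kerAnchor hp hα hβ⟩)
      hφ hp hm).2 ?_
    rw [coord_sub hp, flow_sub_eq_iff hφ hm']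
    exact h2

end FlowModel

/-- Relative to a model and a point m over the base point, the relation is equality of base points
and of flow values, from which the axioms are inherited. -/
theorem equivalence_periodRel (hφ : IsContactIsotropicRealisation J C φ F)
    (hk : Module.finrank ℝ E' = Module.finrank ℝ E + k) : Equivalence (PeriodRel J C F) := by
  have key (α : kerAnchor J) : ∃ (W : FlowModel J C F k α.1.proj) (m : M), φ m = α.1.proj ∧
      ∀ β β' : kerAnchor J, β.1.proj = α.1.proj → (PeriodRel J C F β β' ↔
        β'.1.proj = α.1.proj ∧ W.flow (W.coord β) m = W.flow (W.coord β') m) := by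
    obtain ⟨W⟩ := exists_flowModel hφ hk α.1.proj
    obtain ⟨m, hm⟩ := hφ.surjective α.1.proj
    refine ⟨W, m, hm, fun β β' hβ => ?_⟩
    rw [FlowModel.periodRel_iff (W := W) hφ (hβ.symm ▸ W.mem) (hm.trans hβ.symm), hβ]
  refine ⟨fun α => ?_, fun {α β} h => ?_, fun {α β γ} h h' => ?_⟩
  · obtain ⟨W, m, -, h⟩ := key α
    exact (h α α rfl).2 ⟨rfl, rfl⟩
  · obtain ⟨W, m, -, h1⟩ := key α
    obtain ⟨h2, h3⟩ := (h1 α β rfl).1 h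
    exact (h1 β α h2).2 ⟨rfl, h3.symm⟩
  · obtain ⟨W, m, -, h1⟩ := key α
    obtain ⟨h2, h3⟩ := (h1 α β rfl).1 h
    obtain ⟨h4, h5⟩ := (h1 β γ h2).1 h'
    exact (h1 α γ rfl).2 ⟨h4, h3.trans h5⟩

theorem quotMk_eq_iff (hφ : IsContactIsotropicRealisation J C φ F)
    (hk : Module.finrank ℝ E' = Module.finrank ℝ E + k) {W : FlowModel J C F k i}
    {α β : kerAnchor J} (hp : α.1.proj ∈ W.U) {m : M} (hm : φ m = α.1.proj) :
    (Quot.mk (PeriodRel J C F) α = Quot.mk (PeriodRel J C F) β) ↔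
      β.1.proj = α.1.proj ∧ W.flow (W.coord α) m = W.flow (W.coord β) m := by
  rw [Quot.eq, (equivalence_periodRel hφ hk).eqvGen_iff, FlowModel.periodRel_iff hφ hp hm]

namespace FlowModel

/-- The time-one flow of `α` starting at the value of `σ`. -/
def flowFrom (W : FlowModel J C F k i) (σ : P → M) (α : kerAnchor J) : M :=
  W.flow (W.coord α) (σ α.1.proj)

variable {W : FlowModel J C F k i}

variable [ChartedSpace (E × (Fin k → ℝ)) (kerAnchor J)]
    [IsManifold 𝓘(ℝ, E × (Fin k → ℝ)) ∞ (kerAnchor J)]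

theorem continuous_proj_kerAnchor : Continuous fun α : kerAnchor J => α.1.proj :=
  (FiberBundle.continuous_proj _ _).comp continuous_subtype_val

/-- The flow from a section is a local diffeomorphism. -/
theorem exists_flowFrom_localInverse (hφ : IsContactIsotropicRealisation J C φ F)
    (he : IsSmoothEmbedding 𝓘(ℝ, E × (Fin k → ℝ)) (𝓘(ℝ, E).prod 𝓘(ℝ, ℝ × (E →L[ℝ] ℝ))) ∞
      (Subtype.val : kerAnchor J → J1 E L))
    {U : Set P} (hU : IsOpen U) {σ : P → M} (hσ : ContMDiffOn 𝓘(ℝ, E) 𝓘(ℝ, E') ∞ σ U)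
    (hσφ : ∀ p ∈ U, φ (σ p) = p) {α₀ : kerAnchor J} (h0 : α₀.1.proj ∈ W.U) (h0' : α₀.1.proj ∈ U) :
    ∃ A : OpenPartialHomeomorph (kerAnchor J) M, α₀ ∈ A.source ∧
      (∀ α ∈ A.source, α.1.proj ∈ W.U ∧ α.1.proj ∈ U ∧ A α = W.flowFrom σ α) ∧
      ContMDiffOn 𝓘(ℝ, E × (Fin k → ℝ)) 𝓘(ℝ, E') ∞ A A.source ∧
      ContMDiffOn 𝓘(ℝ, E') 𝓘(ℝ, E × (Fin k → ℝ)) ∞ A.symm A.target := by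
  set p₀ := α₀.1.proj
  set b₀ := W.coord α₀ with hb₀
  have hm₀ : φ (W.flow b₀ (σ p₀)) ∈ W.U := by
    rw [map_flow hφ (by rw [hσφ _ h0']; exact h0), hσφ _ h0']
    exact h0
  obtain ⟨Θ, hmΘ, hΘ⟩ := W.exists_isFlowChart hm₀
  obtain ⟨r, hr, hr'⟩ := Metric.isOpen_iff.1 Θ.open_target _ (Θ.map_source hmΘ)
  -- the translated section
  set τ : P → M := fun p => W.flow b₀ (σ p) with hτ
  have hτs {p : P} (hp : p ∈ W.U ∩ U) : ContMDiffAt 𝓘(ℝ, E) 𝓘(ℝ, E') ∞ τ p :=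
    ContMDiffAt.comp p (g := fun x : M × (Fin k → ℝ) => W.flow x.2 x.1) (f := fun p => (σ p, b₀))
      (contMDiffAt_flow hφ (by rw [hσφ p hp.2]; exact hp.1) b₀)
      ((hσ.contMDiffAt (hU.mem_nhds hp.2)).prodMk contMDiffAt_const)
  have hτφ {p : P} (hp : p ∈ W.U ∩ U) : φ (τ p) = p := by
    rw [hτ, map_flow hφ (by rw [hσφ p hp.2]; exact hp.1), hσφ p hp.2]
  have hc := isSmoothChart_chartAt (E := E) i
  set A₁ := (chartAt E i).target ∩ (chartAt E i).symm ⁻¹' (W.U ∩ U)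
  have hA₁ : IsOpen A₁ := (chartAt E i).isOpen_inter_preimage_symm (W.isOpen.inter hU)
  have hτc : ContMDiffOn 𝓘(ℝ, E) 𝓘(ℝ, E') ∞ (τ ∘ (chartAt E i).symm) A₁ := fun e he' =>
    (ContMDiffAt.comp e (hτs he'.2) (hc.contMDiffAt_symm he'.1)).contMDiffWithinAt
  set A₂ := A₁ ∩ (τ ∘ (chartAt E i).symm) ⁻¹' Θ.source
  have hA₂ : IsOpen A₂ := hτc.continuousOn.isOpen_inter_preimage hA₁ Θ.open_source
  -- In Θ the point reached is Θ(τ p) + (0, b - b₀), whose fibre coordinate is b + c. The flow from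
  -- σ is thus a shear between two charts.
  set c : E → (Fin k → ℝ) := fun e => (Θ (τ ((chartAt E i).symm e))).2 - b₀ with hcdef
  have hcs : ContDiffOn ℝ ∞ c A₂ := by
    intro e he'
    have h1 : ContMDiffAt 𝓘(ℝ, E) 𝓘(ℝ, E × (Fin k → ℝ)) ∞ (Θ ∘ (τ ∘ (chartAt E i).symm)) e :=
      ContMDiffAt.comp e (hΘ.contMDiffAt he'.2) (hτc.contMDiffAt (hA₁.mem_nhds he'.1))
    exact ((contDiff_snd.contDiffAt.comp e (contMDiffAt_iff_contDiffAt.1 h1)).sub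
      contDiffAt_const).contDiffWithinAt
  have hsm : IsSmoothChart (E := E × (Fin k → ℝ)) (W.coordChart ≫ₕ shear hA₂ hcs) :=
    (W.isSmoothChart_coordChart he).trans (contDiffOn_shear hA₂ hcs).1 (contDiffOn_shear hA₂ hcs).2
  set A' : OpenPartialHomeomorph (kerAnchor J) M := (W.coordChart ≫ₕ shear hA₂ hcs) ≫ₕ Θ.symm
    with hA'
  -- Moving the centre and the translation each use at most r/2, so the endpoint stays in the ball
  -- of radius r.
  set O : Set (kerAnchor J) := {α | α.1.proj ∈ W.U ∩ U ∧ τ α.1.proj ∈ Θ.source ∧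
    Θ (τ α.1.proj) ∈ Metric.ball (Θ (τ p₀)) (r / 2) ∧ ‖W.coord α - b₀‖ < r / 2} with hO
  have hO₀ : O ∈ 𝓝 α₀ := by
    have hp := continuous_proj_kerAnchor.continuousAt (x := α₀)
    have hτp : ContinuousAt (fun α : kerAnchor J => τ α.1.proj) α₀ :=
      ContinuousAt.comp (g := τ) (hτs ⟨h0, h0'⟩).continuousAt hp
    have h1 := hp.eventually ((W.isOpen.inter hU).mem_nhds ⟨h0, h0'⟩)
    have h2 := hτp.eventually (Θ.open_source.mem_nhds hmΘ)
    have h3 : ContinuousAt (fun α : kerAnchor J => Θ (τ α.1.proj)) α₀ :=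
      ContinuousAt.comp (g := Θ) (Θ.continuousAt hmΘ) hτp
    have h3' := h3.eventually (Metric.isOpen_ball.mem_nhds
      (Metric.mem_ball_self (half_pos hr) : Θ (τ p₀) ∈ Metric.ball (Θ (τ p₀)) (r / 2)))
    have h4 : ContinuousAt (fun α : kerAnchor J => ‖W.coord α - b₀‖) α₀ :=
      ((ContinuousAt.comp (g := W.coord) (W.contMDiffAt_coord h0).continuousAt
        continuous_subtype_val.continuousAt).sub continuousAt_const).norm
    have h4' := h4.eventually (gt_mem_nhds (by simpa [hb₀] using half_pos hr :
      ‖W.coord α₀ - b₀‖ < r / 2))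
    filter_upwards [h1, h2, h3', h4'] with α a1 a2 a3 a4 using ⟨a1, a2, a3, a4⟩
  have key {α : kerAnchor J} (hα : α ∈ O) : W.coordChart α ∈ (shear hA₂ hcs).source ∧
      shear hA₂ hcs (W.coordChart α) ∈ Θ.target ∧ A' α = W.flowFrom σ α := by
    obtain ⟨hα1, hα2, hα3, hα4⟩ := hα
    have e0 : (chartAt E i).symm (chartAt E i α.1.proj) = α.1.proj :=
      (chartAt E i).left_inv (W.subset hα1.1).1
    have e1 : shear hA₂ hcs (W.coordChart α) =
        Θ (τ α.1.proj) + (0, W.coord α - b₀) := by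
      refine Prod.ext ?_ ?_
      · change chartAt E i α.1.proj = (Θ (τ α.1.proj)).1 + 0
        rw [hΘ.fst_eq _ hα2, hτφ hα1, add_zero]
      · change W.coord α + ((Θ (τ ((chartAt E i).symm (chartAt E i α.1.proj)))).2 - b₀) =
          (Θ (τ α.1.proj)).2 + (W.coord α - b₀)
        rw [e0]
        abel
    have e2 : Metric.ball (Θ (τ α.1.proj)) (r / 2) ⊆ Θ.target := by
      refine subset_trans (fun x hx => ?_) hr'
      rw [Metric.mem_ball] at hx hα3 ⊢
      linarith [dist_triangle x (Θ (τ α.1.proj)) (Θ (τ p₀))]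
    have e3 : W.coordChart α ∈ (shear hA₂ hcs).source := by
      refine ⟨⟨(chartAt E i).map_source (W.subset hα1.1).1, ?_⟩, ?_⟩
      · change (chartAt E i).symm (chartAt E i α.1.proj) ∈ W.U ∩ U
        rw [e0]
        exact hα1
      · change τ ((chartAt E i).symm (chartAt E i α.1.proj)) ∈ Θ.source
        rw [e0]
        exact hα2
    refine ⟨e3, ?_, ?_⟩
    · rw [e1]
      refine e2 ?_
      rw [mem_ball_iff_norm, add_sub_cancel_left]
      simpa [hr] using hα4
    · have e4 := hΘ.flow_eq hφ hα2 e2 hα4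
      have e5 : W.flow (W.coord α - b₀) (τ α.1.proj) = W.flowFrom σ α := by
        rw [hτ, ← flow_add hφ (by rw [hσφ _ hα1.2]; exact hα1.1), sub_add_cancel]
        rfl
      rw [← e5, e4, ← e1]
      rfl
  refine ⟨A'.restr O, ?_, ?_, ?_, ?_⟩
  · rw [OpenPartialHomeomorph.restr_source]
    obtain ⟨a1, a2, -⟩ := key (mem_of_mem_nhds hO₀)
    exact ⟨⟨⟨h0, a1⟩, a2⟩, mem_interior_iff_mem_nhds.2 hO₀⟩
  · intro α hα
    rw [OpenPartialHomeomorph.restr_source] at hα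
    have h := interior_subset hα.2
    exact ⟨h.1.1, h.1.2, (key h).2.2⟩
  · refine ContMDiffOn.mono (s := A'.source) ?_ fun α hα => hα.1
    exact hΘ.contMDiffOn_symm.comp (hsm.contMDiffOn.mono fun _ h => h.1) fun _ h => h.2
  · refine ContMDiffOn.mono (s := A'.target) ?_ fun α hα => hα.1
    exact hsm.contMDiffOn_symm.comp (hΘ.contMDiffOn.mono fun _ h => h.1) fun _ h => h.2

end FlowModel

end Period

theorem IsSmoothChart.mem_maximalAtlas {V : Type*} [NormedAddCommGroup V] [NormedSpace ℝ V]
    {N : Type*} [TopologicalSpace N] [ChartedSpace V N] [IsManifold 𝓘(ℝ, V) ∞ N]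
    {D : OpenPartialHomeomorph N V} (hD : IsSmoothChart (E := V) D) :
    D ∈ IsManifold.maximalAtlas 𝓘(ℝ, V) ∞ N :=
  OpenPartialHomeomorph.mem_maximalAtlas_of_contMDiffOn D hD.contMDiffOn hD.contMDiffOn_symm

/-- A function is smooth if its composition with a local diffeomorphism is. -/
theorem contMDiffAt_of_comp_isLocalDiffeomorphAt {V : Type*} [NormedAddCommGroup V]
    [NormedSpace ℝ V] {N : Type*} [TopologicalSpace N] [ChartedSpace V N]
    {Q : Type*} [TopologicalSpace Q] [ChartedSpace V Q] {q : N → Q} {a : N}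
    {Y G X : Type*} [NormedAddCommGroup Y] [NormedSpace ℝ Y] [TopologicalSpace G]
    {I : ModelWithCorners ℝ Y G} [TopologicalSpace X] [ChartedSpace G X] {f : Q → X}
    (hq : IsLocalDiffeomorphAt 𝓘(ℝ, V) 𝓘(ℝ, V) ∞ q a)
    (hf : ContMDiffAt 𝓘(ℝ, V) I ∞ (f ∘ q) a) : ContMDiffAt 𝓘(ℝ, V) I ∞ f (q a) := by
  obtain ⟨T, ha, hT⟩ := hq
  have h1 : q a ∈ T.target := by
    rw [hT ha]
    exact T.map_source ha
  have h2 : T.symm (q a) = a := by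
    rw [hT ha]
    exact T.left_inv ha
  have h3 : ContMDiffAt 𝓘(ℝ, V) 𝓘(ℝ, V) ∞ T.symm (q a) :=
    T.contMDiffOn_invFun.contMDiffAt (T.open_target.mem_nhds h1)
  have h4 := ContMDiffAt.comp (q a) (g := f ∘ q) (by rw [h2]; exact hf) h3
  refine h4.congr_of_eventuallyEq ?_
  filter_upwards [T.open_target.mem_nhds h1] with y hy
  have h5 : q (T.symm y) = y := (hT (T.map_target hy)).trans (T.right_inv hy)
  exact congrArg f h5.symm

/-! ### The period lattice as a submanifold and the quotient manifold -/

section Period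

variable {E : Type*} [NormedAddCommGroup E] [NormedSpace ℝ E] [FiniteDimensional ℝ E]
  {P : Type*} [TopologicalSpace P] [ChartedSpace E P] [IsManifold 𝓘(ℝ, E) ∞ P] [T2Space P]
  {L : P → Type*} [TopologicalSpace (TotalSpace ℝ L)] [∀ p, TopologicalSpace (L p)]
  [∀ p, AddCommGroup (L p)] [∀ p, Module ℝ (L p)] [FiberBundle ℝ L] [VectorBundle ℝ ℝ L]
  [ContMDiffVectorBundle ∞ ℝ L 𝓘(ℝ, E)]
  {E' : Type*} [NormedAddCommGroup E'] [NormedSpace ℝ E'] [FiniteDimensional ℝ E']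
  {M : Type*} [TopologicalSpace M] [ChartedSpace E' M] [IsManifold 𝓘(ℝ, E') ∞ M] [T2Space M]
  {L' : M → Type*} [TopologicalSpace (TotalSpace ℝ L')] [∀ m, TopologicalSpace (L' m)]
  [∀ m, AddCommGroup (L' m)] [∀ m, Module ℝ (L' m)] [FiberBundle ℝ L'] [VectorBundle ℝ ℝ L']
  [∀ m, IsTopologicalAddGroup (L' m)] [∀ m, ContinuousSMul ℝ (L' m)]
  [ContMDiffVectorBundle ∞ ℝ L' 𝓘(ℝ, E')]
  {k : ℕ} {J : JacobiStructure E L} {C : ContactForm E' L'} {φ : M → P}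
  {F : BundleComponent E L E' L' φ} {i : P}

namespace FlowModel

/-- A flow chart reads φ as the projection to E, so fixing the fibre coordinate gives a section. -/
theorem exists_localSection (hφ : IsContactIsotropicRealisation J C φ F)
    (W : FlowModel J C F k i) {p₀ : P} (hp₀ : p₀ ∈ W.U) : ∃ (U : Set P) (σ : P → M), IsOpen U ∧
      p₀ ∈ U ∧ ContMDiffOn 𝓘(ℝ, E) 𝓘(ℝ, E') ∞ σ U ∧ ∀ p ∈ U, φ (σ p) = p := by
  obtain ⟨m₀, rfl⟩ := hφ.surjective p₀
  obtain ⟨Θ, h1, hΘ⟩ := W.exists_isFlowChart hp₀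
  have hc := isSmoothChart_chartAt (E := E) i
  have hg : Continuous fun e : E => (e, (Θ m₀).2) := by fun_prop
  refine ⟨(chartAt E i).source ∩ chartAt E i ⁻¹' ((fun e : E => (e, (Θ m₀).2)) ⁻¹' Θ.target),
    fun p => Θ.symm (chartAt E i p, (Θ m₀).2),
    (chartAt E i).isOpen_inter_preimage (Θ.open_target.preimage hg),
    ⟨(W.subset hp₀).1, ?_⟩, ?_, ?_⟩
  · change (chartAt E i (φ m₀), (Θ m₀).2) ∈ Θ.target
    rw [← hΘ.fst_eq _ h1]
    exact Θ.map_source h1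
  · intro p hp
    have h2 : ContMDiffAt 𝓘(ℝ, E) 𝓘(ℝ, E × (Fin k → ℝ)) ∞
        (fun p => (chartAt E i p, (Θ m₀).2)) p :=
      (hc.contMDiffAt hp.1).prodMk_space contMDiffAt_const
    exact (ContMDiffAt.comp p (g := Θ.symm) (hΘ.contMDiffAt_symm hp.2) h2).contMDiffWithinAt
  · intro p hp
    have h2 := Θ.map_target hp.2
    have h3 := hΘ.fst_eq _ h2
    rw [Θ.right_inv hp.2] at h3
    exact ((chartAt E i).injOn hp.1 (W.subset (hΘ.mem_U _ h2)).1 h3).symm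

variable {W : FlowModel J C F k i}

theorem continuousAt_coordChart_symm {p : P} (hp : p ∈ W.U) (b : Fin k → ℝ) :
    ContinuousAt (fun x : P × (Fin k → ℝ) => W.coordChart.symm (chartAt E i x.1, x.2)) (p, b) := by
  have h : (chartAt E i p, b) ∈ W.coordChart.target := by
    refine ⟨(chartAt E i).map_source (W.subset hp).1, ?_⟩
    rw [mem_preimage, (chartAt E i).left_inv (W.subset hp).1]
    exact hp
  exact ContinuousAt.comp (g := W.coordChart.symm)
    (f := fun x : P × (Fin k → ℝ) => (chartAt E i x.1, x.2)) (W.coordChart.continuousAt_symm h)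
    ((ContinuousAt.comp (g := chartAt E i) ((chartAt E i).continuousAt (W.subset hp).1)
      continuousAt_fst).prodMk continuousAt_snd)

theorem coe_coordChart_symm_chartAt {p : P} (hp : p ∈ W.U) (b : Fin k → ℝ) :
    (W.coordChart.symm (chartAt E i p, b) : J1 E L) = W.elem p b := by
  have h0 := (chartAt E i).left_inv (W.subset hp).1
  rw [W.coe_coordChart_symm, h0]
  refine ⟨(chartAt E i).map_source (W.subset hp).1, ?_⟩
  rw [mem_preimage, h0]
  exact hp

theorem map_flowFrom (hφ : IsContactIsotropicRealisation J C φ F) {σ : P → M} {α : kerAnchor J}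
    (hp : α.1.proj ∈ W.U) (hσ : φ (σ α.1.proj) = α.1.proj) : φ (W.flowFrom σ α) = α.1.proj := by
  rw [flowFrom, map_flow hφ (by rw [hσ]; exact hp), hσ]

variable [ChartedSpace (E × (Fin k → ℝ)) (kerAnchor J)]
    [IsManifold 𝓘(ℝ, E × (Fin k → ℝ)) ∞ (kerAnchor J)]

/-- Near one of its elements the period lattice is the graph of a smooth function. -/
theorem exists_period_function (hφ : IsContactIsotropicRealisation J C φ F)
    (he : IsSmoothEmbedding 𝓘(ℝ, E × (Fin k → ℝ)) (𝓘(ℝ, E).prod 𝓘(ℝ, ℝ × (E →L[ℝ] ℝ))) ∞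
      (Subtype.val : kerAnchor J → J1 E L))
    {U : Set P} (hU : IsOpen U) {σ : P → M} (hσ : ContMDiffOn 𝓘(ℝ, E) 𝓘(ℝ, E') ∞ σ U)
    (hσφ : ∀ p ∈ U, φ (σ p) = p) {p₀ : P} (h0 : p₀ ∈ W.U) (h0' : p₀ ∈ U) {b₀ : Fin k → ℝ}
    (hb₀ : W.flow b₀ (σ p₀) = σ p₀) :
    ∃ (μ : P → Fin k → ℝ) (O : Set P), IsOpen O ∧ p₀ ∈ O ∧ O ⊆ W.U ∩ U ∧
      ContMDiffOn 𝓘(ℝ, E) 𝓘(ℝ, Fin k → ℝ) ∞ μ O ∧ μ p₀ = b₀ ∧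
      (∀ p ∈ O, W.flow (μ p) (σ p) = σ p) ∧
      ∀ᶠ x : P × (Fin k → ℝ) in 𝓝 (p₀, b₀), W.flow x.2 (σ x.1) = σ x.1 → x.2 = μ x.1 := by
  set α₀ : kerAnchor J := W.coordChart.symm (chartAt E i p₀, b₀) with hα₀
  have hα₀' : (α₀ : J1 E L) = W.elem p₀ b₀ := coe_coordChart_symm_chartAt h0 b₀
  have hp₀ : α₀.1.proj = p₀ := congrArg TotalSpace.proj hα₀'
  have hc₀ : W.coord α₀ = b₀ := by rw [hα₀', W.coord_elem h0]
  obtain ⟨A, hA0, hA, hAs, hAs'⟩ := exists_flowFrom_localInverse (W := W) hφ he hU hσ hσφ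
    (α₀ := α₀) (hp₀.symm ▸ h0) (hp₀.symm ▸ h0')
  have hA₀ : A α₀ = σ p₀ := by
    rw [(hA _ hA0).2.2, flowFrom, hc₀, hp₀, hb₀]
  have hσo : IsOpen (U ∩ σ ⁻¹' A.target) := hσ.continuousOn.isOpen_inter_preimage hU A.open_target
  have hpr {p : P} (hp : p ∈ U ∩ σ ⁻¹' A.target) : (A.symm (σ p)).1.proj = p ∧
      W.flowFrom σ (A.symm (σ p)) = σ p := by
    have h1 := hA _ (A.map_target hp.2)
    have h2 : W.flowFrom σ (A.symm (σ p)) = σ p := by rw [← h1.2.2, A.right_inv hp.2]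
    refine ⟨?_, h2⟩
    have h3 := map_flowFrom hφ h1.1 (hσφ _ h1.2.1)
    rw [← h3, h2, hσφ p hp.1]
  have hOU : U ∩ σ ⁻¹' A.target ⊆ W.U ∩ U := fun p hp =>
    ⟨by rw [← (hpr hp).1]; exact (hA _ (A.map_target hp.2)).1, hp.1⟩
  have hp₀O : p₀ ∈ U ∩ σ ⁻¹' A.target := ⟨h0', by rw [mem_preimage, ← hA₀]; exact A.map_source hA0⟩
  -- Periods are the elements that the flow from σ sends back to σ. Their coordinates near b₀ are
  -- found by applying the local inverse to σ.
  refine ⟨fun p => W.coord (A.symm (σ p)), U ∩ σ ⁻¹' A.target, hσo, hp₀O, hOU, ?_, ?_, ?_, ?_⟩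
  · intro p hp
    have h1 := hAs'.contMDiffAt (A.open_target.mem_nhds hp.2)
    have h2 := ContMDiffAt.comp p (g := A.symm) h1 (hσ.contMDiffAt (hU.mem_nhds hp.1))
    have h3 := ContMDiffAt.comp p (g := (Subtype.val : kerAnchor J → J1 E L)) (he.contMDiff _) h2
    exact (ContMDiffAt.comp p (g := W.coord) (W.contMDiffAt_coord
      (hA _ (A.map_target hp.2)).1) h3).contMDiffWithinAt
  · change W.coord (A.symm (σ p₀)) = b₀
    rw [← hA₀, A.left_inv hA0, hc₀]
  · intro p hp
    have h := (hpr hp).2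
    rwa [flowFrom, (hpr hp).1] at h
  · have h1 := (continuousAt_coordChart_symm h0 b₀).eventually (A.open_source.mem_nhds hA0)
    have h2 : ∀ᶠ x : P × (Fin k → ℝ) in 𝓝 (p₀, b₀), x.1 ∈ U ∩ σ ⁻¹' A.target :=
      continuousAt_fst.eventually (hσo.mem_nhds hp₀O)
    filter_upwards [h1, h2] with x hx1 hx2 hx
    have h3 := coe_coordChart_symm_chartAt (W := W) (hOU hx2).1 x.2
    have h4 : A (W.coordChart.symm (chartAt E i x.1, x.2)) = σ x.1 := by
      rw [(hA _ hx1).2.2, flowFrom, h3, W.coord_elem (hOU hx2).1]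
      exact hx
    rw [← h4, A.left_inv hx1, h3, W.coord_elem (hOU hx2).1]

end FlowModel

variable [ChartedSpace (E × (Fin k → ℝ)) (kerAnchor J)]
    [IsManifold 𝓘(ℝ, E × (Fin k → ℝ)) ∞ (kerAnchor J)]

/-- Locally Σ is the coincidence set of two continuous maps to the Hausdorff space M, the flow from
a section and the section itself. -/
theorem isClosed_periodLattice (hφ : IsContactIsotropicRealisation J C φ F)
    (hk : Module.finrank ℝ E' = Module.finrank ℝ E + k)
    (he : IsSmoothEmbedding 𝓘(ℝ, E × (Fin k → ℝ)) (𝓘(ℝ, E).prod 𝓘(ℝ, ℝ × (E →L[ℝ] ℝ))) ∞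
      (Subtype.val : kerAnchor J → J1 E L)) : IsClosed (periodLattice J C F) := by
  rw [← isOpen_compl_iff, isOpen_iff_mem_nhds]
  intro α hα
  obtain ⟨W⟩ := exists_flowModel hφ hk α.1.proj
  obtain ⟨U, σ, hU, hpU, hσ, hσφ⟩ := W.exists_localSection hφ W.mem
  obtain ⟨A, hA0, hA, hAs, -⟩ := FlowModel.exists_flowFrom_localInverse (W := W) hφ he hU hσ hσφ
    (α₀ := α) W.mem hpU
  have h1 : A α ≠ σ α.1.proj := by
    rw [(hA _ hA0).2.2]
    exact fun h => hα ((FlowModel.mem_periodLattice_iff (W := W) hφ W.mem (hσφ _ hpU)).2 h)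
  have h2 : ContinuousAt (fun α : kerAnchor J => σ α.1.proj) α :=
    ContinuousAt.comp (g := σ) (hσ.continuousOn.continuousAt (hU.mem_nhds hpU))
      FlowModel.continuous_proj_kerAnchor.continuousAt
  have h4 : ∀ᶠ β in 𝓝 α, A β ≠ σ β.1.proj := by
    have h5 := ((A.continuousAt hA0).prodMk h2).eventually
      (isClosed_diagonal.isOpen_compl.mem_nhds (show (A α, σ α.1.proj) ∈ (diagonal M)ᶜ from h1))
    filter_upwards [h5] with β hβ using hβ
  filter_upwards [h4, A.open_source.mem_nhds hA0] with
    β hβ hβA hβ'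
  have h3 := hA _ hβA
  exact hβ (h3.2.2.trans ((FlowModel.mem_periodLattice_iff (W := W) hφ h3.1
    (hσφ _ h3.2.1)).1 hβ'))

/-- The period lattice is an embedded submanifold. -/
theorem exists_periodLattice_submanifold (hφ : IsContactIsotropicRealisation J C φ F)
    (hk : Module.finrank ℝ E' = Module.finrank ℝ E + k)
    (he : IsSmoothEmbedding 𝓘(ℝ, E × (Fin k → ℝ)) (𝓘(ℝ, E).prod 𝓘(ℝ, ℝ × (E →L[ℝ] ℝ))) ∞
      (Subtype.val : kerAnchor J → J1 E L)) :
    ∃ _ : ChartedSpace E (periodLattice J C F), IsManifold 𝓘(ℝ, E) ∞ (periodLattice J C F) ∧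
      IsSmoothEmbedding 𝓘(ℝ, E) 𝓘(ℝ, E × (Fin k → ℝ)) ∞
        (Subtype.val : periodLattice J C F → kerAnchor J) := by
  refine exists_submanifold (Fin k → ℝ) (ModelWithCorners.range_eq_univ _) ?_
  intro α₀ hα₀
  obtain ⟨W⟩ := exists_flowModel hφ hk α₀.1.proj
  obtain ⟨U, σ, hU, hpU, hσ, hσφ⟩ := W.exists_localSection hφ W.mem
  obtain ⟨μ, O, hO, hpO, hOU, hμ, hμ0, hμp, hμu⟩ := FlowModel.exists_period_function (W := W) hφ he
    hU hσ hσφ W.mem hpU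
    ((FlowModel.mem_periodLattice_iff (W := W) hφ W.mem (hσφ _ hpU)).1 hα₀)
  have hc := isSmoothChart_chartAt (E := E) α₀.1.proj
  set A := (chartAt E α₀.1.proj).target ∩ (chartAt E α₀.1.proj).symm ⁻¹' O
  have hA : IsOpen A := (chartAt E α₀.1.proj).isOpen_inter_preimage_symm hO
  have hs : ContDiffOn ℝ ∞ (fun e : E => -μ ((chartAt E α₀.1.proj).symm e)) A := by
    intro e he'
    exact (contMDiffAt_iff_contDiffAt.1 (ContMDiffAt.comp e (g := μ)
      (hμ.contMDiffAt (hO.mem_nhds he'.2)) (hc.contMDiffAt_symm he'.1))).neg.contDiffWithinAt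
  -- Subtracting the period function from the fibre coordinate turns Σ into the zero slice.
  have hsm := (W.isSmoothChart_coordChart he).trans (contDiffOn_shear hA hs).1
    (contDiffOn_shear hA hs).2
  have hcont : ContinuousAt (fun α : kerAnchor J => (α.1.proj, W.coord α)) α₀ :=
    FlowModel.continuous_proj_kerAnchor.continuousAt.prodMk
      (ContinuousAt.comp (g := W.coord) (W.contMDiffAt_coord W.mem).continuousAt
        continuous_subtype_val.continuousAt)
  have hN : {α : kerAnchor J | α.1.proj ∈ O ∧ (W.flow (W.coord α) (σ α.1.proj) = σ α.1.proj →
      W.coord α = μ α.1.proj)} ∈ 𝓝 α₀ := by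
    filter_upwards [hcont.eventually hμu,
      FlowModel.continuous_proj_kerAnchor.continuousAt.eventually (hO.mem_nhds hpO)] with α h1 h2
    exact ⟨h2, h1⟩
  -- Restriction to where the period near b₀ is unique excludes the other sheets of Σ.
  refine ⟨_, (hsm.restr {α : kerAnchor J | α.1.proj ∈ O ∧
    (W.flow (W.coord α) (σ α.1.proj) = σ α.1.proj → W.coord α = μ α.1.proj)}).mem_maximalAtlas,
    ContinuousLinearEquiv.refl ℝ _, ?_, ?_⟩
  · rw [OpenPartialHomeomorph.restr_source]
    refine ⟨⟨W.mem, (chartAt E α₀.1.proj).map_source (mem_chart_source E _), ?_⟩,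
      mem_interior_iff_mem_nhds.2 hN⟩
    change (chartAt E α₀.1.proj).symm (chartAt E α₀.1.proj α₀.1.proj) ∈ O
    rw [(chartAt E α₀.1.proj).left_inv (mem_chart_source E _)]
    exact hpO
  · intro α hα
    rw [OpenPartialHomeomorph.restr_source] at hα
    obtain ⟨h1, h2⟩ := interior_subset hα.2
    have h3 : α.1.proj ∈ W.U := (hOU h1).1
    have h4 : W.coord α + -μ ((chartAt E α₀.1.proj).symm (chartAt E α₀.1.proj α.1.proj)) =
        W.coord α - μ α.1.proj := by
      rw [(chartAt E α₀.1.proj).left_inv (W.subset h3).1, sub_eq_add_neg]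
    rw [FlowModel.mem_periodLattice_iff (W := W) hφ h3 (hσφ _ (hOU h1).2)]
    change _ ↔ W.coord α + -μ ((chartAt E α₀.1.proj).symm (chartAt E α₀.1.proj α.1.proj)) = 0
    rw [h4, sub_eq_zero]
    exact ⟨h2, fun h => by rw [h]; exact hμp _ h1⟩

/-- The quotient of `ker ρ` by the period lattice is a manifold. -/
theorem exists_periodQuotient_manifold (hφ : IsContactIsotropicRealisation J C φ F)
    (hk : Module.finrank ℝ E' = Module.finrank ℝ E + k)
    (he : IsSmoothEmbedding 𝓘(ℝ, E × (Fin k → ℝ)) (𝓘(ℝ, E).prod 𝓘(ℝ, ℝ × (E →L[ℝ] ℝ))) ∞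
      (Subtype.val : kerAnchor J → J1 E L)) :
    ∃ _ : ChartedSpace (E × (Fin k → ℝ)) (PeriodQuotient J C F),
      IsManifold 𝓘(ℝ, E × (Fin k → ℝ)) ∞ (PeriodQuotient J C F) ∧
      IsLocalDiffeomorph 𝓘(ℝ, E × (Fin k → ℝ)) 𝓘(ℝ, E × (Fin k → ℝ)) ∞
        (Quot.mk (PeriodRel J C F)) := by
  have ht : ∀ a b, Quot.mk (PeriodRel J C F) a = Quot.mk (PeriodRel J C F) b →
      ∃ h : kerAnchor J → kerAnchor J,
        ContMDiffAt 𝓘(ℝ, E × (Fin k → ℝ)) 𝓘(ℝ, E × (Fin k → ℝ)) ∞ h a ∧ h a = b ∧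
        ∀ᶠ x in 𝓝 a, Quot.mk (PeriodRel J C F) (h x) = Quot.mk (PeriodRel J C F) x := by
    intro a b hab
    obtain ⟨W⟩ := exists_flowModel hφ hk a.1.proj
    obtain ⟨U, σ, hU, hpU, hσ, hσφ⟩ := W.exists_localSection hφ W.mem
    obtain ⟨h1, h2⟩ := (quotMk_eq_iff hφ hk (W := W) W.mem (hσφ _ hpU)).1 hab
    obtain ⟨A, hA0, hA, hAs, hAs'⟩ := FlowModel.exists_flowFrom_localInverse (W := W) hφ he hU hσ
      hσφ (α₀ := a) W.mem hpU
    obtain ⟨B, hB0, hB, hBs, hBs'⟩ := FlowModel.exists_flowFrom_localInverse (W := W) hφ he hU hσ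
      hσφ (α₀ := b) (by rw [h1]; exact W.mem) (by rw [h1]; exact hpU)
    have h3 : A a = B b := by
      rw [(hA _ hA0).2.2, (hB _ hB0).2.2, FlowModel.flowFrom, FlowModel.flowFrom, h1, h2]
    have h4 : A a ∈ B.target := h3 ▸ B.map_source hB0
    -- Equivalent elements have the same flow endpoint. Following the flow from σ near a and
    -- inverting it near b gives the smooth identification of their neighbourhoods.
    refine ⟨fun x => B.symm (A x), ?_, ?_, ?_⟩
    · exact ContMDiffAt.comp a (g := B.symm) (hBs'.contMDiffAt (B.open_target.mem_nhds h4))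
        (hAs.contMDiffAt (A.open_source.mem_nhds hA0))
    · exact (congrArg B.symm h3).trans (B.left_inv hB0)
    · filter_upwards [A.open_source.mem_nhds hA0,
        (A.continuousAt hA0).eventually (B.open_target.mem_nhds h4)] with x hx hx'
      have h5 := hB _ (B.map_target hx')
      have h6 := hA _ hx
      have h7 : W.flowFrom σ (B.symm (A x)) = W.flowFrom σ x := by
        rw [← h5.2.2, B.right_inv hx', h6.2.2]
      have h8 : x.1.proj = (B.symm (A x)).1.proj := by
        rw [← FlowModel.map_flowFrom hφ h5.1 (hσφ _ h5.2.1), h7,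
          FlowModel.map_flowFrom hφ h6.1 (hσφ _ h6.2.1)]
      refine (quotMk_eq_iff hφ hk (W := W) h5.1 (hσφ _ h5.2.1)).2 ⟨h8, ?_⟩
      rw [FlowModel.flowFrom, FlowModel.flowFrom, h8] at h7
      exact h7
  refine exists_quotient_manifold continuous_quot_mk ?_ Quot.mk_surjective ?_ ht
  -- Openness: the local identifications carry a point of O to every equivalent point b, and whole
  -- neighbourhoods with it.
  · intro O hO
    rw [← isQuotientMap_quot_mk.isOpen_preimage, isOpen_iff_mem_nhds]
    rintro b ⟨a, haO, hab⟩
    obtain ⟨h, h1, h2, h3⟩ := ht b a hab.symm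
    filter_upwards [h3, h1.continuousAt.eventually (hO.mem_nhds (by rw [h2]; exact haO))] with x hx hx'
    exact ⟨h x, hx', hx⟩
  -- Local injectivity: the flow from σ takes equal values on equivalent elements and is injective
  -- near a.
  · intro a
    obtain ⟨W⟩ := exists_flowModel hφ hk a.1.proj
    obtain ⟨U, σ, hU, hpU, hσ, hσφ⟩ := W.exists_localSection hφ W.mem
    obtain ⟨A, hA0, hA, hAs, hAs'⟩ := FlowModel.exists_flowFrom_localInverse (W := W) hφ he hU hσ
      hσφ (α₀ := a) W.mem hpU
    refine ⟨A.source, A.open_source.mem_nhds hA0, fun x hx y hy hxy => A.injOn hx hy ?_⟩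
    have h1 := hA _ hx
    obtain ⟨h2, h3⟩ := (quotMk_eq_iff hφ hk (W := W) h1.1 (hσφ _ h1.2.1)).1 hxy
    rw [h1.2.2, (hA _ hy).2.2, FlowModel.flowFrom, FlowModel.flowFrom, h2, h3]

end Period

/-! ### The diffeomorphism induced by a local section -/

section Psi

variable {E : Type*} [NormedAddCommGroup E] [NormedSpace ℝ E] [FiniteDimensional ℝ E]
  {P : Type*} [TopologicalSpace P] [ChartedSpace E P] [IsManifold 𝓘(ℝ, E) ∞ P] [T2Space P]
  {L : P → Type*} [TopologicalSpace (TotalSpace ℝ L)] [∀ p, TopologicalSpace (L p)]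
  [∀ p, AddCommGroup (L p)] [∀ p, Module ℝ (L p)] [FiberBundle ℝ L] [VectorBundle ℝ ℝ L]
  [ContMDiffVectorBundle ∞ ℝ L 𝓘(ℝ, E)]
  {E' : Type*} [NormedAddCommGroup E'] [NormedSpace ℝ E'] [FiniteDimensional ℝ E']
  {M : Type*} [TopologicalSpace M] [ChartedSpace E' M] [IsManifold 𝓘(ℝ, E') ∞ M] [T2Space M]
  {L' : M → Type*} [TopologicalSpace (TotalSpace ℝ L')] [∀ m, TopologicalSpace (L' m)]
  [∀ m, AddCommGroup (L' m)] [∀ m, Module ℝ (L' m)] [FiberBundle ℝ L'] [VectorBundle ℝ ℝ L']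
  [∀ m, IsTopologicalAddGroup (L' m)] [∀ m, ContinuousSMul ℝ (L' m)]
  [ContMDiffVectorBundle ∞ ℝ L' 𝓘(ℝ, E')]
  {k : ℕ} {J : JacobiStructure E L} {C : ContactForm E' L'} {φ : M → P}
  {F : BundleComponent E L E' L' φ} {i : P}

/-- The relation `FlowsTo` does not refer to a model, so flows defined in different models agree. -/
theorem FlowModel.flowFrom_eq (hφ : IsContactIsotropicRealisation J C φ F)
    {i' : P} (W : FlowModel J C F k i) (W' : FlowModel J C F k i') {σ : P → M} {α : kerAnchor J}
    (hp : α.1.proj ∈ W.U) (hp' : α.1.proj ∈ W'.U) (hσ : φ (σ α.1.proj) = α.1.proj) :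
    W.flowFrom σ α = W'.flowFrom σ α :=
  (FlowModel.flowsTo_iff_coord (W := W') hφ α.2 hp' hσ).1
    ((FlowModel.flowsTo_iff_coord (W := W) hφ α.2 hp hσ).2 rfl)

variable [ChartedSpace (E × (Fin k → ℝ)) (kerAnchor J)]
    [IsManifold 𝓘(ℝ, E × (Fin k → ℝ)) ∞ (kerAnchor J)]
    [ChartedSpace (E × (Fin k → ℝ)) (PeriodQuotient J C F)]

theorem contMDiff_periodQuotient_proj
    (he : IsSmoothEmbedding 𝓘(ℝ, E × (Fin k → ℝ)) (𝓘(ℝ, E).prod 𝓘(ℝ, ℝ × (E →L[ℝ] ℝ))) ∞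
      (Subtype.val : kerAnchor J → J1 E L))
    (hq : IsLocalDiffeomorph 𝓘(ℝ, E × (Fin k → ℝ)) 𝓘(ℝ, E × (Fin k → ℝ)) ∞
      (Quot.mk (PeriodRel J C F))) :
    ContMDiff 𝓘(ℝ, E × (Fin k → ℝ)) 𝓘(ℝ, E) ∞
      (PeriodQuotient.proj : PeriodQuotient J C F → P) := by
  intro x
  obtain ⟨α, rfl⟩ := Quot.mk_surjective x
  refine contMDiffAt_of_comp_isLocalDiffeomorphAt (hq α) ?_
  exact ContMDiffAt.comp α (g := fun α : J1 E L => α.proj) (contMDiff_proj _ _) (he.contMDiff α)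

/-- A local section of the realisation identifies it with the quotient of `ker ρ` by the period
lattice. -/
theorem exists_flow_partialDiffeomorph (hφ : IsContactIsotropicRealisation J C φ F)
    (hk : Module.finrank ℝ E' = Module.finrank ℝ E + k)
    (he : IsSmoothEmbedding 𝓘(ℝ, E × (Fin k → ℝ)) (𝓘(ℝ, E).prod 𝓘(ℝ, ℝ × (E →L[ℝ] ℝ))) ∞
      (Subtype.val : kerAnchor J → J1 E L))
    (hq : IsLocalDiffeomorph 𝓘(ℝ, E × (Fin k → ℝ)) 𝓘(ℝ, E × (Fin k → ℝ)) ∞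
      (Quot.mk (PeriodRel J C F)))
    {U : Set P} (hU : IsOpen U) {σ : P → M} (hσ : ContMDiffOn 𝓘(ℝ, E) 𝓘(ℝ, E') ∞ σ U)
    (hσφ : ∀ p ∈ U, φ (σ p) = p) :
    ∃ Ψ : PartialDiffeomorph 𝓘(ℝ, E × (Fin k → ℝ)) 𝓘(ℝ, E') (PeriodQuotient J C F) M ∞,
      Ψ.source = PeriodQuotient.proj ⁻¹' U ∧ Ψ.target = φ ⁻¹' U ∧
      (∀ α : kerAnchor J, α.1.proj ∈ U → FlowsTo C F α.1 (σ α.1.proj) (Ψ (Quot.mk _ α))) ∧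
      ∀ x ∈ Ψ.source, φ (Ψ x) = x.proj := by
  have hW (p : P) : Nonempty (FlowModel J C F k p) := exists_flowModel hφ hk p
  let W (p : P) : FlowModel J C F k p := (hW p).some
  -- The model changes with the base point; locally g is given by a single model, since the models
  -- agree on overlaps.
  set g : kerAnchor J → M := fun α => (W α.1.proj).flowFrom σ α with hg
  have hgφ {α : kerAnchor J} (hα : α.1.proj ∈ U) : φ (g α) = α.1.proj :=
    FlowModel.map_flowFrom hφ (W _).mem (hσφ _ hα)
  have hgq {α β : kerAnchor J} (hα : α.1.proj ∈ U) (hβ : β.1.proj ∈ U) :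
      Quot.mk (PeriodRel J C F) α = Quot.mk (PeriodRel J C F) β ↔ g α = g β := by
    have h1 := quotMk_eq_iff (β := β) hφ hk (W := W α.1.proj) (W _).mem (hσφ _ hα)
    have h2 (h : β.1.proj = α.1.proj) : g β = (W α.1.proj).flow ((W α.1.proj).coord β)
        (σ α.1.proj) := by
      change (W β.1.proj).flowFrom σ β = _
      rw [(W β.1.proj).flowFrom_eq hφ (W α.1.proj) (W _).mem (by rw [h]; exact (W _).mem)
        (hσφ _ hβ), FlowModel.flowFrom, h]
    constructor
    · intro h
      obtain ⟨h3, h4⟩ := h1.1 h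
      rw [h2 h3, ← h4]
      rfl
    · intro h
      have h3 : β.1.proj = α.1.proj := by rw [← hgφ hα, h, hgφ hβ]
      exact h1.2 ⟨h3, by rw [← h2 h3, ← h]; rfl⟩
  -- A right inverse of g from transitivity. Its choice, not continuous in general, disappears in
  -- the quotient.
  have hr (m : M) : ∃ α : kerAnchor J, φ m ∈ U → α.1.proj = φ m ∧ g α = m := by
    by_cases h : φ m ∈ U
    · obtain ⟨b, hb⟩ := FlowModel.exists_flow_eq (W := W (φ m)) hφ (m := σ (φ m)) (m' := m)
        (by rw [hσφ _ h]; exact (W _).mem) (hσφ _ h).symm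
      refine ⟨⟨_, (W (φ m)).elem_mem (W _).mem b⟩, fun _ => ⟨rfl, ?_⟩⟩
      change (W (φ m)).flow ((W (φ m)).coord ((W (φ m)).elem (φ m) b)) (σ (φ m)) = m
      rw [(W (φ m)).coord_elem (W _).mem, hb]
    · exact ⟨⟨_, (W (φ m)).elem_mem (W _).mem 0⟩, fun h' => absurd h' h⟩
  choose r hr using hr
  have hA (α : kerAnchor J) (hα : α.1.proj ∈ U) : ∃ A : OpenPartialHomeomorph (kerAnchor J) M,
      α ∈ A.source ∧ (∀ β ∈ A.source, β.1.proj ∈ U ∧ A β = g β) ∧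
      ContMDiffOn 𝓘(ℝ, E × (Fin k → ℝ)) 𝓘(ℝ, E') ∞ A A.source ∧
      ContMDiffOn 𝓘(ℝ, E') 𝓘(ℝ, E × (Fin k → ℝ)) ∞ A.symm A.target := by
    obtain ⟨A, h1, h2, h3, h4⟩ := FlowModel.exists_flowFrom_localInverse (W := W α.1.proj) hφ he hU
      hσ hσφ (W _).mem hα
    refine ⟨A, h1, fun β hβ => ⟨(h2 β hβ).2.1, ?_⟩, h3, h4⟩
    rw [(h2 β hβ).2.2]
    exact FlowModel.flowFrom_eq hφ _ _ (h2 β hβ).1 (W _).mem (hσφ _ (h2 β hβ).2.1)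
  have hout (α : kerAnchor J) (hα : α.1.proj ∈ U) :
      g (Quot.out (Quot.mk (PeriodRel J C F) α)) = g α := by
    have h1 := Quot.out_eq (Quot.mk (PeriodRel J C F) α)
    have h2 : (Quot.out (Quot.mk (PeriodRel J C F) α)).1.proj = α.1.proj :=
      congrArg PeriodQuotient.proj h1
    exact (hgq (by rw [h2]; exact hα) hα).1 h1
  have hpc := (contMDiff_periodQuotient_proj (C := C) (F := F) he hq).continuous
  let Ψ : PartialDiffeomorph 𝓘(ℝ, E × (Fin k → ℝ)) 𝓘(ℝ, E') (PeriodQuotient J C F) M ∞ :=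
    { toFun := fun x => g x.out
      invFun := fun m => Quot.mk _ (r m)
      source := PeriodQuotient.proj ⁻¹' U
      target := φ ⁻¹' U
      map_source' := by
        rintro ⟨α⟩ hα
        have hα' : α.1.proj ∈ U := hα
        change φ (g (Quot.out (Quot.mk (PeriodRel J C F) α))) ∈ U
        rw [hout α hα', hgφ hα']
        exact hα'
      map_target' := by
        intro m hm
        change (r m).1.proj ∈ U
        rw [(hr m hm).1]
        exact hm
      left_inv' := by
        rintro ⟨α⟩ hα
        have hα' : α.1.proj ∈ U := hα
        change Quot.mk (PeriodRel J C F) (r (g (Quot.out (Quot.mk (PeriodRel J C F) α)))) =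
          Quot.mk (PeriodRel J C F) α
        rw [hout α hα']
        have h1 := hr (g α) (by rw [hgφ hα']; exact hα')
        exact (hgq (by rw [h1.1, hgφ hα']; exact hα') hα').2 h1.2
      right_inv' := by
        intro m hm
        have h1 := hr m hm
        rw [hout _ (by rw [h1.1]; exact hm), h1.2]
      open_source := hU.preimage hpc
      open_target := hU.preimage hφ.contMDiff.continuous
      contMDiffOn_toFun := by
        rintro ⟨α⟩ hα
        have hα' : α.1.proj ∈ U := hα
        obtain ⟨A, h1, h2, h3, -⟩ := hA α hα'
        refine ContMDiffAt.contMDiffWithinAt ?_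
        refine contMDiffAt_of_comp_isLocalDiffeomorphAt (hq α) ?_
        refine (h3.contMDiffAt (A.open_source.mem_nhds h1)).congr_of_eventuallyEq ?_
        filter_upwards [A.open_source.mem_nhds h1] with β hβ
        rw [(h2 β hβ).2]
        exact hout β (h2 β hβ).1
      contMDiffOn_invFun := by
        intro m hm
        have h0 := hr m hm
        obtain ⟨A, h1, h2, -, h4⟩ := hA (r m) (by rw [h0.1]; exact hm)
        have h5 : m ∈ A.target := by
          rw [← h0.2, ← (h2 _ h1).2]
          exact A.map_source h1
        refine ContMDiffAt.contMDiffWithinAt ?_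
        refine (ContMDiffAt.comp m (g := Quot.mk (PeriodRel J C F)) (hq.contMDiff _)
          (h4.contMDiffAt (A.open_target.mem_nhds h5))).congr_of_eventuallyEq ?_
        filter_upwards [A.open_target.mem_nhds h5,
          (hU.preimage hφ.contMDiff.continuous).mem_nhds hm] with m' hm' hm''
        have h6 := hr m' hm''
        have h7 := h2 _ (A.map_target hm')
        refine (hgq (by rw [h6.1]; exact hm'') h7.1).2 ?_
        rw [h6.2, ← h7.2, A.right_inv hm'] }
  refine ⟨Ψ, rfl, rfl, fun α hα => ?_, ?_⟩
  · have h1 : Ψ (Quot.mk _ α) = g α := hout α hα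
    rw [h1]
    exact (FlowModel.flowsTo_iff_coord (W := W α.1.proj) hφ α.2 (W _).mem (hσφ _ hα)).2 rfl
  · rintro ⟨α⟩ hα
    have hα' : α.1.proj ∈ U := hα
    have h1 : Ψ (Quot.mk _ α) = g α := hout α hα'
    exact (congrArg φ h1).trans (hgφ hα')

theorem exists_flow_partialDiffeomorph_at (hφ : IsContactIsotropicRealisation J C φ F)
    (hk : Module.finrank ℝ E' = Module.finrank ℝ E + k)
    (he : IsSmoothEmbedding 𝓘(ℝ, E × (Fin k → ℝ)) (𝓘(ℝ, E).prod 𝓘(ℝ, ℝ × (E →L[ℝ] ℝ))) ∞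
      (Subtype.val : kerAnchor J → J1 E L))
    (hq : IsLocalDiffeomorph 𝓘(ℝ, E × (Fin k → ℝ)) 𝓘(ℝ, E × (Fin k → ℝ)) ∞
      (Quot.mk (PeriodRel J C F))) (p : P) : ∃ U : Set P, IsOpen U ∧ p ∈ U ∧
    ∃ Ψ : OpenPartialHomeomorph (PeriodQuotient J C F) M, Ψ.source = PeriodQuotient.proj ⁻¹' U := by
  obtain ⟨W⟩ := exists_flowModel hφ hk p
  obtain ⟨U, σ, hU, hpU, hσ, hσφ⟩ := W.exists_localSection hφ W.mem
  obtain ⟨Ψ, h1, -⟩ := exists_flow_partialDiffeomorph hφ hk he hq hU hσ hσφ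
  exact ⟨U, hU, hpU, Ψ.toOpenPartialHomeomorph, h1⟩

/-- Points over different base points are separated in P. Points over the same one are separated in
M, through the injective map Ψ of a local section. -/
theorem t2Space_periodQuotient (hφ : IsContactIsotropicRealisation J C φ F)
    (hk : Module.finrank ℝ E' = Module.finrank ℝ E + k)
    (he : IsSmoothEmbedding 𝓘(ℝ, E × (Fin k → ℝ)) (𝓘(ℝ, E).prod 𝓘(ℝ, ℝ × (E →L[ℝ] ℝ))) ∞
      (Subtype.val : kerAnchor J → J1 E L))
    (hq : IsLocalDiffeomorph 𝓘(ℝ, E × (Fin k → ℝ)) 𝓘(ℝ, E × (Fin k → ℝ)) ∞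
      (Quot.mk (PeriodRel J C F))) : T2Space (PeriodQuotient J C F) := by
  have hpc := (contMDiff_periodQuotient_proj (C := C) (F := F) he hq).continuous
  refine ⟨fun x y hxy => ?_⟩
  by_cases h : x.proj = y.proj
  · obtain ⟨U, hU, hpU, Ψ, hΨ⟩ := exists_flow_partialDiffeomorph_at hφ hk he hq x.proj
    have hx : x ∈ Ψ.source := by rw [hΨ]; exact hpU
    have hy : y ∈ Ψ.source := by rw [hΨ, mem_preimage, ← h]; exact hpU
    obtain ⟨u, v, hu, hv, hxu, hyv, huv⟩ := t2_separation fun h => hxy (Ψ.injOn hx hy h)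
    refine ⟨Ψ.source ∩ Ψ ⁻¹' u, Ψ.source ∩ Ψ ⁻¹' v, Ψ.isOpen_inter_preimage hu,
      Ψ.isOpen_inter_preimage hv, ⟨hx, hxu⟩, ⟨hy, hyv⟩, ?_⟩
    exact (huv.preimage Ψ).mono inter_subset_right inter_subset_right
  · obtain ⟨u, v, hu, hv, hxu, hyv, huv⟩ := t2_separation h
    exact ⟨_, _, hu.preimage hpc, hv.preimage hpc, hxu, hyv, huv.preimage _⟩

/-- Countably many domains of local sections cover P, and the part of the quotient over each is
homeomorphic to an open subset of M. -/
theorem secondCountableTopology_periodQuotient [SecondCountableTopology P]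
    [SecondCountableTopology M] (hφ : IsContactIsotropicRealisation J C φ F)
    (hk : Module.finrank ℝ E' = Module.finrank ℝ E + k)
    (he : IsSmoothEmbedding 𝓘(ℝ, E × (Fin k → ℝ)) (𝓘(ℝ, E).prod 𝓘(ℝ, ℝ × (E →L[ℝ] ℝ))) ∞
      (Subtype.val : kerAnchor J → J1 E L))
    (hq : IsLocalDiffeomorph 𝓘(ℝ, E × (Fin k → ℝ)) 𝓘(ℝ, E × (Fin k → ℝ)) ∞
      (Quot.mk (PeriodRel J C F))) : SecondCountableTopology (PeriodQuotient J C F) := by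
  have hpc := (contMDiff_periodQuotient_proj (C := C) (F := F) he hq).continuous
  choose U hU hpU Ψ hΨ using exists_flow_partialDiffeomorph_at (C := C) (F := F) hφ hk he hq
  obtain ⟨S, hS, hSU⟩ := TopologicalSpace.countable_cover_nhds
    fun p => (hU p).mem_nhds (hpU p)
  have : Countable S := hS.to_subtype
  have (p : S) : SecondCountableTopology (Ψ p).source :=
    (Ψ p).toHomeomorphSourceTarget.secondCountableTopology
  refine TopologicalSpace.secondCountableTopology_of_countable_cover (U := fun p : S => (Ψ p).source)
    (fun p => (Ψ p).open_source) (eq_univ_of_forall fun x => ?_)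
  have hx : x.proj ∈ ⋃ p ∈ S, U p := hSU ▸ mem_univ _
  simp only [mem_iUnion] at hx ⊢
  obtain ⟨p, hp, hxp⟩ := hx
  exact ⟨⟨p, hp⟩, by rw [hΨ]; exact hxp⟩

end Psi

/-- A discrete subgroup within bounded distance of every vector is a full lattice: a linear
functional that vanishes on S is bounded on the whole space, hence zero. A ℤ-basis of S then
provides Λ. -/
theorem exists_lattice_basis {k : ℕ} (S : AddSubgroup (Fin k → ℝ))
    (hd : ∀ᶠ b in 𝓝 (0 : Fin k → ℝ), b ∈ S → b = 0) {R : ℝ} (hR : ∀ b, ∃ s ∈ S, ‖b - s‖ ≤ R) :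
    ∃ Λ : (Fin k → ℝ) ≃L[ℝ] (Fin k → ℝ), ∀ b,
      b ∈ S ↔ ∃ n : Fin k → ℤ, b = Λ fun j => (n j : ℝ) := by
  set Z : Submodule ℤ (Fin k → ℝ) := AddSubgroup.toIntSubmodule S with hZ
  have : DiscreteTopology Z := by
    refine discreteTopology_of_isOpen_singleton_zero ?_
    obtain ⟨t, ht, ht', h0⟩ := mem_nhds_iff.1 hd
    refine isOpen_induced_iff.2 ⟨t, ht', ?_⟩
    ext b
    refine ⟨fun hb => Subtype.ext (ht hb b.2), fun hb => ?_⟩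
    rw [mem_singleton_iff.1 hb]
    exact h0
  have : IsZLattice ℝ Z := by
    refine ⟨?_⟩
    by_contra h
    obtain ⟨f, hf0, hf⟩ := Submodule.exists_le_ker_of_lt_top _ (lt_top_iff_ne_top.2 h)
    obtain ⟨x, hx⟩ : ∃ x, f x ≠ 0 := by
      by_contra! h
      exact hf0 (LinearMap.ext h)
    set f' := LinearMap.toContinuousLinearMap f with hf'
    have hb (b : Fin k → ℝ) : ‖f b‖ ≤ ‖f'‖ * R := by
      obtain ⟨s, hs, hs'⟩ := hR b
      have h1 : f s = 0 := hf (Submodule.subset_span hs)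
      have h2 : f b = f' (b - s) := by
        rw [hf', LinearMap.coe_toContinuousLinearMap', map_sub, h1, sub_zero]
      rw [h2]
      exact (f'.le_opNorm _).trans (mul_le_mul_of_nonneg_left hs' (norm_nonneg _))
    -- A large multiple of x violates the bound.
    obtain ⟨n, hn⟩ := exists_nat_gt (‖f'‖ * R / ‖f x‖)
    rw [div_lt_iff₀ (norm_pos_iff.2 hx)] at hn
    have h3 := hb ((n : ℝ) • x)
    rw [map_smul, norm_smul, Real.norm_natCast] at h3
    linarith
  let B := IsZLattice.basis Z
  have hΛ (v : Fin k → ℝ) : (B.ofZLatticeBasis ℝ Z).equivFun.symm.toContinuousLinearEquiv v =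
      ∑ j, v j • (B j : Fin k → ℝ) := by
    simp [Module.Basis.equivFun_symm_apply]
  refine ⟨(B.ofZLatticeBasis ℝ Z).equivFun.symm.toContinuousLinearEquiv, fun b => ⟨fun h => ?_, ?_⟩⟩
  · refine ⟨fun j => B.repr ⟨b, h⟩ j, ?_⟩
    rw [hΛ]
    have h1 := congrArg Subtype.val (B.sum_repr ⟨b, h⟩)
    simp only [Int.cast_smul_eq_zsmul]
    rw [Submodule.coe_sum] at h1
    exact h1.symm
  · rintro ⟨n, rfl⟩
    rw [hΛ]
    refine S.sum_mem fun j _ => ?_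
    rw [Int.cast_smul_eq_zsmul]
    exact S.zsmul_mem (B j).2 _

/-! ### Smooth bases of the periods -/

section Period

variable {E : Type*} [NormedAddCommGroup E] [NormedSpace ℝ E] [FiniteDimensional ℝ E]
  {P : Type*} [TopologicalSpace P] [ChartedSpace E P] [IsManifold 𝓘(ℝ, E) ∞ P] [T2Space P]
  {L : P → Type*} [TopologicalSpace (TotalSpace ℝ L)] [∀ p, TopologicalSpace (L p)]
  [∀ p, AddCommGroup (L p)] [∀ p, Module ℝ (L p)] [FiberBundle ℝ L] [VectorBundle ℝ ℝ L]
  [ContMDiffVectorBundle ∞ ℝ L 𝓘(ℝ, E)]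
  {E' : Type*} [NormedAddCommGroup E'] [NormedSpace ℝ E'] [FiniteDimensional ℝ E']
  {M : Type*} [TopologicalSpace M] [ChartedSpace E' M] [IsManifold 𝓘(ℝ, E') ∞ M] [T2Space M]
  {L' : M → Type*} [TopologicalSpace (TotalSpace ℝ L')] [∀ m, TopologicalSpace (L' m)]
  [∀ m, AddCommGroup (L' m)] [∀ m, Module ℝ (L' m)] [FiberBundle ℝ L'] [VectorBundle ℝ ℝ L']
  [∀ m, IsTopologicalAddGroup (L' m)] [∀ m, ContinuousSMul ℝ (L' m)]
  [ContMDiffVectorBundle ∞ ℝ L' 𝓘(ℝ, E')]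
  {k : ℕ} {J : JacobiStructure E L} {C : ContactForm E' L'} {φ : M → P}
  {F : BundleComponent E L E' L' φ} {i : P}

namespace FlowModel

variable {W : FlowModel J C F k i}

variable (W) in
/-- The subgroup of periods of the flow at `m`. -/
def periodSubgroup (hφ : IsContactIsotropicRealisation J C φ F) {m : M} (hm : φ m ∈ W.U) :
    AddSubgroup (Fin k → ℝ) where
  carrier := {b | W.flow b m = m}
  add_mem' {b b'} hb hb' := by
    change W.flow b m = m at hb
    change W.flow b' m = m at hb'
    change W.flow (b + b') m = m
    rw [flow_add hφ hm, hb', hb]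
  zero_mem' := flow_zero hφ hm
  neg_mem' {b} hb := by
    change W.flow b m = m at hb
    change W.flow (-b) m = m
    rw [← zero_sub, flow_sub_eq_iff hφ hm, flow_zero hφ hm, hb]

theorem mem_periodSubgroup (hφ : IsContactIsotropicRealisation J C φ F) {m : M} (hm : φ m ∈ W.U)
    {b : Fin k → ℝ} : b ∈ W.periodSubgroup hφ hm ↔ W.flow b m = m := Iff.rfl

variable [ChartedSpace (E × (Fin k → ℝ)) (kerAnchor J)]
    [IsManifold 𝓘(ℝ, E × (Fin k → ℝ)) ∞ (kerAnchor J)]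

/-- Near each of its points the fibre is reached by the local inverse of the flow from σ, with
coordinates bounded by continuity. Finitely many such neighbourhoods cover the compact fibre. -/
theorem exists_bounded_flow_eq (hφ : IsContactIsotropicRealisation J C φ F)
    (he : IsSmoothEmbedding 𝓘(ℝ, E × (Fin k → ℝ)) (𝓘(ℝ, E).prod 𝓘(ℝ, ℝ × (E →L[ℝ] ℝ))) ∞
      (Subtype.val : kerAnchor J → J1 E L))
    {U : Set P} (hU : IsOpen U) {σ : P → M} (hσ : ContMDiffOn 𝓘(ℝ, E) 𝓘(ℝ, E') ∞ σ U)
    (hσφ : ∀ p ∈ U, φ (σ p) = p) {p₀ : P} (h0 : p₀ ∈ W.U) (h0' : p₀ ∈ U) :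
    ∃ R : ℝ, ∀ m, φ m = p₀ → ∃ b, ‖b‖ ≤ R ∧ W.flow b (σ p₀) = m := by
  have hm : φ (σ p₀) ∈ W.U := by rw [hσφ _ h0']; exact h0
  suffices h : ∃ R : ℝ, ∀ m ∈ φ ⁻¹' {p₀}, φ m = p₀ → ∃ b, ‖b‖ ≤ R ∧ W.flow b (σ p₀) = m by
    obtain ⟨R, hR⟩ := h
    exact ⟨R, fun m hm => hR m hm hm⟩
  refine (hφ.isCompact_fibre p₀).induction_on
    (p := fun s => ∃ R : ℝ, ∀ m ∈ s, φ m = p₀ → ∃ b, ‖b‖ ≤ R ∧ W.flow b (σ p₀) = m) ?_ ?_ ?_ ?_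
  · exact ⟨0, by simp⟩
  · rintro s t hst ⟨R, hR⟩
    exact ⟨R, fun m hm => hR m (hst hm)⟩
  · rintro s t ⟨R, hR⟩ ⟨R', hR'⟩
    refine ⟨max R R', fun m hm hmp => ?_⟩
    rcases hm with hm | hm
    · obtain ⟨b, hb, hb'⟩ := hR m hm hmp
      exact ⟨b, hb.trans (le_max_left _ _), hb'⟩
    · obtain ⟨b, hb, hb'⟩ := hR' m hm hmp
      exact ⟨b, hb.trans (le_max_right _ _), hb'⟩
  · intro m₀ hm₀
    obtain ⟨b₀, hb₀⟩ := exists_flow_eq (W := W) hφ hm (m' := m₀) (hm₀.trans (hσφ _ h0').symm)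
    let α₀ : kerAnchor J := ⟨W.elem p₀ b₀, W.elem_mem h0 b₀⟩
    have hc₀ : W.coord α₀ = b₀ := W.coord_elem h0 b₀
    obtain ⟨A, hA0, hA, -, -⟩ := exists_flowFrom_localInverse (W := W) hφ he hU hσ hσφ
      (α₀ := α₀) h0 h0'
    have hA₀ : A α₀ = m₀ := by
      rw [(hA _ hA0).2.2, flowFrom, hc₀]
      exact hb₀
    have ht : m₀ ∈ A.target := hA₀ ▸ A.map_source hA0
    have hcont : ContinuousAt (fun m => W.coord (A.symm m)) m₀ := by
      have h1 : ContinuousAt (fun m => (A.symm m : J1 E L)) m₀ :=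
        continuous_subtype_val.continuousAt.comp (A.continuousAt_symm ht)
      refine ContinuousAt.comp (g := W.coord) (W.contMDiffAt_coord ?_).continuousAt h1
      exact (hA _ (A.map_target ht)).1
    have h2 : ∀ᶠ m in 𝓝 m₀, ‖W.coord (A.symm m)‖ < ‖b₀‖ + 1 := by
      refine hcont.norm.eventually_lt continuousAt_const ?_
      rw [← hA₀, A.left_inv hA0, hc₀]
      exact lt_add_one _
    refine ⟨_, mem_nhdsWithin_of_mem_nhds (h2.and (A.open_target.mem_nhds ht)), ‖b₀‖ + 1, ?_⟩
    rintro m ⟨h3, h4⟩ hmp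
    refine ⟨_, h3.le, ?_⟩
    have h5 := hA _ (A.map_target h4)
    have h6 : W.flowFrom σ (A.symm m) = m := by rw [← h5.2.2, A.right_inv h4]
    have h7 := map_flowFrom hφ h5.1 (hσφ _ h5.2.1)
    rw [h6, hmp] at h7
    rw [flowFrom, ← h7] at h6
    exact h6

/-- The periods over a point form a lattice. -/
theorem exists_periods_basis (hφ : IsContactIsotropicRealisation J C φ F)
    (he : IsSmoothEmbedding 𝓘(ℝ, E × (Fin k → ℝ)) (𝓘(ℝ, E).prod 𝓘(ℝ, ℝ × (E →L[ℝ] ℝ))) ∞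
      (Subtype.val : kerAnchor J → J1 E L))
    {U : Set P} (hU : IsOpen U) {σ : P → M} (hσ : ContMDiffOn 𝓘(ℝ, E) 𝓘(ℝ, E') ∞ σ U)
    (hσφ : ∀ p ∈ U, φ (σ p) = p) {p₀ : P} (h0 : p₀ ∈ W.U) (h0' : p₀ ∈ U) :
    ∃ Λ : (Fin k → ℝ) ≃L[ℝ] (Fin k → ℝ), ∀ b,
      W.flow b (σ p₀) = σ p₀ ↔ ∃ n : Fin k → ℤ, b = Λ fun j => (n j : ℝ) := by
  have hm : φ (σ p₀) ∈ W.U := by rw [hσφ _ h0']; exact h0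
  obtain ⟨R, hR⟩ := exists_bounded_flow_eq (W := W) hφ he hU hσ hσφ h0 h0'
  refine exists_lattice_basis (W.periodSubgroup hφ hm) (R := R) ?_ fun b => ?_
  · obtain ⟨μ, O, -, -, -, -, hμ0, -, hμ⟩ := exists_period_function (W := W) hφ he hU hσ hσφ h0 h0'
      (flow_zero hφ hm)
    have h1 : Filter.Tendsto (fun b : Fin k → ℝ => (p₀, b)) (𝓝 0) (𝓝 (p₀, 0)) :=
      (Continuous.prodMk_right p₀).continuousAt
    filter_upwards [h1.eventually hμ] with b hb hb'
    rw [hb hb', hμ0]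
  -- The endpoint of b is also reached by some b' of norm at most R, and b - b' is a period at
  -- distance at most R from b.
  · obtain ⟨b', hb', h⟩ := hR (W.flow b (σ p₀)) (by rw [map_flow hφ hm, hσφ _ h0'])
    refine ⟨b - b', (mem_periodSubgroup hφ hm).2 ((flow_sub_eq_iff hφ hm _ _).2 h.symm), ?_⟩
    rwa [sub_sub_cancel]

/-- The periods form a smooth family of lattices. -/
theorem exists_smooth_periods_basis (hφ : IsContactIsotropicRealisation J C φ F)
    (he : IsSmoothEmbedding 𝓘(ℝ, E × (Fin k → ℝ)) (𝓘(ℝ, E).prod 𝓘(ℝ, ℝ × (E →L[ℝ] ℝ))) ∞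
      (Subtype.val : kerAnchor J → J1 E L))
    {U : Set P} (hU : IsOpen U) {σ : P → M} (hσ : ContMDiffOn 𝓘(ℝ, E) 𝓘(ℝ, E') ∞ σ U)
    (hσφ : ∀ p ∈ U, φ (σ p) = p) {p₀ : P} (h0 : p₀ ∈ W.U) (h0' : p₀ ∈ U) :
    ∃ (Λ Λ' : P → (Fin k → ℝ) →L[ℝ] (Fin k → ℝ)) (B : Set P), IsOpen B ∧ p₀ ∈ B ∧ B ⊆ W.U ∩ U ∧
      ContMDiffOn 𝓘(ℝ, E) 𝓘(ℝ, (Fin k → ℝ) →L[ℝ] (Fin k → ℝ)) ∞ Λ B ∧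
      ContMDiffOn 𝓘(ℝ, E) 𝓘(ℝ, (Fin k → ℝ) →L[ℝ] (Fin k → ℝ)) ∞ Λ' B ∧
      ∀ p ∈ B, (∀ b, Λ p (Λ' p b) = b) ∧ (∀ b, Λ' p (Λ p b) = b) ∧
        ∀ b, W.flow b (σ p) = σ p ↔ ∃ n : Fin k → ℤ, b = Λ p fun j => (n j : ℝ) := by
  obtain ⟨Λ₀, hΛ₀⟩ := exists_periods_basis (W := W) hφ he hU hσ hσφ h0 h0'
  have hj (j : Fin k) : W.flow (Λ₀ (Pi.single j 1)) (σ p₀) = σ p₀ := by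
    refine (hΛ₀ _).2 ⟨Pi.single j 1, congrArg Λ₀ (funext fun l => ?_)⟩
    by_cases h : l = j
    · subst h; simp
    · simp [Pi.single_eq_of_ne h]
  choose μ O hO hO0 hOU hμ hμ0 hμp hμu using fun j => exists_period_function (W := W) hφ he hU hσ
    hσφ h0 h0' (hj j)
  let T : (Fin k → Fin k → ℝ) → (Fin k → ℝ) →L[ℝ] (Fin k → ℝ) := fun v =>
    ∑ j, (ContinuousLinearMap.proj (R := ℝ) (φ := fun _ : Fin k => ℝ) j).smulRight (v j)
  have hT : ContDiff ℝ ∞ T := ContDiff.sum fun j _ =>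
    ContDiff.smulRight contDiff_const (contDiff_apply ℝ (Fin k → ℝ) j)
  have hTv (v : Fin k → Fin k → ℝ) (b : Fin k → ℝ) : T v b = ∑ j, b j • v j := by
    simp [T]
  -- The basis periods at p₀ are continued by their period functions; Λ p has these as columns.
  set Λ : P → (Fin k → ℝ) →L[ℝ] (Fin k → ℝ) := fun p => T fun j => μ j p with hΛ
  have hΛv (p : P) (b : Fin k → ℝ) : Λ p b = ∑ j, b j • μ j p := hTv _ b
  have hΛ0 : Λ p₀ = Λ₀ := by
    ext1 b
    have h1 : b = ∑ j, b j • (Pi.single j 1 : Fin k → ℝ) := pi_eq_sum_univ' b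
    rw [hΛv, ContinuousLinearEquiv.coe_coe]
    conv_rhs => rw [h1]
    simp only [map_sum, map_smul, hμ0]
  set O' : Set P := (W.U ∩ U) ∩ ⋂ j, O j with hO'
  have hO'o : IsOpen O' := (W.isOpen.inter hU).inter (isOpen_iInter_of_finite hO)
  have hpO' : p₀ ∈ O' := ⟨⟨h0, h0'⟩, mem_iInter.2 hO0⟩
  have hφσ {p : P} (hp : p ∈ O') : φ (σ p) ∈ W.U := by rw [hσφ _ hp.1.2]; exact hp.1.1
  have hΛs : ContMDiffOn 𝓘(ℝ, E) 𝓘(ℝ, (Fin k → ℝ) →L[ℝ] (Fin k → ℝ)) ∞ Λ O' := by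
    intro p hp
    refine (ContMDiffAt.comp p (g := T) hT.contMDiff.contMDiffAt (f := fun p j => μ j p)
      (contMDiffAt_pi_space.2 fun j => ?_)).contMDiffWithinAt
    exact (hμ j).contMDiffAt ((hO j).mem_nhds (mem_iInter.1 hp.2 j))
  have hint {p : P} (hp : p ∈ O') (n : Fin k → ℤ) :
      (Λ p fun j => (n j : ℝ)) ∈ W.periodSubgroup hφ (hφσ hp) := by
    rw [hΛv]
    refine AddSubgroup.sum_mem _ fun j _ => ?_
    rw [Int.cast_smul_eq_zsmul]
    exact AddSubgroup.zsmul_mem _ ((mem_periodSubgroup _ _).2 (hμp j p (mem_iInter.1 hp.2 j))) _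
  have hΛc (t₀ : Fin k → ℝ) : ContinuousAt (fun x : P × (Fin k → ℝ) => Λ x.1 x.2) (p₀, t₀) := by
    have h1 : ContinuousAt (fun x : P × (Fin k → ℝ) => Λ x.1) (p₀, t₀) :=
      ContinuousAt.comp (g := Λ) (hΛs.contMDiffAt (hO'o.mem_nhds hpO')).continuousAt continuousAt_fst
    exact h1.clm_apply continuousAt_snd
  have hinv : ∀ᶠ p in 𝓝 p₀, (Λ p).IsInvertible := by
    have h1 := (hΛs.contMDiffAt (hO'o.mem_nhds hpO')).continuousAt
    refine h1.eventually (p := fun A => A.IsInvertible) ?_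
    rw [hΛ0]
    exact Λ₀.nhds
  have hO'e : ∀ᶠ p in 𝓝 p₀, p ∈ O' := hO'o.mem_nhds hpO'
  -- It remains to exclude new periods at nearby p. Modulo the continued lattice only the compact
  -- unit cube matters, and near each (p₀, t₀) there are two cases: either Λ t₀ is no period at p₀,
  -- which is an open condition, or t₀ is integral and uniqueness of the nearby period forces t =
  -- t₀.
  have htube : ∀ᶠ p in 𝓝 p₀, ∀ t ∈ Icc (0 : Fin k → ℝ) 1,
      (Λ p).IsInvertible → W.flow (Λ p t) (σ p) = σ p → ∃ n : Fin k → ℤ, t = fun j => (n j : ℝ) := by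
    refine isCompact_Icc.eventually_forall_of_forall_eventually fun t₀ _ => ?_
    have hfst : Filter.Tendsto (fun x : P × (Fin k → ℝ) => x.1) (𝓝 (p₀, t₀)) (𝓝 p₀) :=
      continuousAt_fst
    by_cases h : W.flow (Λ p₀ t₀) (σ p₀) = σ p₀
    · obtain ⟨n, hn⟩ := (hΛ₀ _).1 h
      rw [hΛ0] at hn
      have hn' : t₀ = fun j => (n j : ℝ) := Λ₀.injective hn
      obtain ⟨ν, -, -, -, -, -, -, -, hν⟩ := exists_period_function (W := W) hφ he hU hσ hσφ h0 h0' h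
      have h1 : ContinuousAt (fun x : P × (Fin k → ℝ) => (x.1, Λ x.1 x.2)) (p₀, t₀) :=
        continuousAt_fst.prodMk (hΛc t₀)
      have h2 : ContinuousAt (fun x : P × (Fin k → ℝ) => (x.1, Λ x.1 t₀)) (p₀, t₀) :=
        ContinuousAt.comp (g := fun x : P × (Fin k → ℝ) => (x.1, Λ x.1 x.2))
          (f := fun x : P × (Fin k → ℝ) => (x.1, t₀)) h1
          (continuousAt_fst.prodMk continuousAt_const)
      filter_upwards [h1.eventually hν, h2.eventually hν, hfst.eventually hO'e]
        with x hx1 hx2 hx3 hx4 hx5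
      refine ⟨n, ?_⟩
      rw [← hn']
      obtain ⟨A, hA⟩ := hx4
      refine A.injective ?_
      have h3 := (hx1 hx5).trans (hx2 (by rw [hn']; exact hint hx3 n)).symm
      rwa [← hA] at h3
    · have hm : φ (σ p₀) ∈ W.U := hφσ hpO'
      have hσc : ContinuousAt (fun x : P × (Fin k → ℝ) => σ x.1) (p₀, t₀) :=
        ContinuousAt.comp (g := σ) (hσ.continuousOn.continuousAt (hU.mem_nhds h0')) continuousAt_fst
      have h1 : ContinuousAt (fun x : P × (Fin k → ℝ) => W.flow (Λ x.1 x.2) (σ x.1)) (p₀, t₀) :=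
        ContinuousAt.comp (g := fun x : M × (Fin k → ℝ) => W.flow x.2 x.1)
          (f := fun x : P × (Fin k → ℝ) => (σ x.1, Λ x.1 x.2))
          (contMDiffAt_flow hφ hm _).continuousAt (hσc.prodMk (hΛc t₀))
      filter_upwards [h1.ne_iff_eventually_ne hσc |>.1 h] with x hx _ hx'
      exact absurd hx' hx
  obtain ⟨B, hB, hBo, hpB⟩ := mem_nhds_iff.1 (hinv.and (hO'e.and htube))
  refine ⟨Λ, fun p => (Λ p).inverse, B, hBo, hpB, fun p hp => (hB hp).2.1.1,
    hΛs.mono fun p hp => (hB hp).2.1, ?_, ?_⟩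
  · intro p hp
    obtain ⟨A, hA⟩ := (hB hp).1
    have h1 : ContDiffAt ℝ ∞ ContinuousLinearMap.inverse (Λ p) := hA ▸ contDiffAt_map_inverse A
    exact (h1.contMDiffAt.comp p (hΛs.contMDiffAt (hO'o.mem_nhds (hB hp).2.1))).contMDiffWithinAt
  · intro p hp
    have hpO := (hB hp).2.1
    obtain ⟨A, hA⟩ := (hB hp).1
    have h1 (b : Fin k → ℝ) : Λ p ((Λ p).inverse b) = b := by
      rw [← hA, ContinuousLinearMap.inverse_equiv]
      exact A.apply_symm_apply b
    have h2 (b : Fin k → ℝ) : (Λ p).inverse (Λ p b) = b := by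
      rw [← hA, ContinuousLinearMap.inverse_equiv]
      exact A.symm_apply_apply b
    refine ⟨h1, h2, fun b => ⟨fun hb => ?_, ?_⟩⟩
    -- Subtracting integral parts moves a period into the unit cube without leaving the group of
    -- periods.
    · set t := (Λ p).inverse b with ht
      have h3 : Λ p (fun j => Int.fract (t j)) = b - Λ p fun j => (⌊t j⌋ : ℝ) := by
        rw [← h1 b, ← map_sub]
        rfl
      have h4 := AddSubgroup.sub_mem (W.periodSubgroup hφ (hφσ hpO)) hb (hint hpO fun j => ⌊t j⌋)
      rw [← h3] at h4
      obtain ⟨n, hn⟩ := (hB hp).2.2 _ ⟨fun j => Int.fract_nonneg _, fun j => (Int.fract_lt_one _).le⟩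
        (hB hp).1 h4
      refine ⟨fun j => ⌊t j⌋ + n j, ?_⟩
      rw [← h1 b]
      refine congrArg (Λ p) (funext fun j => ?_)
      have h5 : Int.fract (t j) = n j := congrFun hn j
      push_cast
      rw [← h5, Int.floor_add_fract]
    · rintro ⟨n, rfl⟩
      exact hint hpO n

end FlowModel

end Period

/-! ### The torus bundle -/

section Torus

variable {E : Type*} [NormedAddCommGroup E] [NormedSpace ℝ E] [FiniteDimensional ℝ E]
  {P : Type*} [TopologicalSpace P] [ChartedSpace E P] [IsManifold 𝓘(ℝ, E) ∞ P] [T2Space P]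
  {L : P → Type*} [TopologicalSpace (TotalSpace ℝ L)] [∀ p, TopologicalSpace (L p)]
  [∀ p, AddCommGroup (L p)] [∀ p, Module ℝ (L p)] [FiberBundle ℝ L] [VectorBundle ℝ ℝ L]
  [ContMDiffVectorBundle ∞ ℝ L 𝓘(ℝ, E)]
  {E' : Type*} [NormedAddCommGroup E'] [NormedSpace ℝ E'] [FiniteDimensional ℝ E']
  {M : Type*} [TopologicalSpace M] [ChartedSpace E' M] [IsManifold 𝓘(ℝ, E') ∞ M] [T2Space M]
  {L' : M → Type*} [TopologicalSpace (TotalSpace ℝ L')] [∀ m, TopologicalSpace (L' m)]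
  [∀ m, AddCommGroup (L' m)] [∀ m, Module ℝ (L' m)] [FiberBundle ℝ L'] [VectorBundle ℝ ℝ L']
  [∀ m, IsTopologicalAddGroup (L' m)] [∀ m, ContinuousSMul ℝ (L' m)]
  [ContMDiffVectorBundle ∞ ℝ L' 𝓘(ℝ, E')]
  {k : ℕ} {J : JacobiStructure E L} {C : ContactForm E' L'} {φ : M → P}
  {F : BundleComponent E L E' L' φ} {i : P}

variable [ChartedSpace (E × (Fin k → ℝ)) (kerAnchor J)]
    [IsManifold 𝓘(ℝ, E × (Fin k → ℝ)) ∞ (kerAnchor J)]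

theorem FlowModel.contMDiffAt_coordChart_symm {W : FlowModel J C F k i}
    (he : IsSmoothEmbedding 𝓘(ℝ, E × (Fin k → ℝ)) (𝓘(ℝ, E).prod 𝓘(ℝ, ℝ × (E →L[ℝ] ℝ))) ∞
      (Subtype.val : kerAnchor J → J1 E L)) {p : P} (hp : p ∈ W.U) (b : Fin k → ℝ) :
    ContMDiffAt (𝓘(ℝ, E).prod 𝓘(ℝ, Fin k → ℝ)) 𝓘(ℝ, E × (Fin k → ℝ)) ∞
      (fun x : P × (Fin k → ℝ) => W.coordChart.symm (chartAt E i x.1, x.2)) (p, b) := by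
  have h : (chartAt E i p, b) ∈ W.coordChart.target := by
    refine ⟨(chartAt E i).map_source (W.subset hp).1, ?_⟩
    rw [mem_preimage, (chartAt E i).left_inv (W.subset hp).1]
    exact hp
  have h1 : ContMDiffAt (𝓘(ℝ, E).prod 𝓘(ℝ, Fin k → ℝ)) 𝓘(ℝ, E × (Fin k → ℝ)) ∞
      (fun x : P × (Fin k → ℝ) => (chartAt E i x.1, x.2)) (p, b) := by
    refine ContMDiffAt.prodMk_space ?_ contMDiffAt_snd
    exact ContMDiffAt.comp (p, b) (g := chartAt E i)
      ((isSmoothChart_chartAt (E := E) i).contMDiffAt (W.subset hp).1) contMDiffAt_fst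
  exact ContMDiffAt.comp (p, b) (g := W.coordChart.symm)
    ((W.isSmoothChart_coordChart he).contMDiffOn_symm.contMDiffAt
      (W.coordChart.open_target.mem_nhds h)) h1

variable [ChartedSpace (E × (Fin k → ℝ)) (PeriodQuotient J C F)]

/-- A smooth basis of the periods trivialises the quotient of `ker ρ` by the period lattice. -/
theorem exists_torus_trivialization (hφ : IsContactIsotropicRealisation J C φ F)
    (hk : Module.finrank ℝ E' = Module.finrank ℝ E + k)
    (he : IsSmoothEmbedding 𝓘(ℝ, E × (Fin k → ℝ)) (𝓘(ℝ, E).prod 𝓘(ℝ, ℝ × (E →L[ℝ] ℝ))) ∞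
      (Subtype.val : kerAnchor J → J1 E L))
    (hq : IsLocalDiffeomorph 𝓘(ℝ, E × (Fin k → ℝ)) 𝓘(ℝ, E × (Fin k → ℝ)) ∞
      (Quot.mk (PeriodRel J C F))) (p₀ : P) :
    ∃ e : Trivialization (Fin k → Circle) (PeriodQuotient.proj : PeriodQuotient J C F → P),
      p₀ ∈ e.baseSet ∧
      ContMDiffOn 𝓘(ℝ, E × (Fin k → ℝ))
        (𝓘(ℝ, E).prod (ModelWithCorners.pi fun _ : Fin k => 𝓡 1)) ∞ e e.source ∧
      ContMDiffOn (𝓘(ℝ, E).prod (ModelWithCorners.pi fun _ : Fin k => 𝓡 1))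
        𝓘(ℝ, E × (Fin k → ℝ)) ∞ e.toOpenPartialHomeomorph.symm e.target := by
  obtain ⟨W⟩ := exists_flowModel hφ hk p₀
  obtain ⟨U, σ, hU, hpU, hσ, hσφ⟩ := W.exists_localSection hφ W.mem
  obtain ⟨Λ, Λ', B, hB, hpB, hBU, hΛs, hΛs', hΛ⟩ :=
    FlowModel.exists_smooth_periods_basis (W := W) hφ he hU hσ hσφ W.mem hpU
  have hpc := (contMDiff_periodQuotient_proj (C := C) (F := F) he hq).continuous
  let T : (Fin k → ℝ) → Fin k → Circle := fun t j => Circle.exp (2 * Real.pi * t j)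
  have hT (t t' : Fin k → ℝ) : T t = T t' ↔ ∃ n : Fin k → ℤ, t - t' = fun j => (n j : ℝ) := by
    have h1 (j : Fin k) : T t j = T t' j ↔ ∃ n : ℤ, t j - t' j = n := by
      refine Circle.exp_eq_exp.trans (exists_congr fun n => ?_)
      rw [mul_comm (n : ℝ), ← mul_add, mul_right_inj' Real.two_pi_pos.ne', sub_eq_iff_eq_add']
    rw [funext_iff]
    simp only [h1, Classical.skolem, funext_iff, Pi.sub_apply]
  -- Coordinates with respect to the basis of periods, reduced modulo integers, separate exactly the
  -- classes modulo Σ.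
  let G : kerAnchor J → P × (Fin k → Circle) := fun α => (α.1.proj, T (Λ' α.1.proj (W.coord α)))
  let S : P → (Fin k → ℝ) → kerAnchor J := fun p t => W.coordChart.symm (chartAt E p₀ p, Λ p t)
  have hS {p : P} (hp : p ∈ B) (t : Fin k → ℝ) : (S p t : J1 E L) = W.elem p (Λ p t) :=
    W.coe_coordChart_symm_chartAt (hBU hp).1 _
  have hSp {p : P} (hp : p ∈ B) (t : Fin k → ℝ) : (S p t).1.proj = p := by rw [hS hp]; rfl
  have hGS {p : P} (hp : p ∈ B) (t : Fin k → ℝ) : G (S p t) = (p, T t) := by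
    simp only [G]
    rw [hSp hp, hS hp, W.coord_elem (hBU hp).1, (hΛ p hp).2.1]
  have hGq {α β : kerAnchor J} (hα : α.1.proj ∈ B) :
      Quot.mk (PeriodRel J C F) α = Quot.mk (PeriodRel J C F) β ↔ G α = G β := by
    have hm := hσφ _ (hBU hα).2
    have hm' : φ (σ α.1.proj) ∈ W.U := by rw [hm]; exact (hBU hα).1
    rw [quotMk_eq_iff hφ hk (hBU hα).1 hm, ← FlowModel.flow_sub_eq_iff hφ hm', (hΛ _ hα).2.2,
      Prod.ext_iff, eq_comm]
    refine and_congr_right fun h => ?_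
    have h' : α.1.proj = β.1.proj := h
    simp only [G]
    rw [hT, ← h', ← map_sub]
    refine exists_congr fun n => ⟨fun h1 => ?_, fun h1 => ?_⟩
    · rw [h1, (hΛ _ hα).2.1]
    · rw [← h1, (hΛ _ hα).1]
  let D : PeriodQuotient J C F → P × (Fin k → Circle) := fun x => G x.out
  -- The argument is discontinuous on the circle, but any choice of logarithms gives the same class.
  -- Smoothness is therefore checked with logarithms that are smooth at the given point.
  let R : P × (Fin k → Circle) → PeriodQuotient J C F := fun y =>
    Quot.mk _ (S y.1 fun j => (2 * Real.pi)⁻¹ * Complex.arg (y.2 j))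
  have hD {α : kerAnchor J} (hα : α.1.proj ∈ B) : D (Quot.mk _ α) = G α := by
    have h1 := Quot.out_eq (Quot.mk (PeriodRel J C F) α)
    exact ((hGq hα).1 h1.symm).symm
  have hTf {z : Fin k → Circle} {t : Fin k → ℝ} (ht : ∀ j, Circle.exp (t j) = z j) :
      (T fun j => (2 * Real.pi)⁻¹ * t j) = z := by
    refine funext fun j => ?_
    simp only [T]
    rw [mul_inv_cancel_left₀ Real.two_pi_pos.ne', ht]
  have hR {p : P} (hp : p ∈ B) (t : Fin k → ℝ) : R (p, T t) = Quot.mk _ (S p t) := by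
    refine (hGq (by rw [hSp hp]; exact hp)).2 ?_
    rw [hGS hp, hGS hp, hTf fun j => Circle.exp_arg _]
  have hDs (x : PeriodQuotient J C F) (hx : x.proj ∈ B) : ContMDiffAt 𝓘(ℝ, E × (Fin k → ℝ))
      (𝓘(ℝ, E).prod (ModelWithCorners.pi fun _ : Fin k => 𝓡 1)) ∞ D x := by
    obtain ⟨α, rfl⟩ := Quot.mk_surjective x
    have hα : α.1.proj ∈ B := hx
    refine contMDiffAt_of_comp_isLocalDiffeomorphAt (hq α) ?_
    have h1 : ContMDiffAt 𝓘(ℝ, E × (Fin k → ℝ)) 𝓘(ℝ, E) ∞ (fun α : kerAnchor J => α.1.proj) α :=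
      ContMDiffAt.comp α (g := fun α : J1 E L => α.proj) (contMDiff_proj _ _) (he.contMDiff α)
    have h2 : ContMDiffAt 𝓘(ℝ, E × (Fin k → ℝ)) 𝓘(ℝ, Fin k → ℝ) ∞
        (fun α : kerAnchor J => Λ' α.1.proj (W.coord α)) α :=
      (ContMDiffAt.comp α (g := Λ') (hΛs'.contMDiffAt (hB.mem_nhds hα)) h1).clm_apply
        (ContMDiffAt.comp α (g := W.coord) (W.contMDiffAt_coord (hBU hα).1) (he.contMDiff α))
    have h3 : ContMDiffAt 𝓘(ℝ, E × (Fin k → ℝ))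
        (𝓘(ℝ, E).prod (ModelWithCorners.pi fun _ : Fin k => 𝓡 1)) ∞ G α := by
      refine h1.prodMk (contMDiffAt_pi_of fun j => ?_)
      refine ContMDiffAt.comp α (g := Circle.exp) contMDiff_circleExp.contMDiffAt ?_
      exact contMDiffAt_const.mul (contMDiffAt_pi_space.1 h2 j)
    refine h3.congr_of_eventuallyEq ?_
    filter_upwards [(hB.preimage FlowModel.continuous_proj_kerAnchor).mem_nhds hα] with β hβ
    exact hD hβ
  have hRs (y : P × (Fin k → Circle)) (hy : y.1 ∈ B) : ContMDiffAt
      (𝓘(ℝ, E).prod (ModelWithCorners.pi fun _ : Fin k => 𝓡 1)) 𝓘(ℝ, E × (Fin k → ℝ)) ∞ R y := by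
    choose f hf hf' using fun j => exists_circle_log (y.2 j)
    have h1 : ContMDiffAt (𝓘(ℝ, E).prod (ModelWithCorners.pi fun _ : Fin k => 𝓡 1))
        𝓘(ℝ, Fin k → ℝ) ∞
        (fun y : P × (Fin k → Circle) => fun j => (2 * Real.pi)⁻¹ * f j (y.2 j)) y := by
      refine contMDiffAt_pi_space.2 fun j => contMDiffAt_const.mul ?_
      exact ContMDiffAt.comp y (g := f j) (hf j)
        (ContMDiffAt.comp y (g := fun z : Fin k → Circle => z j)
          (contMDiff_pi_apply (I := fun _ : Fin k => 𝓡 1) (N := fun _ : Fin k => Circle) j _)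
          contMDiffAt_snd)
    have h2 : ContMDiffAt (𝓘(ℝ, E).prod (ModelWithCorners.pi fun _ : Fin k => 𝓡 1))
        𝓘(ℝ, (Fin k → ℝ) →L[ℝ] (Fin k → ℝ)) ∞ (fun y : P × (Fin k → Circle) => Λ y.1) y :=
      ContMDiffAt.comp y (g := Λ) (hΛs.contMDiffAt (hB.mem_nhds hy)) contMDiffAt_fst
    have h3 := ContMDiffAt.comp y
      (g := fun x : P × (Fin k → ℝ) => W.coordChart.symm (chartAt E p₀ x.1, x.2))
      (W.contMDiffAt_coordChart_symm he (hBU hy).1 _)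
      (contMDiffAt_fst.prodMk (h2.clm_apply h1))
    refine (ContMDiffAt.comp y (g := Quot.mk (PeriodRel J C F)) (hq.contMDiff _)
      h3).congr_of_eventuallyEq ?_
    filter_upwards [continuousAt_fst.eventually (hB.mem_nhds hy)] with y' hy'
    change R y' = Quot.mk _ (S y'.1 fun j => (2 * Real.pi)⁻¹ * f j (y'.2 j))
    rw [← hR hy', hTf fun j => hf' j _]
  let e : Trivialization (Fin k → Circle) (PeriodQuotient.proj : PeriodQuotient J C F → P) :=
    { toFun := D
      invFun := R
      source := PeriodQuotient.proj ⁻¹' B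
      target := B ×ˢ univ
      baseSet := B
      open_baseSet := hB
      source_eq := rfl
      target_eq := rfl
      open_source := hB.preimage hpc
      open_target := hB.prod isOpen_univ
      map_source' := by
        rintro ⟨α⟩ hα
        have hα' : α.1.proj ∈ B := hα
        refine ⟨?_, mem_univ _⟩
        rw [hD hα']
        exact hα'
      map_target' := by
        rintro ⟨p, z⟩ ⟨hp, -⟩
        change (S p _).1.proj ∈ B
        rw [hSp hp]
        exact hp
      left_inv' := by
        rintro ⟨α⟩ hα
        have hα' : α.1.proj ∈ B := hα
        rw [hD hα']
        refine (hR hα' _).trans ((hGq (by rw [hSp hα']; exact hα')).2 (hGS hα' _))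
      right_inv' := by
        rintro ⟨p, z⟩ ⟨hp, -⟩
        rw [hD (by rw [hSp hp]; exact hp), hGS hp, hTf fun j => Circle.exp_arg _]
      continuousOn_toFun := fun x hx => (hDs x hx).continuousAt.continuousWithinAt
      continuousOn_invFun := fun y hy => (hRs y hy.1).continuousAt.continuousWithinAt
      proj_toFun := by
        rintro ⟨α⟩ hα
        have hα' : α.1.proj ∈ B := hα
        exact congrArg Prod.fst (hD hα') }
  exact ⟨e, hpB, fun x hx => (hDs x hx).contMDiffWithinAt,
    fun y hy => (hRs y hy.1).contMDiffWithinAt⟩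

end Torus

end ContactRealisation

end

/-! ### The main theorem -/

theorem theorem3p9
    {E : Type*} [NormedAddCommGroup E] [NormedSpace ℝ E] [FiniteDimensional ℝ E]
    {P : Type*} [TopologicalSpace P] [T2Space P] [SecondCountableTopology P]
    [ChartedSpace E P] [IsManifold 𝓘(ℝ, E) ∞ P]
    {L : P → Type*} [TopologicalSpace (TotalSpace ℝ L)] [∀ p, TopologicalSpace (L p)]
    [∀ p, AddCommGroup (L p)] [∀ p, Module ℝ (L p)] [FiberBundle ℝ L] [VectorBundle ℝ ℝ L]
    [ContMDiffVectorBundle ∞ ℝ L 𝓘(ℝ, E)]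
    {E' : Type*} [NormedAddCommGroup E'] [NormedSpace ℝ E'] [FiniteDimensional ℝ E']
    {M : Type*} [TopologicalSpace M] [T2Space M] [SecondCountableTopology M]
    [ChartedSpace E' M] [IsManifold 𝓘(ℝ, E') ∞ M]
    {L' : M → Type*} [TopologicalSpace (TotalSpace ℝ L')] [∀ m, TopologicalSpace (L' m)]
    [∀ m, AddCommGroup (L' m)] [∀ m, Module ℝ (L' m)] [FiberBundle ℝ L'] [VectorBundle ℝ ℝ L']
    [∀ m, IsTopologicalAddGroup (L' m)] [∀ m, ContinuousSMul ℝ (L' m)]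
    [ContMDiffVectorBundle ∞ ℝ L' 𝓘(ℝ, E')]
    (k : ℕ) (hk : Module.finrank ℝ E' = Module.finrank ℝ E + k)
    (J : JacobiStructure E L) (C : ContactForm E' L') (φ : M → P)
    (F : BundleComponent E L E' L' φ) (hφ : IsContactIsotropicRealisation J C φ F) :
    -- the submanifold structure of `ker ρ ⊆ J¹L`
    ∃ (_ : ChartedSpace (E × (Fin k → ℝ)) (kerAnchor J)),
      IsManifold 𝓘(ℝ, E × (Fin k → ℝ)) ∞ (kerAnchor J) ∧
      IsSmoothEmbedding 𝓘(ℝ, E × (Fin k → ℝ)) (𝓘(ℝ, E).prod 𝓘(ℝ, ℝ × (E →L[ℝ] ℝ))) ∞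
        (Subtype.val : kerAnchor J → J1 E L) ∧
      -- `Σ` is a closed submanifold of `ker ρ`
      IsClosed (periodLattice J C F) ∧
      (∃ (_ : ChartedSpace E (periodLattice J C F)),
        IsManifold 𝓘(ℝ, E) ∞ (periodLattice J C F) ∧
        IsSmoothEmbedding 𝓘(ℝ, E) 𝓘(ℝ, E × (Fin k → ℝ)) ∞
          (Subtype.val : periodLattice J C F → kerAnchor J)) ∧
      -- the quotient manifold `ker ρ / Σ`
      T2Space (PeriodQuotient J C F) ∧ SecondCountableTopology (PeriodQuotient J C F) ∧
      ∃ (_ : ChartedSpace (E × (Fin k → ℝ)) (PeriodQuotient J C F)),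
        IsManifold 𝓘(ℝ, E × (Fin k → ℝ)) ∞ (PeriodQuotient J C F) ∧
        IsLocalDiffeomorph 𝓘(ℝ, E × (Fin k → ℝ)) 𝓘(ℝ, E × (Fin k → ℝ)) ∞
          (Quot.mk (PeriodRel J C F)) ∧
        -- `ker ρ / Σ → P` is a smooth fibre bundle with fibre the `k`-torus
        ContMDiff 𝓘(ℝ, E × (Fin k → ℝ)) 𝓘(ℝ, E) ∞
          (PeriodQuotient.proj : PeriodQuotient J C F → P) ∧
        (∀ p : P, ∃ e : Trivialization (Fin k → Circle)
            (PeriodQuotient.proj : PeriodQuotient J C F → P),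
          p ∈ e.baseSet ∧
          ContMDiffOn 𝓘(ℝ, E × (Fin k → ℝ))
            (𝓘(ℝ, E).prod (ModelWithCorners.pi fun _ : Fin k => 𝓡 1)) ∞ e e.source ∧
          ContMDiffOn (𝓘(ℝ, E).prod (ModelWithCorners.pi fun _ : Fin k => 𝓡 1))
            𝓘(ℝ, E × (Fin k → ℝ)) ∞ e.toOpenPartialHomeomorph.symm e.target) ∧
        -- the isomorphism `[α] ↦ φ¹_α(σ(π(α)))` induced by a smooth local section `σ`
        ∀ (U : Set P) (_ : IsOpen U) (σ : P → M) (_ : ContMDiffOn 𝓘(ℝ, E) 𝓘(ℝ, E') ∞ σ U)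
          (_ : ∀ p ∈ U, φ (σ p) = p),
          ∃ Ψ : PartialDiffeomorph 𝓘(ℝ, E × (Fin k → ℝ)) 𝓘(ℝ, E') (PeriodQuotient J C F) M ∞,
            Ψ.source = PeriodQuotient.proj ⁻¹' U ∧ Ψ.target = φ ⁻¹' U ∧
            (∀ α : kerAnchor J, α.1.proj ∈ U →
              FlowsTo C F α.1 (σ α.1.proj) (Ψ (Quot.mk _ α))) ∧
            ∀ x ∈ Ψ.source, φ (Ψ x) = x.proj := by
  obtain ⟨cs, hm, he⟩ := exists_kerAnchor_submanifold hφ hk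
  obtain ⟨cq, hqm, hq⟩ := exists_periodQuotient_manifold hφ hk he
  exact ⟨cs, hm, he, isClosed_periodLattice hφ hk he, exists_periodLattice_submanifold hφ hk he,
    t2Space_periodQuotient hφ hk he hq, secondCountableTopology_periodQuotient hφ hk he hq,
    cq, hqm, hq, contMDiff_periodQuotient_proj he hq, exists_torus_trivialization hφ hk he hq,
    fun U hU σ hσ hσφ => exists_flow_partialDiffeomorph hφ hk he hq hU hσ hσφ⟩
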